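/- Let $\mathbb T^2=\mathbb R^2/\mathbb Z^2$ with Lebesgue measure. For $0<\eta<1$ let $f:[0,1]\to[0,1]$ be $f(y)=y/(1-\eta)$ for $y\le 1-\eta$ and $f(y)=(1-y)/\eta$ for $y\ge 1-\eta$, and let $H=G\circ F:\mathbb T^2\to\mathbb T^2$ with $F(x,y)=(x+f(y),y)$ and $G(x,y)=(x,y+x)$. The map $H$ is differentiable off the singular set $S=\{y=0\}\cup\{y=1-\eta\}$, with Jacobian $DH_1=\begin{pmatrix}1&\frac1{1-\eta}\\1&1+\frac1{1-\eta}\end{pmatrix}$ for $0<y<1-\eta$ and $DH_0=\begin{pmatrix}1&-\frac1\eta\\1&1-\frac1\eta\end{pmatrix}$ for $1-\eta<y<1$. The Lyapunov exponent of $H^{\pm1}$ at $z$ in direction $v\neq0$ is $\limsup_{n\to\infty}\frac1n\log\|DH^{\pm n}_zv\|$. A local stable manifold $\gamma_s(z)$ of $H$ at $z$ is a line segment with $z$ in its interior, aligned with a direction whose Lyapunov exponent under $H$ is negative, such that $\mathrm{dist}(H^n\zeta,H^n\zeta')\to0$ as $n\to\infty$ for all $\zeta,\zeta'\in\gamma_s(z)$;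 a local unstable manifold $\gamma_u(z)$ of $H$ is a local stable manifold of $H^{-1}$. Let $X'$ be the set of $z\in\mathbb T^2$ such that $H^n(z)\notin S$ for all $n\in\mathbb Z$, all Lyapunov exponents of $H$ and of $H^{-1}$ at $z$ are non-zero, and $z$ has a local stable and a local unstable manifold. Let $\mathfrak M_1=DH_1^{-1}$, $\mathfrak M_2=DH_1^{-1}DH_0^{-1}$, $\mathfrak M_3=DH_1^{-1}DH_0^{-2}$, let $\mathcal C'$ be the cone of non-zero vectors whose gradient lies between those of the unstable eigenvectors of $\mathfrak M_1$ and $\mathfrak M_3$ (inclusive), and let $\mathcal K_i(\eta)=\inf_{v\in\mathcal C'}\|\mathfrak M_iv\|_\infty/\|v\|_\infty$. Let $\eta_1$ be the supremum of the $t\in(0,\frac13]$ such that $$\mathcal K_3(\eta)>\frac1{1-\frac1{\mathcal K_1(\eta)}-\frac1{\mathcal K_2(\eta)}}\qquad\text{for all }0<\eta<t.$$ Then $\eta_1\approx0.324$ (to three decimals, $|\eta_1-0.324|<0.0005$), and for every $0<\eta<\eta_1$ the set $X'$ has full Lebesgue measure and condition (M) holds for $H$: for all $z,z'\in X'$, every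 local unstable manifold $\gamma_u(z)$ at $z$ and every local stable manifold $\gamma_s(z')$ at $z'$, there are integers $m,n\ge0$ with $$H^m(\gamma_u(z))\cap H^{-n}(\gamma_s(z'))\neq\emptyset .$$ -/

import Mathlib

open MeasureTheory Filter Topology Set

namespace ToralShear

noncomputable section

/-- The two-torus `ℝ² / ℤ²`, with its Lebesgue (Haar) probability measure `volume`. -/
abbrev Torus : Type := UnitAddCircle × UnitAddCircle

/-- The representative in `[0, 1)` of a point of the circle. -/
def rep (y : UnitAddCircle) : ℝ := (AddCircle.equivIco (1 : ℝ) 0 y : ℝ)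

/-- The projection `ℝ² → 𝕋²`. -/
def proj (v : Fin 2 → ℝ) : Torus := ((v 0 : UnitAddCircle), (v 1 : UnitAddCircle))

/-- The non-monotonic shear profile on `[0, 1]`: it increases from `0` to `1` on `[0, 1 - η]` and
decreases from `1` to `0` on `[1 - η, 1]`. -/
def profile (η y : ℝ) : ℝ := if y ≤ 1 - η then y / (1 - η) else (1 - y) / η

/-- The horizontal shear `F (x, y) = (x + f y, y)`. -/
def shearF (η : ℝ) : Equiv.Perm Torus where
  toFun z := (z.1 + (profile η (rep z.2) : UnitAddCircle), z.2)
  invFun z := (z.1 - (profile η (rep z.2) : UnitAddCircle), z.2)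
  left_inv z := by simp
  right_inv z := by simp

/-- The vertical shear `G (x, y) = (x, y + x)`. -/
def shearG : Equiv.Perm Torus where
  toFun z := (z.1, z.2 + z.1)
  invFun z := (z.1, z.2 - z.1)
  left_inv z := by simp
  right_inv z := by simp

/-- The toral map `H = G ∘ F`. -/
def mapH (η : ℝ) : Equiv.Perm Torus := shearG * shearF η

/-- The Jacobian matrix of `H` on the strip `A = {0 < y < 1 - η}`. -/
def jacA (η : ℝ) : Matrix (Fin 2) (Fin 2) ℝ := !![1, 0; 1, 1] * !![1, 1 / (1 - η); 0, 1]

/-- The Jacobian matrix of `H` on the strip `{1 - η < y < 1}`. -/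
def jacB (η : ℝ) : Matrix (Fin 2) (Fin 2) ℝ := !![1, 0; 1, 1] * !![1, -(1 / η); 0, 1]

/-- The Jacobian matrix of `H` at `z`. It is the derivative of `H` off `singularSet η`; its value
on `singularSet η` is never used. -/
def jacH (η : ℝ) (z : Torus) : Matrix (Fin 2) (Fin 2) ℝ :=
  if rep z.2 < 1 - η then jacA η else jacB η

/-- The Jacobian matrix of `H⁻¹` at `z`. -/
def jacHinv (η : ℝ) (z : Torus) : Matrix (Fin 2) (Fin 2) ℝ := (jacH η ((mapH η)⁻¹ z))⁻¹

/-- The lines `y = 0` and `y = 1 - η`, where `H` fails to be differentiable. -/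
def singularSet (η : ℝ) : Set Torus :=
  {z | z.2 = 0 ∨ z.2 = ((1 - η : ℝ) : UnitAddCircle)}

/-! ### Lyapunov exponents and local stable manifolds of a toral map `T` with Jacobian `D` -/

/-- The Jacobian matrix of `T ^ n` at `z`, by the chain rule. -/
def cocycle (T : Equiv.Perm Torus) (D : Torus → Matrix (Fin 2) (Fin 2) ℝ) :
    ℕ → Torus → Matrix (Fin 2) (Fin 2) ℝ
  | 0, _ => 1
  | n + 1, z => D ((T ^ n) z) * cocycle T D n z

/-- The Lyapunov exponent of `T` at `z` in the direction `v`. -/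
def lyapunov (T : Equiv.Perm Torus) (D : Torus → Matrix (Fin 2) (Fin 2) ℝ)
    (z : Torus) (v : Fin 2 → ℝ) : ℝ :=
  limsup (fun n : ℕ => (1 / (n : ℝ)) * Real.log ‖(cocycle T D n z).mulVec v‖) atTop

/-- The segment on the torus through `z` in the direction `v`, from `z - a v` to `z + b v`. -/
def seg (z : Torus) (v : Fin 2 → ℝ) (a b : ℝ) : Set Torus :=
  (fun t : ℝ => z + proj (t • v)) '' Icc (-a) b

/-- `γ` is a local stable manifold of `T` at `z`: a line segment with `z` in its interior, aligned
with the stable direction at `z`, whose points are forward asymptotic to each other. -/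
def IsLocalStable (T : Equiv.Perm Torus) (D : Torus → Matrix (Fin 2) (Fin 2) ℝ)
    (z : Torus) (γ : Set Torus) : Prop :=
  (∃ (v : Fin 2 → ℝ) (a b : ℝ), v ≠ 0 ∧ lyapunov T D z v < 0 ∧ 0 < a ∧ 0 < b ∧
    γ = seg z v a b) ∧
  ∀ ζ ∈ γ, ∀ ζ' ∈ γ, Tendsto (fun n : ℕ => dist ((T ^ n) ζ) ((T ^ n) ζ')) atTop (𝓝 0)

/-- `γ = γ_s(z)` is a local stable manifold of `H` at `z`. -/
def IsStableManifold (η : ℝ) (z : Torus) (γ : Set Torus) : Prop :=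
  IsLocalStable (mapH η) (jacH η) z γ

/-- `γ = γ_u(z)` is a local unstable manifold of `H` at `z`: a local stable manifold of `H⁻¹`. -/
def IsUnstableManifold (η : ℝ) (z : Torus) (γ : Set Torus) : Prop :=
  IsLocalStable (mapH η)⁻¹ (jacHinv η) z γ

/-- The set `X'`: the full orbit of `z` avoids the singular set, all Lyapunov exponents at `z` (of
`H` and of `H⁻¹`) are non-zero, and there are local stable and unstable manifolds at `z`. -/
def regularSet (η : ℝ) : Set Torus :=
  {z | (∀ n : ℤ, (mapH η ^ n) z ∉ singularSet η) ∧
    (∀ v : Fin 2 → ℝ, v ≠ 0 → lyapunov (mapH η) (jacH η) z v ≠ 0 ∧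
      lyapunov (mapH η)⁻¹ (jacHinv η) z v ≠ 0) ∧
    (∃ γ, IsStableManifold η z γ) ∧ ∃ γ, IsUnstableManifold η z γ}

/-- Condition (M): some forward image of the local unstable manifold at `z` meets some backward
image of the local stable manifold at `z'`, for any `z, z' ∈ X'`. -/
def ConditionM (η : ℝ) : Prop :=
  ∀ z ∈ regularSet η, ∀ z' ∈ regularSet η, ∀ γu γs : Set Torus,
    IsUnstableManifold η z γu → IsStableManifold η z' γs →
    ∃ m n : ℕ, (((mapH η ^ m : Equiv.Perm Torus) '' γu) ∩
      (((mapH η)⁻¹ ^ n : Equiv.Perm Torus) '' γs)).Nonempty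

/-! ### The threshold `η₁` -/

/-- The Jacobian matrices of the return map under `H⁻¹`, for return times 1, 2 and 3. -/
def returnMatrix (η : ℝ) : Fin 3 → Matrix (Fin 2) (Fin 2) ℝ :=
  ![(jacA η)⁻¹, (jacA η)⁻¹ * (jacB η)⁻¹, (jacA η)⁻¹ * (jacB η)⁻¹ * (jacB η)⁻¹]

/-- `g` is the gradient of an unstable eigenvector of `M`. -/
def IsUnstableGradient (M : Matrix (Fin 2) (Fin 2) ℝ) (g : ℝ) : Prop :=
  ∃ μ : ℝ, 1 < |μ| ∧ M.mulVec ![1, g] = μ • ![1, g]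

/-- The cone of non-zero vectors bounded by (and containing) the unstable eigenvectors of the
return matrices for the return times 1 and 3. -/
def cone (η : ℝ) : Set (Fin 2 → ℝ) :=
  {v | ∃ g₁ g₃ g t : ℝ, IsUnstableGradient (returnMatrix η 0) g₁ ∧
    IsUnstableGradient (returnMatrix η 2) g₃ ∧ g₁ ≤ g ∧ g ≤ g₃ ∧ t ≠ 0 ∧ v = t • ![1, g]}

/-- The minimal expansion of the `i`-th return matrix on the cone, in the sup norm. -/
def minExpansion (η : ℝ) (i : Fin 3) : ℝ :=
  sInf ((fun v : Fin 2 → ℝ => ‖(returnMatrix η i).mulVec v‖ / ‖v‖) '' cone η)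

/-- The threshold: the largest `t ≤ 1/3` such that the expansion inequality holds on `(0, t)`. -/
def eta1 : ℝ :=
  sSup {t : ℝ | 0 < t ∧ t ≤ 1 / 3 ∧ ∀ η : ℝ, 0 < η → η < t →
    minExpansion η 2 > 1 / (1 - 1 / minExpansion η 0 - 1 / minExpansion η 1)}

end

end ToralShear

/-! In the coordinates `(y, s)` with `s = y - x`, the map `H` is the second order recursion `(y, s)
↦ (2y - s + f y, y)`. Exchanging `y` and `s` therefore conjugates `H` to `H⁻¹`, so it is enough to
treat stable directions and backward images; the unstable ones follow by reflection.

Full measure. An orbit off the singular lines visits the strip `A = {0 < y < 1 - η}` at least once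
in any three consecutive steps. The three return matrices of `H⁻¹` preserve the cone of slopes `s /
y ∈ [μ, r]`. There the sup norm equals `|x|`, and the least expansion factors `K₁, K₂, K₃` (`rateA`,
`rateAB`, `rateABB`) are attained at slope `r`. The inequality that defines `η₁` says `1/K₁ + 1/K₂ +
1/K₃ < 1`; in particular every `Kᵢ` exceeds `1`. Pulling cone directions back from later and later
visits, compactness yields a contracted direction at each point of `A` (`exists_contracted`). Since
`H` preserves area, every other direction expands (`Expanding.rate_dichotomy`), so no exponent
vanishes. By Borel–Cantelli almost every orbit approaches the singular lines more slowly than the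
contraction rate, so a short segment in the contracted direction is never cut and is a stable
manifold.

Condition (M). Every stable segment has a backward image containing a segment in the cone over `[0,
1 - η]`. The singular lines cut such a segment into pieces with different return times. Unless some
image already crosses the square `[0, 1 - η]²` from bottom to top, there is at most one piece for
each return time, and `∑ 1/Kᵢ < 1` forces the image of one of them to be longer than the whole by a
fixed factor (`HasLength.grow`). Extents are bounded, so a crossing must occur
(`HasLength.crosses`). In the exceptional cases the segment traverses the singular strip or the
region of return time three; an explicit image of it then straddles, at a corner of the square that
is a fixed point, the direction contracted by `H⁻¹`, and is stretched across the square
(`Straddles.crosses`). By reflection a forward image of each unstable segment crosses the square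
from left to right, and two such crossings meet (`exists_crossing`).

The threshold. The gradient `-κ` bounding the cone solves a quadratic equation, and elementary
estimates of its root show that the inequality holds up to `0.3236` and fails at `0.3244`
(`eta1_bounds`). -/

namespace ToralShear

/-! ### Families of planar segments closed under the lifted dynamics

In the coordinates `(y, s)`, `s = y - x`, the map `H⁻¹` lifts to `(y, s) ↦ (s, (2 + a) s - y)` for
`s ∈ [0, 1 - η]` and to `(y, s) ↦ (s, - t s - y)` for `s ∈ [-η, 0]`, where `a = 1 / (1 - η)` and
`t = 1 / η - 2`. -/

/-- A family of segments (given by their end points) closed under taking subsegments, integer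
translations and the two affine branches of the lift of `H⁻¹`. -/
structure SegClosed (η a t : ℝ) (R : ℝ → ℝ → ℝ → ℝ → Prop) : Prop where
  sub : ∀ {y s y' s' u v : ℝ}, R y s y' s' → 0 ≤ u → u ≤ 1 → 0 ≤ v → v ≤ 1 →
    R (y + u * (y' - y)) (s + u * (s' - s)) (y + v * (y' - y)) (s + v * (s' - s))
  shift : ∀ {y s y' s' : ℝ}, R y s y' s' → ∀ m n : ℤ, R (y + m) (s + n) (y' + m) (s' + n)
  stepA : ∀ {y s y' s' : ℝ}, R y s y' s' → 0 ≤ s → s ≤ 1 - η → 0 ≤ s' → s' ≤ 1 - η →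
    R s ((2 + a) * s - y) s' ((2 + a) * s' - y')
  stepB : ∀ {y s y' s' : ℝ}, R y s y' s' → -η ≤ s → s ≤ 0 → -η ≤ s' → s' ≤ 0 →
    R s (-t * s - y) s' (-t * s' - y')

/-- Some segment of the family crosses the square `[0, 1 - η]²` from bottom to top. -/
def Crosses (η : ℝ) (R : ℝ → ℝ → ℝ → ℝ → Prop) : Prop :=
  ∃ y₀ y₁, 0 ≤ y₀ ∧ y₀ ≤ y₁ ∧ y₁ ≤ 1 - η ∧ R y₀ 0 y₁ (1 - η)

/-- The image of a family under the central symmetry of the square. -/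
def flip (η : ℝ) (R : ℝ → ℝ → ℝ → ℝ → Prop) (y s y' s' : ℝ) : Prop :=
  R (1 - η - y) (1 - η - s) (1 - η - y') (1 - η - s')

section closed

variable {η a t : ℝ} {R : ℝ → ℝ → ℝ → ℝ → Prop}

lemma SegClosed.symm (hR : SegClosed η a t R) {y s y' s' : ℝ} (h : R y s y' s') :
    R y' s' y s := by
  have := hR.sub h (u := 1) (v := 0) (by norm_num) (by norm_num) (by norm_num) (by norm_num)
  simpa using this

lemma SegClosed.shift_snd (hR : SegClosed η a t R) {y s y' s' : ℝ} (h : R y s y' s') (n : ℤ) :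
    R y (s + n) y' (s' + n) := by
  simpa using hR.shift h 0 n

lemma SegClosed.sub_dir (hR : SegClosed η a t R) {y s d ρ u v : ℝ}
    (h : R y s (y + d) (s + ρ * d)) (hd : 0 < d) (hu : 0 ≤ u) (hu' : u ≤ d) (hv : 0 ≤ v)
    (hv' : v ≤ d) : R (y + u) (s + ρ * u) (y + v) (s + ρ * v) := by
  have := hR.sub h (u := u / d) (v := v / d) (by positivity) ((div_le_one hd).2 hu')
    (by positivity) ((div_le_one hd).2 hv')
  have e1 : ∀ w : ℝ, w / d * (y + d - y) = w := fun w => by field_simp; ring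
  have e2 : ∀ w : ℝ, w / d * (s + ρ * d - s) = ρ * w := fun w => by field_simp; ring
  simpa only [e1, e2] using this

/-- The central symmetry of the square commutes with both branches up to integer translations. It
exchanges the fixed corners `(0, 0)` and `(1 - η, 1 - η)`, which halves the later case distinctions.
-/
lemma SegClosed.flip (hR : SegClosed η a t R) (ha : a * (1 - η) = 1) (ht : t * η = 1 - 2 * η) :
    SegClosed η a t (flip η R) where
  sub {y s y' s' u v} h h1 h2 h3 h4 := by
    have := hR.sub h h1 h2 h3 h4
    unfold ToralShear.flip
    convert this using 1 <;> ring
  shift {y s y' s'} h m n := by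
    have := hR.shift h (-m) (-n)
    unfold ToralShear.flip
    convert this using 1 <;> push_cast <;> ring
  stepA {y s y' s'} h h1 h2 h3 h4 := by
    have := hR.shift_snd (hR.stepA h (by linarith) (by linarith) (by linarith) (by linarith)) (-1)
    unfold ToralShear.flip
    convert this using 1 <;> push_cast <;> linarith
  stepB {y s y' s'} h h1 h2 h3 h4 := by
    have h5 := hR.shift_snd h (-1)
    have := hR.shift (hR.stepB h5 (by push_cast; linarith) (by push_cast; linarith)
      (by push_cast; linarith) (by push_cast; linarith)) 1 1
    unfold ToralShear.flip
    convert this using 1 <;> push_cast <;> linarith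

lemma SegClosed.crosses_of_flip (hR : SegClosed η a t R) (h : Crosses η (ToralShear.flip η R)) :
    Crosses η R := by
  obtain ⟨y₀, y₁, h0, h1, h2, h3⟩ := h
  refine ⟨1 - η - y₁, 1 - η - y₀, by linarith, by linarith, by linarith, ?_⟩
  have := hR.symm h3
  simpa using this

end closed

/-! ### Segments crossing the local unstable manifold of the fixed point -/

/-- A segment of the family over `[0, 1 - η]`, of slope at least one, whose end points lie on
either side of the line `y = μ s`. -/
structure Straddles (η μ : ℝ) (R : ℝ → ℝ → ℝ → ℝ → Prop) (y s y' s' : ℝ) : Prop where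
  nonneg : 0 ≤ y
  lt : y < y'
  le : y' ≤ 1 - η
  slope : y' - y ≤ s' - s
  neg : μ * s - y < 0
  pos : 0 < μ * s' - y'
  mem : R y s y' s'

section straddles

variable {η a t μ : ℝ} {R : ℝ → ℝ → ℝ → ℝ → Prop} {y s y' s' : ℝ}

/-- Cutting at `s = 0` keeps the lower end on its side of `y = μ s`, because `y` is positive there.
-/
lemma Straddles.clip_low (hR : SegClosed η a t R) (hμ : 1 < μ) (h : Straddles η μ R y s y' s') :
    ∃ y₁ s₁, Straddles η μ R y₁ s₁ y' s' ∧ 0 ≤ s₁ ∧ (s₁ = 0 ∨ y₁ = y ∧ s₁ = s) := by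
  obtain ⟨h1, h2, h3, h4, h5, h6, h7⟩ := h
  rcases le_or_gt 0 s with hs | hs
  · exact ⟨y, s, ⟨h1, h2, h3, h4, h5, h6, h7⟩, hs, Or.inr ⟨rfl, rfl⟩⟩
  have hs' : 0 < s' := by
    by_contra hc
    nlinarith
  have hd : 0 < s' - s := by linarith
  obtain ⟨u, hu⟩ : ∃ u, u = -s / (s' - s) := ⟨_, rfl⟩
  have hus : u * (s' - s) = -s := by rw [hu]; field_simp
  have hu0 : 0 < u := by rw [hu]; exact div_pos (by linarith) hd
  have hu1 : u < 1 := by rw [hu, div_lt_one hd]; linarith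
  refine ⟨y + u * (y' - y), 0, ⟨?_, ?_, h3, ?_, ?_, h6, ?_⟩, le_rfl, Or.inl rfl⟩
  · nlinarith
  · nlinarith
  · nlinarith
  · nlinarith
  · have := hR.sub h7 hu0.le hu1.le zero_le_one le_rfl
    rw [hus] at this
    simpa using this

/-- Cutting at `s = 1 - η` keeps the upper end on its side, because `y ≤ 1 - η < μ (1 - η)` there.
-/
lemma Straddles.clip_high (hR : SegClosed η a t R) (hμ : 1 < μ) (h : Straddles η μ R y s y' s') :
    ∃ y₁ s₁, Straddles η μ R y s y₁ s₁ ∧ s₁ ≤ 1 - η ∧ (s₁ = 1 - η ∨ y₁ = y' ∧ s₁ = s') := by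
  obtain ⟨h1, h2, h3, h4, h5, h6, h7⟩ := h
  rcases le_or_gt s' (1 - η) with hs | hs
  · exact ⟨y', s', ⟨h1, h2, h3, h4, h5, h6, h7⟩, hs, Or.inr ⟨rfl, rfl⟩⟩
  have hs' : s < 1 - η := by
    by_contra hc
    nlinarith
  have hd : 0 < s' - s := by linarith
  obtain ⟨u, hu⟩ : ∃ u, u = (1 - η - s) / (s' - s) := ⟨_, rfl⟩
  have hus : u * (s' - s) = 1 - η - s := by rw [hu]; field_simp
  have hu0 : 0 < u := by rw [hu]; exact div_pos (by linarith) hd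
  have hu1 : u < 1 := by rw [hu, div_lt_one hd]; linarith
  have hyu : y + u * (y' - y) < y' := by nlinarith
  refine ⟨y + u * (y' - y), 1 - η, ⟨h1, ?_, by linarith, ?_, h5, ?_, ?_⟩, le_rfl, Or.inl rfl⟩
  · nlinarith
  · nlinarith
  · nlinarith
  · have := hR.sub h7 le_rfl zero_le_one hu0.le hu1.le
    rw [hus] at this
    simpa using this

lemma Straddles.clip (hR : SegClosed η a t R) (hμ : 1 < μ) (h : Straddles η μ R y s y' s') :
    ∃ y₁ s₁ y₂ s₂, Straddles η μ R y₁ s₁ y₂ s₂ ∧ 0 ≤ s₁ ∧ s₂ ≤ 1 - η ∧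
      (s₁ = 0 ∨ y₁ = y ∧ s₁ = s) ∧ (s₂ = 1 - η ∨ y₂ = y' ∧ s₂ = s') := by
  obtain ⟨y₁, s₁, h1, h2, h3⟩ := h.clip_low hR hμ
  obtain ⟨y₂, s₂, h4, h5, h6⟩ := h1.clip_high hR hμ
  exact ⟨y₁, s₁, y₂, s₂, h4, h2, h5, h3, h6⟩

lemma Straddles.step (hR : SegClosed η a t R) (ha : 0 < a) (hμ : 1 < μ)
    (hμa : μ ^ 2 + 1 = (2 + a) * μ) (h : Straddles η μ R y s y' s') (hs : 0 ≤ s)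
    (hs' : s' ≤ 1 - η) : Straddles η μ R s ((2 + a) * s - y) s' ((2 + a) * s' - y') := by
  obtain ⟨h1, h2, h3, h4, h5, h6, h7⟩ := h
  -- The functional `μ s - y` is a left eigenvector of branch `A` with eigenvalue `μ`; its kernel is
  -- the direction contracted by `H⁻¹`.
  have key : ∀ y s : ℝ, μ * ((2 + a) * s - y) - s = μ * (μ * s - y) := fun y s => by
    linear_combination (-s) * hμa
  refine ⟨hs, by linarith, hs', ?_, ?_, ?_, hR.stepA h7 hs (by linarith) (by linarith) hs'⟩
  · nlinarith
  · rw [key]; nlinarith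
  · rw [key]; nlinarith

/-- A segment that crosses the unstable direction at the corner of the square is stretched until it
crosses the whole square. -/
lemma Straddles.crosses (hR : SegClosed η a t R) (ha : 0 < a) (hη : η < 1) (hμ : 1 < μ)
    (hμa : μ ^ 2 + 1 = (2 + a) * μ) (h : Straddles η μ R y s y' s') : Crosses η R := by
  obtain ⟨δ, hδ, hδ1, hδ2⟩ : ∃ δ > 0, μ * s - y ≤ -δ ∧ δ ≤ μ * s' - y' :=
    ⟨min (y - μ * s) (μ * s' - y'), lt_min (by linarith [h.neg]) h.pos,
      by linarith [min_le_left (y - μ * s) (μ * s' - y')], min_le_right _ _⟩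
  have key : ∀ y s : ℝ, μ * ((2 + a) * s - y) - s = μ * (μ * s - y) := fun y s => by
    linear_combination (-s) * hμa
  -- After `n` steps each end either lies on the boundary of the square or has been moved by a
  -- factor `μ ^ n` away from the line `y = μ s`.
  have main : ∀ n : ℕ, ∃ y s y' s', Straddles η μ R y s y' s' ∧ 0 ≤ s ∧ s' ≤ 1 - η ∧
      (s = 0 ∨ μ * s - y ≤ -(μ ^ n * δ)) ∧ (s' = 1 - η ∨ μ ^ n * δ ≤ μ * s' - y') := by
    intro n
    induction n with
    | zero =>
      obtain ⟨y₁, s₁, y₂, s₂, h1, h2, h3, h4, h5⟩ := h.clip hR hμ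
      refine ⟨y₁, s₁, y₂, s₂, h1, h2, h3, ?_, ?_⟩
      · rcases h4 with h4 | ⟨rfl, rfl⟩
        · exact Or.inl h4
        · right; simpa using hδ1
      · rcases h5 with h5 | ⟨rfl, rfl⟩
        · exact Or.inl h5
        · right; simpa using hδ2
    | succ n ih =>
      obtain ⟨y, s, y', s', h1, h2, h3, h4, h5⟩ := ih
      obtain ⟨y₁, s₁, y₂, s₂, g1, g2, g3, g4, g5⟩ := (h1.step hR ha hμ hμa h2 h3).clip hR hμ
      refine ⟨y₁, s₁, y₂, s₂, g1, g2, g3, ?_, ?_⟩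
      · rcases g4 with g4 | ⟨rfl, rfl⟩
        · exact Or.inl g4
        rcases h4 with rfl | h4
        -- An end with `s = 0` and `y > 0` is mapped below the square, so it is clipped again. The
        -- same happens above the square to an end with `s' = 1 - η`.
        · exact absurd h1.neg (by linarith)
        · right
          rw [key, pow_succ]; nlinarith
      · rcases g5 with g5 | ⟨rfl, rfl⟩
        · exact Or.inl g5
        rcases h5 with rfl | h5
        · exfalso
          have := h1.le
          have : 0 < a * (1 - η) := mul_pos ha (by linarith)
          linarith
        · right
          rw [key, pow_succ]; nlinarith
  obtain ⟨n, hn⟩ := pow_unbounded_of_one_lt (μ * (1 - η) / δ) hμ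
  rw [div_lt_iff₀ hδ] at hn
  obtain ⟨y, s, y', s', h1, h2, h3, h4, h5⟩ := main n
  have e1 := h1.nonneg
  have e2 := h1.lt
  have e3 := h1.le
  have hs : s = 0 := by
    rcases h4 with h4 | h4
    · exact h4
    · nlinarith
  have hs' : s' = 1 - η := by
    rcases h5 with h5 | h5
    · exact h5
    · nlinarith
  subst hs hs'
  exact ⟨y, y', e1, e2.le, e3, h1.mem⟩

end straddles

/-! ### Parameters -/

/-- The slopes and rates attached to a parameter `η`: `a` and `t` are those of the two branches,
`μ` is the unstable eigenvalue of the first return matrix, and `[μ, r]` is the invariant cone of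
slopes in the coordinates `(y, s)`, with `κ = 1 / (r - 1)`. -/
structure Rates (η a t μ r κ : ℝ) : Prop where
  pos : 0 < η
  lt : η < 0.3245
  ha : a * (1 - η) = 1
  ht : t * η = 1 - 2 * η
  one_lt : 1 < μ
  hμ : μ ^ 2 + 1 = (2 + a) * μ
  hr : (r - (2 + a)) * ((t ^ 2 - 1) * r + t) = t * r + 1
  lt_r : 2 + a < r
  hκ : κ * (r - 1) = 1

/-- The least expansion factors of the three return matrices on the cone. -/
def rateA (a κ : ℝ) : ℝ := 1 + a + a * κ

/-- See `rateA`. -/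
def rateAB (a t κ : ℝ) : ℝ := (1 + a) * t + 1 + ((1 + a) * (1 + t) + 1) * κ

/-- See `rateA`. -/
def rateABB (a t κ : ℝ) : ℝ :=
  t ^ 2 + t - 1 + a * (t ^ 2 - 1) + ((1 + a) * t ^ 2 + (2 + a) * t - a) * κ

/-! ### Numerical bounds on the parameters -/

section rates

variable {η a t μ r κ : ℝ}

lemma Rates.one_lt_a (P : Rates η a t μ r κ) : 1 < a := by
  have := P.pos; have := P.lt; have := P.ha
  by_contra hc
  nlinarith

lemma Rates.a_lt (P : Rates η a t μ r κ) : a < 1.481 := by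
  have := P.pos; have := P.lt; have := P.ha
  by_contra hc
  nlinarith

lemma Rates.lt_t (P : Rates η a t μ r κ) : 1.0816 < t := by
  have := P.pos; have := P.lt; have := P.ht
  by_contra hc
  nlinarith

lemma Rates.lt_μ (P : Rates η a t μ r κ) : 2.6 < μ := by
  have := P.one_lt_a; have := P.one_lt; have := P.hμ
  by_contra hc
  nlinarith

lemma Rates.μ_lt (P : Rates η a t μ r κ) : μ < 3.17 := by
  have := P.a_lt; have := P.one_lt; have := P.hμ
  by_contra hc
  nlinarith

lemma Rates.μ_lt_r (P : Rates η a t μ r κ) : μ < r := by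
  have := P.lt_r; have := P.one_lt; have := P.hμ
  by_contra hc
  nlinarith

/-- This is the source of the factor `10` in `crosses_of_traverse_strip`. -/
lemma Rates.r_lt (P : Rates η a t μ r κ) : r < 10 := by
  have h1 := P.a_lt; have h2 := P.lt_t; have h3 := P.hr; have h4 := P.lt_r
  have h5 := P.one_lt_a
  by_contra hc
  push Not at hc
  have e1 : 6.519 * ((t ^ 2 - 1) * r + t) ≤ t * r + 1 := by
    rw [← h3]
    have : 0 < (t ^ 2 - 1) * r + t := by nlinarith
    nlinarith
  have e2 : 0.157 * t ≤ t ^ 2 - 1 := by nlinarith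
  nlinarith [mul_le_mul_of_nonneg_right e2 (by linarith : (0 : ℝ) ≤ r)]

lemma Rates.κ_pos (P : Rates η a t μ r κ) : 0 < κ := by
  have h1 := P.lt_r; have h2 := P.hκ; have h3 := P.one_lt_a
  by_contra hc
  nlinarith

end rates

end ToralShear


namespace ToralShear

/-! ### Segments traversing the region of return time three or the singular strip -/

section traverse

variable {η a t μ r κ : ℝ} {R : ℝ → ℝ → ℝ → ℝ → Prop}

/-- The region of return time three is `-η ≤ s ≤ 0`, `0 ≤ y + t s ≤ η`, where branch `B` applies
twice. The image under `B`, `B`, `A`, lowered by one in `s`, straddles `y = μ s` precisely because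
`μ σ₀ < 1`. -/
lemma crosses_of_traverse_BB_aux (P : Rates η a t μ r κ) (hR : SegClosed η a t R) {σ₀ σ₁ : ℝ}
    (h1 : 0 ≤ σ₁) (h2 : σ₁ ≤ σ₀) (h3 : σ₀ ≤ η) (h4 : t * (σ₀ - σ₁) < η) (h5 : μ * σ₀ < 1)
    (h : R (t * σ₀) (-σ₀) (t * σ₁ + η) (-σ₁)) : Crosses η R := by
  have hη := P.pos; have hη' := P.lt; have ht := P.ht; have ha := P.ha
  have hμ := P.hμ; have hμ1 := P.lt_μ; have ht1 := P.lt_t; have ha1 := P.one_lt_a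
  have ha2 := P.a_lt
  have r1 := hR.stepB h (by linarith) (by linarith) (by linarith) (by linarith)
  have r2 := hR.stepB r1 (by linarith) (by linarith) (by linarith) (by linarith)
  have r3 := hR.stepA r2 (by linarith) (by linarith) (by linarith) (by linarith)
  have r4 := hR.shift_snd r3 (-1)
  have hσ : σ₀ - σ₁ < 0.31 := by nlinarith
  have e1 : -t * (-t * -σ₀ - t * σ₀) - -σ₀ = σ₀ := by ring
  have e2 : -t * (-t * -σ₁ - (t * σ₁ + η)) - -σ₁ = 1 - 2 * η + σ₁ := by linear_combination ht
  rw [e1, e2] at r4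
  refine Straddles.crosses (μ := μ) hR (by linarith) (by linarith) P.one_lt hμ
    (y := σ₀) (s := _) (y' := _) (s' := _) ⟨by linarith, ?_, by linarith, ?_, ?_, ?_, r4⟩
  · linarith
  · push_cast
    nlinarith
  · have : μ * ((2 + a) * σ₀ - (-t * -σ₀ - t * σ₀) + ((-1 : ℤ) : ℝ)) - σ₀ = μ * (μ * σ₀ - 1) := by
      push_cast
      linear_combination (-σ₀) * hμ
    rw [this]
    nlinarith
  · push_cast
    have : (2 + a) * (1 - 2 * η + σ₁) - (-t * -σ₁ - (t * σ₁ + η)) + -1 ≥ 0.5 := by nlinarith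
    nlinarith

/-- A segment joining the two sides of the region of return time three is stretched until it
crosses the square. -/
lemma crosses_of_traverse_BB (P : Rates η a t μ r κ) (hR : SegClosed η a t R) {σ₀ σ₁ : ℝ}
    (h1 : 0 ≤ σ₁) (h2 : σ₁ ≤ σ₀) (h3 : σ₀ ≤ η) (h4 : t * (σ₀ - σ₁) < η)
    (h : R (t * σ₀) (-σ₀) (t * σ₁ + η) (-σ₁)) : Crosses η R := by
  have hη := P.pos; have hη' := P.lt; have ht := P.ht; have ha := P.ha
  have hμ1 := P.lt_μ; have hμ2 := P.μ_lt; have ht1 := P.lt_t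
  rcases lt_or_ge (μ * σ₀) 1 with h5 | h5
  · exact crosses_of_traverse_BB_aux P hR h1 h2 h3 h4 h5 h
  -- The flip replaces `σ₀` by `η - σ₁`. Since `σ₀ - σ₁ < 0.301` and `σ₀ ≥ 1 / μ`, the condition `μ
  -- (η - σ₁) < 1` then holds.
  refine hR.crosses_of_flip (crosses_of_traverse_BB_aux P (hR.flip ha ht)
    (σ₀ := η - σ₁) (σ₁ := η - σ₀) (by linarith) (by linarith) (by linarith) (by linarith) ?_ ?_)
  · have : σ₀ - σ₁ < 0.301 := by nlinarith
    nlinarith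
  · have := hR.shift_snd (hR.symm h) 1
    unfold flip
    convert this using 1 <;> push_cast <;> linarith

/-- The quantity `y + t s` is affine along the segment; the proof cuts where it equals `0` and `η`.
-/
lemma crosses_of_traverse_BB' (P : Rates η a t μ r κ) (hR : SegClosed η a t R) {y s y' s' : ℝ}
    (h1 : -η ≤ s) (h2 : s < s') (h3 : s' ≤ 0) (hy : y < y') (h4 : y + t * s ≤ 0)
    (h5 : η ≤ y' + t * s') (h : R y s y' s') : Crosses η R := by
  have hη := P.pos; have ht1 := P.lt_t
  obtain ⟨c, hc⟩ : ∃ c, c = y + t * s := ⟨_, rfl⟩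
  obtain ⟨D, hD⟩ : ∃ D, D = (y' - y) + t * (s' - s) := ⟨_, rfl⟩
  have hts : 0 < t * (s' - s) := mul_pos (by linarith) (by linarith)
  have hD0 : 0 < D := by rw [hD]; linarith
  have hcD : η ≤ c + D := by rw [hc, hD]; linarith
  have hc0 : c ≤ 0 := by rw [hc]; exact h4
  have u0 : 0 ≤ -c / D := div_nonneg (by linarith) hD0.le
  have v0 : 0 ≤ (η - c) / D := div_nonneg (by linarith) hD0.le
  have u1 : -c / D ≤ 1 := (div_le_one hD0).2 (by linarith)
  have v1 : (η - c) / D ≤ 1 := (div_le_one hD0).2 (by linarith)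
  have hR' := hR.sub h u0 u1 v0 v1
  have eu : -c / D * D = -c := by field_simp
  have ev : (η - c) / D * D = η - c := by field_simp
  have huv : -c / D ≤ (η - c) / D := by
    apply div_le_div_of_nonneg_right _ hD0.le
    linarith
  generalize -c / D = u at *
  generalize (η - c) / D = v at *
  have e : (v - u) * D = η := by linear_combination ev - eu
  have hvu : 0 < v - u := by
    by_contra hcon
    nlinarith
  refine crosses_of_traverse_BB P hR (σ₀ := -(s + u * (s' - s))) (σ₁ := -(s + v * (s' - s)))
    ?_ ?_ ?_ ?_ ?_
  · nlinarith
  · nlinarith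
  · nlinarith
  · have : t * (-(s + u * (s' - s)) - -(s + v * (s' - s))) = η - (v - u) * (y' - y) := by
      rw [← e, hD]; ring
    rw [this]
    nlinarith
  · convert hR' using 1
    · rw [hD, hc] at eu; linear_combination -eu
    · ring
    · rw [hD, hc] at ev; linear_combination -ev
    · ring

/-- Only the part below the line `y + t s = 0` is used. Its image under `B`, `A` has one end on `y =
0`, and after the flip it straddles `y = μ s`. -/
lemma crosses_of_traverse_strip_aux (P : Rates η a t μ r κ) (hR : SegClosed η a t R) {y₀ y₁ : ℝ}
    (h0 : 0 ≤ y₀) (h1 : η ≤ 10 * (y₁ - y₀)) (h3 : y₁ ≤ η)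
    (h : R y₀ (-η) y₁ 0) : Crosses η R := by
  have hη := P.pos; have hη' := P.lt; have ht := P.ht; have ha := P.ha
  have hμ := P.hμ; have hμ1 := P.lt_μ; have ht1 := P.lt_t; have ha1 := P.one_lt_a
  have ha2 := P.a_lt
  obtain ⟨D, hD⟩ : ∃ D, D = (y₁ - y₀) + t * η := ⟨_, rfl⟩
  have hD0 : 0 < D := by rw [hD]; nlinarith
  obtain ⟨v, hv⟩ : ∃ v, v = (1 - 2 * η - y₀) / D := ⟨_, rfl⟩
  have v0 : 0 ≤ v := by rw [hv]; exact div_nonneg (by linarith) hD0.le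
  have v1 : v ≤ 1 := by rw [hv]; exact (div_le_one hD0).2 (by rw [hD]; linarith)
  have ev : v * D = 1 - 2 * η - y₀ := by rw [hv]; field_simp
  have r0 := hR.sub h le_rfl zero_le_one v0 v1
  obtain ⟨σ, hσ⟩ : ∃ σ, σ = η - v * η := ⟨_, rfl⟩
  have hσ0 : 0 ≤ σ := by rw [hσ]; nlinarith
  have hσ1 : σ ≤ η := by rw [hσ]; nlinarith
  have ey : y₀ + v * (y₁ - y₀) = t * σ := by
    rw [hσ]; rw [hD] at ev; linear_combination ev - ht
  have es : -η + v * (0 - -η) = -σ := by rw [hσ]; ring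
  rw [ey, es, zero_mul, zero_mul, add_zero, add_zero] at r0
  have hσ2 : t * σ ≤ η := by rw [← ey]; nlinarith
  have hσ3 : σ ≤ 0.301 := by nlinarith
  have r1 := hR.stepB r0 (by linarith) (by linarith) (by linarith) (by linarith)
  have r2 := hR.stepA r1 (by linarith) (by linarith) (by linarith) (by linarith)
  obtain ⟨Y, hY⟩ : ∃ Y, Y = -t * -η - y₀ := ⟨_, rfl⟩
  rw [← hY] at r2
  -- The margin `η / 10` comes from the slope bound; with `1 - 3 * η` alone the discriminant
  -- estimate below would fail near the threshold.
  have hY1 : 1 - 3 * η + η / 10 ≤ Y := by rw [hY]; linarith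
  have hY2 : Y ≤ 1 - η := by rw [hY]; linarith
  have e0 : -t * -σ - t * σ = 0 := by ring
  rw [e0] at r2
  refine hR.crosses_of_flip (Straddles.crosses (μ := μ) (hR.flip ha ht) (by linarith)
    (by linarith) P.one_lt hμ (y := 1 - η - Y) (s := 1 - η - ((2 + a) * Y - -η))
    (y' := 1 - η - 0) (s' := 1 - η - ((2 + a) * 0 - -σ))
    ⟨by linarith, by linarith, by linarith, ?_, ?_, ?_, ?_⟩)
  · have : 0 < a * Y := mul_pos (by linarith) (by linarith)
    linarith
  · have : μ * (1 - η - ((2 + a) * Y - -η)) - (1 - η - Y)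
        = -(μ ^ 2 * Y - μ * (1 - 2 * η) + (1 - η)) := by linear_combination Y * hμ
    rw [this, neg_lt_zero]
    -- The expression to be shown positive is quadratic in `μ`; its discriminant is negative, and
    -- `e` below completes the square.
    have d : (1 - 2 * η) ^ 2 < 4 * (1 - 3 * η + η / 10) * (1 - η) := by nlinarith
    have hY0 : 0 < Y := by linarith
    have d' : 4 * (1 - 3 * η + η / 10) * (1 - η) ≤ 4 * Y * (1 - η) :=
      mul_le_mul_of_nonneg_right (by linarith) (by linarith)
    have e : 4 * Y * (μ ^ 2 * Y - μ * (1 - 2 * η) + (1 - η)) =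
        (2 * Y * μ - (1 - 2 * η)) ^ 2 + (4 * Y * (1 - η) - (1 - 2 * η) ^ 2) := by ring
    refine (mul_pos_iff_of_pos_left (show 0 < 4 * Y by linarith)).1 ?_
    rw [e]
    linarith [sq_nonneg (2 * Y * μ - (1 - 2 * η))]
  · have : 2.6 * (1 - η - σ) ≤ μ * (1 - η - σ) :=
      mul_le_mul_of_nonneg_right hμ1.le (by linarith)
    linarith
  · unfold flip
    simpa using r2

/-- A segment in the cone joining the two sides of the singular strip is stretched until it
crosses the square. -/
lemma crosses_of_traverse_strip (P : Rates η a t μ r κ) (hR : SegClosed η a t R) {y₀ y₁ : ℝ}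
    (h0 : 0 ≤ y₀) (h1 : η ≤ 10 * (y₁ - y₀)) (h3 : y₁ ≤ 1 - η)
    (h : R y₀ (-η) y₁ 0) : Crosses η R := by
  have hη := P.pos; have hη' := P.lt; have ht := P.ht; have ha := P.ha
  rcases le_or_gt y₁ η with h4 | h4
  · exact crosses_of_traverse_strip_aux P hR h0 h1 h4 h
  rcases le_or_gt (1 - 2 * η) y₀ with h5 | h5
  · refine hR.crosses_of_flip (crosses_of_traverse_strip_aux P (hR.flip ha ht)
      (y₀ := 1 - η - y₁) (y₁ := 1 - η - y₀) (by linarith) (by linarith) (by linarith) ?_)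
    have := hR.shift_snd (hR.symm h) 1
    unfold flip
    convert this using 1 <;> push_cast <;> linarith
  -- Here `y₀ < 1 - 2 η` and `y₁ > η`, so the segment starts to the left and ends to the right of
  -- the region of return time three.
  · exact crosses_of_traverse_BB' P hR (y := y₀) (s := -η) (y' := y₁) (s' := 0) le_rfl
      (by linarith) le_rfl (by linarith) (by linarith) (by linarith) h

end traverse

end ToralShear


namespace ToralShear

/-! ### Growth of segments in the cone -/

/-- The family contains a segment over `[0, 1 - η]`, with slope in the cone, of horizontal extent
at least `L`. -/
def HasLength (η μ r : ℝ) (R : ℝ → ℝ → ℝ → ℝ → Prop) (L : ℝ) : Prop :=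
  ∃ y s d ρ, 0 < d ∧ μ ≤ ρ ∧ ρ ≤ r ∧ 0 ≤ y ∧ y + d ≤ 1 - η ∧ L ≤ (ρ - 1) * d ∧
    R y s (y + d) (s + ρ * d)

/-! The actions of the three return matrices on slopes preserve the cone. -/

section slopes

variable {η a t μ r κ ρ : ℝ}

/-- The slope map of branch `A` is increasing with fixed point `μ`, which gives the lower edge of
the cone. -/
lemma Rates.slopeA (P : Rates η a t μ r κ) (h1 : μ ≤ ρ) :
    μ ≤ 2 + a - 1 / ρ ∧ 2 + a - 1 / ρ ≤ r := by
  have hμ := P.one_lt; have := P.hμ; have := P.lt_r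
  have e : μ = 2 + a - 1 / μ := by field_simp; linarith
  have : 1 / ρ ≤ 1 / μ := one_div_le_one_div_of_le (by linarith) h1
  have : 0 < 1 / ρ := one_div_pos.2 (by linarith)
  constructor <;> linarith

lemma Rates.slopeAB (P : Rates η a t μ r κ) (h1 : μ ≤ ρ) (h2 : ρ ≤ r) :
    μ ≤ 2 + a + ρ / (t * ρ + 1) ∧ 2 + a + ρ / (t * ρ + 1) ≤ r := by
  have hμ := P.one_lt; have ht := P.lt_t; have hr := P.hr
  have hρ : 0 < ρ := by linarith
  have hd : 0 < t * ρ + 1 := by positivity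
  have h3 := P.slopeA h1
  have h4 : 0 < 1 / ρ := by positivity
  have h5 : 0 < ρ / (t * ρ + 1) := by positivity
  refine ⟨by linarith, ?_⟩
  have ht2 : 0 < t ^ 2 - 1 := by nlinarith
  have hr0 : 0 < r := by linarith
  have h6 : 0 < (t ^ 2 - 1) * r + t := by positivity
  have : ρ / (t * ρ + 1) ≤ r - (2 + a) := by
    rw [div_le_iff₀ hd]
    refine le_of_mul_le_mul_right ?_ h6
    have e : (r - (2 + a)) * (t * ρ + 1) * ((t ^ 2 - 1) * r + t) = (t * r + 1) * (t * ρ + 1) := by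
      rw [← hr]; ring
    rw [e]
    nlinarith
  linarith

/-- By `hr` the upper edge `r` is fixed by this Möbius map, which is increasing. -/
lemma Rates.slopeABB (P : Rates η a t μ r κ) (h1 : μ ≤ ρ) (h2 : ρ ≤ r) :
    μ ≤ 2 + a + (t * ρ + 1) / ((t ^ 2 - 1) * ρ + t) ∧
      2 + a + (t * ρ + 1) / ((t ^ 2 - 1) * ρ + t) ≤ r := by
  have hμ := P.one_lt; have ht := P.lt_t; have hr := P.hr
  have hρ : 0 < ρ := by linarith
  have ht2 : 0 < t ^ 2 - 1 := by nlinarith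
  have hd : 0 < (t ^ 2 - 1) * ρ + t := by positivity
  have h3 := P.slopeA h1
  have h4 : 0 < 1 / ρ := by positivity
  have h5 : 0 < (t * ρ + 1) / ((t ^ 2 - 1) * ρ + t) := by positivity
  refine ⟨by linarith, ?_⟩
  have h6 : 0 < (t ^ 2 - 1) * r + t := by nlinarith
  have : (t * ρ + 1) / ((t ^ 2 - 1) * ρ + t) ≤ r - (2 + a) := by
    rw [div_le_iff₀ hd]
    refine le_of_mul_le_mul_right ?_ h6
    have e : (r - (2 + a)) * ((t ^ 2 - 1) * ρ + t) * ((t ^ 2 - 1) * r + t)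
        = (t * r + 1) * ((t ^ 2 - 1) * ρ + t) := by
      rw [← hr]; ring
    rw [e]
    nlinarith
  linarith

/-- Each expansion factor has the form `p + q / (ρ - 1)` with `q > 0`, so it is least at `ρ = r`,
where `1 / (ρ - 1) = κ`. -/
lemma Rates.κ_mul_le (P : Rates η a t μ r κ) (h2 : ρ ≤ r) : κ * (ρ - 1) ≤ 1 := by
  have h := mul_le_mul_of_nonneg_left (show ρ - 1 ≤ r - 1 by linarith) P.κ_pos.le
  rwa [P.hκ] at h

lemma Rates.rateA_mul_le (P : Rates η a t μ r κ) (h2 : ρ ≤ r) :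
    rateA a κ * (ρ - 1) ≤ (1 + a) * ρ - 1 := by
  have := P.one_lt_a
  unfold rateA
  nlinarith [mul_le_mul_of_nonneg_left (P.κ_mul_le h2) (by linarith : 0 ≤ a)]

lemma Rates.rateAB_mul_le (P : Rates η a t μ r κ) (h2 : ρ ≤ r) :
    rateAB a t κ * (ρ - 1) ≤ (1 + a) * (1 + t * ρ) + ρ := by
  have := P.one_lt_a
  have := P.lt_t
  unfold rateAB
  have h : 0 ≤ (1 + a) * (1 + t) + 1 := by nlinarith
  linarith [mul_le_mul_of_nonneg_left (P.κ_mul_le h2) h]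

lemma Rates.rateABB_mul_le (P : Rates η a t μ r κ) (h2 : ρ ≤ r) :
    rateABB a t κ * (ρ - 1) ≤ (1 + a) * ((t ^ 2 - 1) * ρ + t) + 1 + t * ρ := by
  have := P.one_lt_a
  have := P.lt_t
  unfold rateABB
  have h : 0 ≤ (1 + a) * t ^ 2 + (2 + a) * t - a := by nlinarith
  linarith [mul_le_mul_of_nonneg_left (P.κ_mul_le h2) h]

lemma Rates.rateA_pos (P : Rates η a t μ r κ) : 0 < rateA a κ := by
  have := P.one_lt_a; have := P.κ_pos
  unfold rateA; positivity

lemma Rates.rateAB_pos (P : Rates η a t μ r κ) : 0 < rateAB a t κ := by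
  have := P.one_lt_a; have := P.κ_pos; have := P.lt_t
  unfold rateAB; positivity

lemma Rates.rateABB_pos (P : Rates η a t μ r κ) : 0 < rateABB a t κ := by
  have := P.one_lt_a; have := P.κ_pos; have := P.lt_t
  unfold rateABB
  have h1 : 0 < t ^ 2 - 1 := by nlinarith
  have h2 : 0 < (1 + a) * t ^ 2 + (2 + a) * t - a := by nlinarith
  have h3 : 0 < t ^ 2 + t - 1 := by nlinarith
  positivity

end slopes

/-! ### Images of segments under the three return branches -/

section growth

variable {η a t μ r κ y s d ρ : ℝ} {R : ℝ → ℝ → ℝ → ℝ → Prop}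

/-- The alternative `≤ 0` admits empty pieces, so that the cutting argument needs no separate cases
for them. -/
lemma hasLength_of_A (P : Rates η a t μ r κ) (hR : SegClosed η a t R) (hd : 0 ≤ d)
    (hρ1 : μ ≤ ρ) (hρ2 : ρ ≤ r) (hs : 0 ≤ s) (hs' : s + ρ * d ≤ 1 - η)
    (h : R y s (y + d) (s + ρ * d)) :
    rateA a κ * ((ρ - 1) * d) ≤ 0 ∨ HasLength η μ r R (rateA a κ * ((ρ - 1) * d)) := by
  rcases hd.eq_or_lt with rfl | hd
  · left; simp
  right
  have hμ := P.one_lt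
  have hρ : 0 < ρ := by linarith
  have hρd : 0 < ρ * d := by positivity
  have h' := hR.stepA h hs (by linarith) (by linarith) hs'
  refine ⟨s, (2 + a) * s - y, ρ * d, 2 + a - 1 / ρ, hρd, (P.slopeA hρ1).1, (P.slopeA hρ1).2,
    hs, hs', ?_, ?_⟩
  · have e : (2 + a - 1 / ρ - 1) * (ρ * d) = ((1 + a) * ρ - 1) * d := by field_simp; ring
    rw [e, ← mul_assoc]
    exact mul_le_mul_of_nonneg_right (P.rateA_mul_le hρ2) hd.le
  · convert h' using 1
    field_simp
    ring

/-- After branch `B` the height is `-(y + t s)`; the translation `k` (`0` to the left of the region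
of return time three, `1` to its right) brings it into `[0, 1 - η]`. Branch `B` reverses the
orientation of the segment. -/
lemma hasLength_of_AB (P : Rates η a t μ r κ) (hR : SegClosed η a t R) (hd : 0 ≤ d)
    (hρ1 : μ ≤ ρ) (hρ2 : ρ ≤ r) (hs : -η ≤ s) (hs' : s + ρ * d ≤ 0) (k : ℤ)
    (hk : 0 ≤ k - (y + d + t * (s + ρ * d))) (hk' : k - (y + t * s) ≤ 1 - η)
    (h : R y s (y + d) (s + ρ * d)) :
    rateAB a t κ * ((ρ - 1) * d) ≤ 0 ∨ HasLength η μ r R (rateAB a t κ * ((ρ - 1) * d)) := by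
  rcases hd.eq_or_lt with rfl | hd
  · left; simp
  right
  have hμ := P.one_lt
  have ht := P.lt_t
  have hρ : 0 < ρ := by linarith
  have hρd : 0 < ρ * d := by positivity
  have htd : 0 < t * (ρ * d) := by positivity
  have hd' : 0 < (1 + t * ρ) * d := by positivity
  have r1 := hR.shift_snd (hR.stepB h hs (by linarith) (by linarith) hs') k
  have r2 := hR.symm (hR.stepA r1 (by linarith) (by linarith) (by linarith) (by linarith))
  refine ⟨k - (y + d + t * (s + ρ * d)), (2 + a) * (k - (y + d + t * (s + ρ * d))) - (s + ρ * d),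
    (1 + t * ρ) * d, 2 + a + ρ / (t * ρ + 1), hd', (P.slopeAB hρ1 hρ2).1, (P.slopeAB hρ1 hρ2).2,
    hk, by linarith, ?_, ?_⟩
  · have e : (2 + a + ρ / (t * ρ + 1) - 1) * ((1 + t * ρ) * d)
        = ((1 + a) * (1 + t * ρ) + ρ) * d := by field_simp; ring
    rw [e, ← mul_assoc]
    exact mul_le_mul_of_nonneg_right (P.rateAB_mul_le hρ2) hd.le
  · convert r2 using 1
    · ring
    · ring
    · ring
    · field_simp
      ring

lemma hasLength_of_ABB (P : Rates η a t μ r κ) (hR : SegClosed η a t R) (hd : 0 ≤ d)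
    (hρ1 : μ ≤ ρ) (hρ2 : ρ ≤ r) (hs : -η ≤ s) (hs' : s + ρ * d ≤ 0)
    (hc : 0 ≤ y + t * s) (hc' : y + d + t * (s + ρ * d) ≤ η)
    (h : R y s (y + d) (s + ρ * d)) :
    rateABB a t κ * ((ρ - 1) * d) ≤ 0 ∨ HasLength η μ r R (rateABB a t κ * ((ρ - 1) * d)) := by
  rcases hd.eq_or_lt with rfl | hd
  · left; simp
  right
  have hμ := P.one_lt
  have ht := P.lt_t
  have hht := P.ht
  have ht2 : 0 < t ^ 2 - 1 := by nlinarith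
  have hρ : 0 < ρ := by linarith
  have hρd : 0 < ρ * d := by positivity
  have htd : 0 < t * (ρ * d) := by positivity
  have hd' : 0 < ((t ^ 2 - 1) * ρ + t) * d := by positivity
  have r1 := hR.stepB h hs (by linarith) (by linarith) hs'
  have r2 := hR.stepB r1 (by linarith) (by linarith) (by linarith) (by linarith)
  obtain ⟨c, hcd⟩ : ∃ c, c = y + t * s := ⟨_, rfl⟩
  obtain ⟨c', hcd'⟩ : ∃ c', c' = y + d + t * (s + ρ * d) := ⟨_, rfl⟩
  rw [← hcd] at hc
  rw [← hcd'] at hc'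
  have hcc : c ≤ c' := by rw [hcd, hcd']; linarith
  have f1 : 0 ≤ t * c := mul_nonneg (by linarith) hc
  have f2 : t * c' ≤ t * η := mul_le_mul_of_nonneg_left hc' (by linarith)
  have f3 : t * c ≤ t * c' := mul_le_mul_of_nonneg_left hcc (by linarith)
  have e1 : -t * s - y = -c := by rw [hcd]; ring
  have e2 : -t * (s + ρ * d) - (y + d) = -c' := by rw [hcd']; ring
  rw [e1, e2] at r2
  have r3 := hR.stepA r2 (by linarith) (by linarith) (by linarith) (by linarith)
  have ey : t * c - s + ((t ^ 2 - 1) * ρ + t) * d = t * c' - (s + ρ * d) := by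
    rw [hcd, hcd']; ring
  refine ⟨t * c - s, (2 + a) * (t * c - s) + c,
    ((t ^ 2 - 1) * ρ + t) * d, 2 + a + (t * ρ + 1) / ((t ^ 2 - 1) * ρ + t), hd',
    (P.slopeABB hρ1 hρ2).1, (P.slopeABB hρ1 hρ2).2, by linarith, by linarith, ?_, ?_⟩
  · have e : (2 + a + (t * ρ + 1) / ((t ^ 2 - 1) * ρ + t) - 1) * (((t ^ 2 - 1) * ρ + t) * d)
        = ((1 + a) * ((t ^ 2 - 1) * ρ + t) + 1 + t * ρ) * d := by
      have : (t ^ 2 - 1) * ρ + t ≠ 0 := by positivity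
      field_simp; ring
    rw [e, ← mul_assoc]
    exact mul_le_mul_of_nonneg_right (P.rateABB_mul_le hρ2) hd.le
  · have : (t ^ 2 - 1) * ρ + t ≠ 0 := by positivity
    have e : (2 + a + (t * ρ + 1) / ((t ^ 2 - 1) * ρ + t)) * (((t ^ 2 - 1) * ρ + t) * d)
        = (2 + a) * (((t ^ 2 - 1) * ρ + t) * d) + (t * ρ + 1) * d := by
      field_simp
    convert r3 using 1
    · ring
    · ring
    · linear_combination ey
    · rw [e]
      linear_combination (2 + a) * ey + hcd - hcd'

/-- The part of a segment in the singular strip: unless the family crosses the square, it splits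
into a piece of return time two and one of return time three. -/
lemma hasLength_of_strip (P : Rates η a t μ r κ) (hR : SegClosed η a t R) (hX : ¬ Crosses η R)
    (hd : 0 ≤ d) (hρ1 : μ ≤ ρ) (hρ2 : ρ ≤ r) (hy : 0 ≤ y) (hy' : y + d ≤ 1 - η)
    (hs : -η ≤ s) (hs' : s + ρ * d ≤ 0) (h : R y s (y + d) (s + ρ * d)) :
    ∃ ℓ₂ ℓ₃, 0 ≤ ℓ₂ ∧ 0 ≤ ℓ₃ ∧ ℓ₂ + ℓ₃ = (ρ - 1) * d ∧
      (rateAB a t κ * ℓ₂ ≤ 0 ∨ HasLength η μ r R (rateAB a t κ * ℓ₂)) ∧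
      (rateABB a t κ * ℓ₃ ≤ 0 ∨ HasLength η μ r R (rateABB a t κ * ℓ₃)) := by
  have hμ := P.one_lt
  have ht := P.lt_t
  have hht := P.ht
  have hη := P.pos
  have hη' := P.lt
  rcases hd.eq_or_lt with rfl | hd
  · exact ⟨0, 0, le_rfl, le_rfl, by simp, by simp, by simp⟩
  have hρ : 0 < ρ := by linarith
  have hρd : 0 < ρ * d := by positivity
  obtain ⟨c, hc⟩ : ∃ c, c = y + t * s := ⟨_, rfl⟩
  have hD : 0 < 1 + t * ρ := by positivity
  have hts : t * s ≤ 0 := mul_nonpos_of_nonneg_of_nonpos (by linarith) (by linarith)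
  have hts' : t * (s + ρ * d) ≤ 0 := mul_nonpos_of_nonneg_of_nonpos (by linarith) (by linarith)
  have hts2 : t * -η ≤ t * s := mul_le_mul_of_nonneg_left hs (by linarith)
  have hcu : ∀ u, y + u + t * (s + ρ * u) = c + (1 + t * ρ) * u := fun u => by rw [hc]; ring
  have piece : ∀ u v, 0 ≤ u → u ≤ v → v ≤ d →
      R (y + u) (s + ρ * u) (y + u + (v - u)) (s + ρ * u + ρ * (v - u)) ∧
        -η ≤ s + ρ * u ∧ s + ρ * u + ρ * (v - u) ≤ 0 := by
    intro u v hu huv hv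
    refine ⟨?_, by nlinarith, by nlinarith⟩
    have := hR.sub_dir h hd hu (huv.trans hv) (hu.trans huv) hv
    convert this using 1 <;> ring
  have lenAB : ∀ u v, 0 ≤ u → u ≤ v → v ≤ d → (c + (1 + t * ρ) * v ≤ 0 ∨ η ≤ c + (1 + t * ρ) * u) →
      (rateAB a t κ * ((ρ - 1) * (v - u)) ≤ 0 ∨
        HasLength η μ r R (rateAB a t κ * ((ρ - 1) * (v - u)))) := by
    intro u v hu huv hv hcase
    obtain ⟨p1, p2, p3⟩ := piece u v hu huv hv
    have ev := hcu v
    have eu := hcu u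
    have q1 : (1 + t * ρ) * u ≤ (1 + t * ρ) * v := mul_le_mul_of_nonneg_left huv hD.le
    have q2 : 0 ≤ (1 + t * ρ) * u := mul_nonneg hD.le hu
    have q3 : (1 + t * ρ) * v ≤ (1 + t * ρ) * d := mul_le_mul_of_nonneg_left hv hD.le
    have ed := hcu d
    rcases hcase with hcase | hcase
    · refine hasLength_of_AB P hR (by linarith) hρ1 hρ2 p2 p3 0 ?_ ?_ p1
      · push_cast
        have : y + u + (v - u) + t * (s + ρ * u + ρ * (v - u)) = c + (1 + t * ρ) * v := by
          rw [← ev]; ring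
        rw [this]; linarith
      · push_cast
        rw [eu]; linarith
    · refine hasLength_of_AB P hR (by linarith) hρ1 hρ2 p2 p3 1 ?_ ?_ p1
      · push_cast
        have : y + u + (v - u) + t * (s + ρ * u + ρ * (v - u)) = c + (1 + t * ρ) * v := by
          rw [← ev]; ring
        rw [this]; linarith
      · push_cast
        rw [eu]; linarith
  have lenABB : ∀ u v, 0 ≤ u → u ≤ v → v ≤ d → 0 ≤ c + (1 + t * ρ) * u →
      c + (1 + t * ρ) * v ≤ η → (rateABB a t κ * ((ρ - 1) * (v - u)) ≤ 0 ∨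
        HasLength η μ r R (rateABB a t κ * ((ρ - 1) * (v - u)))) := by
    intro u v hu huv hv h1 h2
    obtain ⟨p1, p2, p3⟩ := piece u v hu huv hv
    refine hasLength_of_ABB P hR (by linarith) hρ1 hρ2 p2 p3 (by rw [hcu]; exact h1) ?_ p1
    have : y + u + (v - u) + t * (s + ρ * u + ρ * (v - u)) = c + (1 + t * ρ) * v := by
      rw [← hcu]; ring
    rw [this]; exact h2
  have split : ∀ e, c < e → e < c + (1 + t * ρ) * d →
      ∃ w, 0 ≤ w ∧ w ≤ d ∧ c + (1 + t * ρ) * w = e := by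
    intro e h1 h2
    refine ⟨(e - c) / (1 + t * ρ), div_nonneg (by linarith) hD.le, ?_, by field_simp; ring⟩
    rw [div_le_iff₀ hD]; linarith
  have h0d : ∀ L : ℝ, L * (d - 0) = L * d := fun L => by rw [sub_zero]
  have hc0 : c + (1 + t * ρ) * 0 = c := by ring
  have hρ1' : 0 ≤ ρ - 1 := by linarith
  have hDd : 0 < (1 + t * ρ) * d := mul_pos hD hd
  -- Along the segment `y + t s` increases from `c` to `c + (1 + t ρ) d`; the return time is three
  -- between `0` and `η` and two elsewhere. There would be two pieces of return time two only if
  -- both levels were passed, and then the family crosses the square.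
  rcases le_or_gt (c + (1 + t * ρ) * d) 0 with k1 | k1
  · refine ⟨(ρ - 1) * d, 0, by positivity, le_rfl, by ring, ?_, by simp⟩
    have := lenAB 0 d le_rfl hd.le le_rfl (Or.inl k1)
    simpa using this
  rcases le_or_gt η c with k2 | k2
  · refine ⟨(ρ - 1) * d, 0, by positivity, le_rfl, by ring, ?_, by simp⟩
    have := lenAB 0 d le_rfl hd.le le_rfl (Or.inr (by rw [hc0]; exact k2))
    simpa using this
  rcases le_or_gt (c + (1 + t * ρ) * d) η with k3 | k3
  · rcases le_or_gt 0 c with k4 | k4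
    · refine ⟨0, (ρ - 1) * d, le_rfl, by positivity, by ring, by simp, ?_⟩
      have := lenABB 0 d le_rfl hd.le le_rfl (by rw [hc0]; exact k4) k3
      simpa using this
    · obtain ⟨w, w1, w2, w3⟩ := split 0 k4 k1
      refine ⟨(ρ - 1) * (w - 0), (ρ - 1) * (d - w), mul_nonneg hρ1' (by linarith),
        mul_nonneg hρ1' (by linarith), by ring, lenAB 0 w le_rfl w1 w2 (Or.inl w3.le),
        lenABB w d w1 w2 le_rfl w3.ge k3⟩
  · rcases le_or_gt c 0 with k4 | k4
    · refine absurd (crosses_of_traverse_BB' P hR hs (by linarith) hs' (by linarith) ?_ ?_ h) hX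
      · rw [← hc]; exact k4
      · rw [hcu]; exact k3.le
    · obtain ⟨w, w1, w2, w3⟩ := split η k2 k3
      refine ⟨(ρ - 1) * (d - w), (ρ - 1) * (w - 0), mul_nonneg hρ1' (by linarith),
        mul_nonneg hρ1' (by linarith), by ring, lenAB w d w1 w2 le_rfl (Or.inr w3.ge),
        lenABB 0 w le_rfl w1 w2 (by rw [hc0]; exact k4.le) w3.le⟩

/-- A segment in the cone is cut into at most three pieces, one for each return time, unless the
family crosses the square; so one of the images is longer. -/
lemma HasLength.grow (P : Rates η a t μ r κ) (hR : SegClosed η a t R) (hX : ¬ Crosses η R)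
    {L : ℝ} (hL : 0 < L) (h : HasLength η μ r R L) :
    HasLength η μ r R ((1 / rateA a κ + 1 / rateAB a t κ + 1 / rateABB a t κ)⁻¹ * L) := by
  have hμ := P.one_lt
  have ht := P.lt_t
  have ha := P.one_lt_a
  have hκ := P.κ_pos
  have hη := P.pos
  have hη' := P.lt
  have hr := P.r_lt
  obtain ⟨y, s, d, ρ, hd, hρ1, hρ2, hy, hy', hLd, h⟩ := h
  have hρ : 0 < ρ := by linarith
  have hρd : 0 < ρ * d := by positivity
  have K1 := P.rateA_pos
  have K2 := P.rateAB_pos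
  have K3 := P.rateABB_pos
  suffices hsplit : ∃ ℓ₁ ℓ₂ ℓ₃, ℓ₁ + ℓ₂ + ℓ₃ = (ρ - 1) * d ∧
      (rateA a κ * ℓ₁ ≤ 0 ∨ HasLength η μ r R (rateA a κ * ℓ₁)) ∧
      (rateAB a t κ * ℓ₂ ≤ 0 ∨ HasLength η μ r R (rateAB a t κ * ℓ₂)) ∧
      (rateABB a t κ * ℓ₃ ≤ 0 ∨ HasLength η μ r R (rateABB a t κ * ℓ₃)) by
    obtain ⟨ℓ₁, ℓ₂, ℓ₃, hsum, h1, h2, h3⟩ := hsplit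
    obtain ⟨S, hS⟩ : ∃ S, S = 1 / rateA a κ + 1 / rateAB a t κ + 1 / rateABB a t κ := ⟨_, rfl⟩
    rw [← hS]
    have hS0 : 0 < S := by rw [hS]; positivity
    have hSL : 0 < S⁻¹ * L := by positivity
    have mono : ∀ L', S⁻¹ * L ≤ L' → (L' ≤ 0 ∨ HasLength η μ r R L') →
        HasLength η μ r R (S⁻¹ * L) := by
      rintro L' hL' (h0 | ⟨y, s, d, ρ, q1, q2, q3, q4, q5, q6, q7⟩)
      · linarith
      · exact ⟨y, s, d, ρ, q1, q2, q3, q4, q5, hL'.trans q6, q7⟩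
    -- If all three images were shorter than `S⁻¹ L`, then `ℓᵢ < S⁻¹ L / Kᵢ`, and these bounds sum
    -- to `L`, which is at most the total extent.
    by_contra hcon
    have c1 : rateA a κ * ℓ₁ < S⁻¹ * L := not_le.1 fun hc => hcon (mono _ hc h1)
    have c2 : rateAB a t κ * ℓ₂ < S⁻¹ * L := not_le.1 fun hc => hcon (mono _ hc h2)
    have c3 : rateABB a t κ * ℓ₃ < S⁻¹ * L := not_le.1 fun hc => hcon (mono _ hc h3)
    have conv : ∀ K ℓ : ℝ, 0 < K → K * ℓ < S⁻¹ * L → ℓ < S⁻¹ * L * (1 / K) := by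
      intro K ℓ hK hlt
      rw [mul_one_div, lt_div_iff₀ hK]; linarith
    have d1 := conv _ _ K1 c1
    have d2 := conv _ _ K2 c2
    have d3 := conv _ _ K3 c3
    have : S⁻¹ * L * (1 / rateA a κ) + S⁻¹ * L * (1 / rateAB a t κ)
        + S⁻¹ * L * (1 / rateABB a t κ) = L := by
      rw [← mul_add, ← mul_add, ← hS]; field_simp
    linarith
  wlog hs : -η ≤ s ∧ s < 1 - η generalizing s
  · refine this (s - ⌊s + η⌋) ?_ ⟨?_, ?_⟩
    · have := hR.shift_snd h (-⌊s + η⌋)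
      convert this using 1 <;> push_cast <;> ring
    · linarith [Int.floor_le (s + η)]
    · linarith [Int.lt_floor_add_one (s + η)]
  obtain ⟨hs1, hs2⟩ := hs
  -- cut a segment at a prescribed height
  have cut : ∀ e, s ≤ e → e ≤ s + ρ * d → ∃ w, 0 ≤ w ∧ w ≤ d ∧ s + ρ * w = e ∧
      R y s (y + w) (s + ρ * w) ∧ R (y + w) (s + ρ * w) (y + d) (s + ρ * d) := by
    intro e h1 h2
    have hw0 : 0 ≤ (e - s) / ρ := div_nonneg (by linarith) hρ.le
    have hw1 : (e - s) / ρ ≤ d := by rw [div_le_iff₀ hρ]; linarith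
    refine ⟨(e - s) / ρ, hw0, hw1, by field_simp; ring, ?_, ?_⟩
    · simpa using hR.sub_dir h hd le_rfl hd.le hw0 hw1
    · exact hR.sub_dir h hd hw0 hw1 hd.le le_rfl
  rcases lt_or_ge s 0 with k0 | k0
  · rcases le_or_gt (s + ρ * d) 0 with k1 | k1
    · obtain ⟨ℓ₂, ℓ₃, -, -, e, h2, h3⟩ := hasLength_of_strip P hR hX hd.le hρ1 hρ2 hy hy' hs1 k1 h
      exact ⟨0, ℓ₂, ℓ₃, by linarith, by simp, h2, h3⟩
    obtain ⟨w, w0, w1, w2, w3, w4⟩ := cut 0 k0.le k1.le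
    have k2 : s + ρ * d ≤ 1 - η := by
      by_contra k2
      push Not at k2
      obtain ⟨w', w0', w1', w2', w3', w4'⟩ := cut (1 - η) (by linarith) k2.le
      have := hR.sub_dir h hd w0 w1 w0' w1'
      rw [w2, w2'] at this
      exact hX ⟨y + w, y + w', by linarith, by nlinarith, by linarith, this⟩
    obtain ⟨ℓ₂, ℓ₃, -, -, e, h2, h3⟩ := hasLength_of_strip P hR hX w0 hρ1 hρ2 hy (by linarith)
      hs1 w2.le w3
    refine ⟨(ρ - 1) * (d - w), ℓ₂, ℓ₃, by linarith, ?_, h2, h3⟩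
    refine hasLength_of_A P hR (y := y + w) (s := s + ρ * w) (by linarith) hρ1 hρ2 w2.ge
      (by linarith) ?_
    convert w4 using 1 <;> ring
  · rcases le_or_gt (s + ρ * d) (1 - η) with k1 | k1
    · exact ⟨(ρ - 1) * d, 0, 0, by ring, hasLength_of_A P hR hd.le hρ1 hρ2 k0 k1 h, by simp,
        by simp⟩
    obtain ⟨w, w0, w1, w2, w3, w4⟩ := cut (1 - η) hs2.le k1.le
    have k2 : s + ρ * d ≤ 1 := by
      by_contra k2
      push Not at k2
      obtain ⟨w', w0', w1', w2', w3', w4'⟩ := cut 1 (by linarith) k2.le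
      have h5 := hR.sub_dir h hd w0 w1 w0' w1'
      rw [w2, w2'] at h5
      have h6 := hR.shift_snd h5 (-1)
      refine hX (crosses_of_traverse_strip P hR (y₀ := y + w) (y₁ := y + w') (by linarith) ?_
        (by linarith) ?_)
      -- The strip has height `η` and the slope is at most `r < 10`.
      · have : η = ρ * (w' - w) := by linarith
        nlinarith
      · convert h6 using 1 <;> push_cast <;> ring
    have h7 : R (y + w) (s + ρ * w - 1) (y + w + (d - w)) (s + ρ * w - 1 + ρ * (d - w)) := by
      have := hR.shift_snd w4 (-1)
      convert this using 1 <;> push_cast <;> ring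
    obtain ⟨ℓ₂, ℓ₃, -, -, e, h2, h3⟩ := hasLength_of_strip P hR hX (by linarith) hρ1 hρ2
      (by linarith) (by linarith) (by linarith) (by linarith) h7
    exact ⟨(ρ - 1) * w, ℓ₂, ℓ₃, by linarith,
      hasLength_of_A P hR w0 hρ1 hρ2 k0 (by linarith) w3, h2, h3⟩

/-- Under the expansion condition every segment in the cone has an image that crosses the
square. -/
theorem HasLength.crosses (P : Rates η a t μ r κ) (hR : SegClosed η a t R)
    (hK : 1 / rateA a κ + 1 / rateAB a t κ + 1 / rateABB a t κ < 1) {L : ℝ} (hL : 0 < L)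
    (h : HasLength η μ r R L) : Crosses η R := by
  by_contra hX
  have hμ := P.one_lt
  have ht := P.lt_t
  have ha := P.one_lt_a
  have hκ := P.κ_pos
  have hη := P.pos
  have hr := P.μ_lt_r
  have K1 := P.rateA_pos
  have K2 := P.rateAB_pos
  have K3 := P.rateABB_pos
  have grow := fun L (hL : 0 < L) (h : HasLength η μ r R L) => HasLength.grow P hR hX hL h
  have hS0 : 0 < 1 / rateA a κ + 1 / rateAB a t κ + 1 / rateABB a t κ := by positivity
  generalize 1 / rateA a κ + 1 / rateAB a t κ + 1 / rateABB a t κ = S at *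
  have hS1 : 1 < S⁻¹ := (one_lt_inv₀ hS0).2 hK
  have all : ∀ n : ℕ, HasLength η μ r R (S⁻¹ ^ n * L) := by
    intro n
    induction n with
    | zero => simpa using h
    | succ n ih =>
      have := grow _ (by positivity) ih
      rwa [← mul_assoc, ← pow_succ'] at this
  -- A segment over `[0, 1 - η]` with slope at most `r` has extent less than `r`, so the growth
  -- cannot continue.
  obtain ⟨n, hn⟩ := pow_unbounded_of_one_lt (r / L) hS1
  rw [div_lt_iff₀ hL] at hn
  obtain ⟨y, s, d, ρ, q1, q2, q3, q4, q5, q6, q7⟩ := all n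
  nlinarith

end growth

end ToralShear


namespace ToralShear

/-! ### The Jacobian matrices and the threshold -/

lemma jacA_eq (η : ℝ) : jacA η = !![1, 1 / (1 - η); 1, 1 + 1 / (1 - η)] := by
  unfold jacA
  ext i j
  fin_cases i <;> fin_cases j <;> simp [Matrix.mul_apply, Fin.sum_univ_two]
  ring

lemma jacB_eq (η : ℝ) : jacB η = !![1, -(1 / η); 1, 1 - 1 / η] := by
  unfold jacB
  ext i j
  fin_cases i <;> fin_cases j <;> simp [Matrix.mul_apply, Fin.sum_univ_two]
  ring

lemma jacA_inv (η : ℝ) : (jacA η)⁻¹ = !![1 + 1 / (1 - η), -(1 / (1 - η)); -1, 1] := by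
  apply Matrix.inv_eq_left_inv
  rw [jacA_eq]
  ext i j
  fin_cases i <;> fin_cases j <;> simp [Matrix.mul_apply, Fin.sum_univ_two]
  ring

lemma jacB_inv (η : ℝ) : (jacB η)⁻¹ = !![1 - 1 / η, 1 / η; -1, 1] := by
  apply Matrix.inv_eq_left_inv
  rw [jacB_eq]
  ext i j
  fin_cases i <;> fin_cases j <;> simp [Matrix.mul_apply, Fin.sum_univ_two]
  ring

/-! ### Return matrices and their unstable eigenvectors -/

section matrices

variable {η a t : ℝ}

lemma returnMatrix_zero (ha : a = 1 / (1 - η)) : returnMatrix η 0 = !![1 + a, -a; -1, 1] := by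
  rw [ha]; exact jacA_inv η

lemma returnMatrix_one (ha : a = 1 / (1 - η)) (ht : t = 1 / η - 2) :
    returnMatrix η 1 = !![-((1 + a) * t + 1), (1 + a) * (1 + t) + 1; t, -(1 + t)] := by
  have hb : 1 / η = t + 2 := by linarith
  change (jacA η)⁻¹ * (jacB η)⁻¹ = _
  rw [jacA_inv, jacB_inv, ← ha, hb]
  ext i j
  fin_cases i <;> fin_cases j <;> simp [Matrix.mul_apply, Fin.sum_univ_two] <;> ring

lemma returnMatrix_two (ha : a = 1 / (1 - η)) (ht : t = 1 / η - 2) :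
    returnMatrix η 2 = !![t ^ 2 + t - 1 + a * (t ^ 2 - 1), -((1 + a) * t ^ 2 + (2 + a) * t - a);
      1 - t ^ 2, t ^ 2 + t - 1] := by
  have hb : 1 / η = t + 2 := by linarith
  change (jacA η)⁻¹ * (jacB η)⁻¹ * (jacB η)⁻¹ = _
  rw [jacA_inv, jacB_inv, ← ha, hb]
  ext i j
  fin_cases i <;> fin_cases j <;> simp [Matrix.mul_apply, Fin.sum_univ_two] <;> ring

lemma isUnstableGradient_iff {p q r s g : ℝ} :
    IsUnstableGradient !![p, q; r, s] g ↔ 1 < |p + q * g| ∧ r + s * g = (p + q * g) * g := by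
  unfold IsUnstableGradient
  constructor
  · rintro ⟨μ, h1, h2⟩
    have e0 := congrFun h2 0
    have e1 := congrFun h2 1
    simp [Matrix.mulVec, dotProduct, Fin.sum_univ_two] at e0 e1
    rw [e0]
    exact ⟨h1, e1⟩
  · rintro ⟨h1, h2⟩
    refine ⟨p + q * g, h1, ?_⟩
    ext i
    fin_cases i <;> simp [Matrix.mulVec, dotProduct, Fin.sum_univ_two]
    exact h2

/-- The defining equation of `κ`, the absolute gradient of the unstable eigenvector of the third
return matrix. -/
def kappaPoly (a t κ : ℝ) : ℝ :=
  ((1 + a) * t ^ 2 + (2 + a) * t - a) * κ ^ 2 + a * (t ^ 2 - 1) * κ - (t ^ 2 - 1)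

/-- Intermediate value theorem: the quadratic is negative at `0` and positive at `1`. -/
lemma exists_kappa (ha : 1 < a) (ht : 1 < t) : ∃ κ, 0 < κ ∧ kappaPoly a t κ = 0 := by
  have hA : 0 < (1 + a) * t ^ 2 + (2 + a) * t - a := by nlinarith
  have hC : 0 < t ^ 2 - 1 := by nlinarith
  have hB : 0 < a * (t ^ 2 - 1) := by positivity
  have hcont : Continuous (kappaPoly a t) := by unfold kappaPoly; fun_prop
  have h0 : kappaPoly a t 0 ≤ 0 := by unfold kappaPoly; nlinarith
  have h1 : 0 ≤ kappaPoly a t 1 := by unfold kappaPoly; nlinarith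
  obtain ⟨κ, hκ, h⟩ := intermediate_value_Icc zero_le_one hcont.continuousOn ⟨h0, h1⟩
  refine ⟨κ, lt_of_le_of_ne hκ.1 ?_, h⟩
  rintro rfl
  unfold kappaPoly at h
  nlinarith

/-- Equivalently the upper slope `r = 1 + 1 / κ` exceeds `2 + a`. It also places `-κ` above the
gradient `-1 / (μ - 1)`. -/
lemma kappa_lt (ha : 1 < a) (ht : 1 < t) {κ : ℝ} (h0 : 0 < κ) (h : kappaPoly a t κ = 0) :
    (1 + a) * κ < 1 := by
  unfold kappaPoly at h
  have hC : 0 < t ^ 2 - 1 := by nlinarith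
  by_contra hc
  push Not at hc
  have h1 : (t ^ 2 - 1) * κ ≤ ((1 + a) * κ) * ((t ^ 2 - 1) * κ) :=
    le_mul_of_one_le_left (by positivity) hc
  have h2 : (t ^ 2 - 1) * 1 ≤ (t ^ 2 - 1) * ((1 + a) * κ) := mul_le_mul_of_nonneg_left hc hC.le
  have h3 : 0 < ((2 + a) * t + 1) * κ ^ 2 := by positivity
  nlinarith

/-- The determinant is `1`, so the second root of the eigenvector equation belongs to the reciprocal
eigenvalue, which is not unstable. The same argument settles the first return matrix below. -/
lemma unstableGradient_two_iff (ha' : a = 1 / (1 - η)) (ht' : t = 1 / η - 2) (ha : 1 < a)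
    (ht : 1 < t) {κ : ℝ} (h0 : 0 < κ) (h : kappaPoly a t κ = 0) {g : ℝ} :
    IsUnstableGradient (returnMatrix η 2) g ↔ g = -κ := by
  rw [returnMatrix_two ha' ht', isUnstableGradient_iff]
  unfold kappaPoly at h
  have hA : 0 < (1 + a) * t ^ 2 + (2 + a) * t - a := by nlinarith
  have hC : 0 < t ^ 2 - 1 := by nlinarith
  have hm : 1 < t ^ 2 + t - 1 + a * (t ^ 2 - 1) := by nlinarith
  have hm' : 1 < t ^ 2 + t - 1 := by nlinarith
  have hdet : (t ^ 2 + t - 1 + a * (t ^ 2 - 1)) * (t ^ 2 + t - 1) -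
      ((1 + a) * t ^ 2 + (2 + a) * t - a) * (t ^ 2 - 1) = 1 := by ring
  have e1 : 1 - t ^ 2 = -(t ^ 2 - 1) := by ring
  rw [e1]
  generalize (1 + a) * t ^ 2 + (2 + a) * t - a = A at *
  generalize t ^ 2 + t - 1 = m at *
  generalize t ^ 2 - 1 = C at *
  have hAκ : 0 < A * κ := by positivity
  constructor
  · rintro ⟨h1, h2⟩
    have h3 : (g + κ) * (A * (g - κ) - a * C) = 0 := by linear_combination h2 - h
    rcases mul_eq_zero.1 h3 with h4 | h4
    · linarith
    · exfalso
      have h5 : m + a * C + -A * g = m - A * κ := by linear_combination -h4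
      have h6 : (m + a * C + A * κ) * (m - A * κ) = 1 := by linear_combination hdet - A * h
      have h7 : 0 < m - A * κ := by
        by_contra hc
        nlinarith
      rw [h5, abs_of_pos h7] at h1
      nlinarith
  · rintro rfl
    refine ⟨?_, by linear_combination h⟩
    have : 1 < m + a * C + -A * -κ := by linarith
    exact this.trans_le (le_abs_self _)

lemma unstableGradient_zero_iff (ha' : a = 1 / (1 - η)) (ha : 1 < a) {μ : ℝ} (h0 : 1 < μ)
    (h : μ ^ 2 + 1 = (2 + a) * μ) {g : ℝ} :
    IsUnstableGradient (returnMatrix η 0) g ↔ g = -(1 / (μ - 1)) := by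
  rw [returnMatrix_zero ha', isUnstableGradient_iff]
  obtain ⟨γ, hγ⟩ : ∃ γ, γ = 1 / (μ - 1) := ⟨_, rfl⟩
  have hμ1 : 0 < μ - 1 := by linarith
  have hγ1 : γ * (μ - 1) = 1 := by rw [hγ]; field_simp
  have hγ0 : 0 < γ := by rw [hγ]; positivity
  rw [← hγ]
  have haγ : μ * (a * γ) = μ - 1 := by linear_combination (-γ) * h + (μ - 1) * hγ1
  have hq : a * γ ^ 2 + a * γ = 1 := by
    have : μ * (a * γ ^ 2 + a * γ) = μ * 1 := by linear_combination (γ + 1) * haγ + hγ1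
    exact mul_left_cancel₀ (by linarith) this
  constructor
  · rintro ⟨h1, h2⟩
    have h3 : a * ((g + γ) * (g - γ - 1)) = 0 := by linear_combination h2 - hq
    rcases mul_eq_zero.1 ((mul_eq_zero.1 h3).resolve_left (by linarith)) with h4 | h4
    · linarith
    · exfalso
      have h5 : μ * (1 + a + -a * g) = 1 := by
        have : g = 1 + γ := by linarith
        rw [this]; linear_combination -haγ
      have h6 : 0 < 1 + a + -a * g := by
        by_contra hc
        nlinarith
      rw [abs_of_pos h6] at h1
      nlinarith
  · rintro rfl
    refine ⟨?_, by linear_combination hq⟩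
    have : 1 < 1 + a + -a * -γ := by nlinarith
    exact this.trans_le (le_abs_self _)

end matrices

lemma norm_fin_two (v : Fin 2 → ℝ) : ‖v‖ = max |v 0| |v 1| := by
  apply le_antisymm
  · rw [pi_norm_le_iff_of_nonneg (by positivity)]
    intro i
    fin_cases i
    · exact le_max_left _ _
    · exact le_max_right _ _
  · exact max_le (norm_le_pi_norm v 0) (norm_le_pi_norm v 1)

/-! ### Least expansion of the return matrices on the cone -/

section expansion

variable {η a t : ℝ}

/-- The vectors `(1, g)` of the cone have norm `1` because `|g| ≤ γ ≤ 1`. The first component of the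
image bounds its norm from below, is least at `g = -κ`, and equals the norm there, so the infimum is
attained. -/
lemma minExpansion_eq_of {p q u v κ γ : ℝ} {i : Fin 3}
    (hM : returnMatrix η i = !![p, q; u, v])
    (hcone : ∀ w, w ∈ cone η ↔ ∃ g c : ℝ, -γ ≤ g ∧ g ≤ -κ ∧ c ≠ 0 ∧ w = c • ![1, g])
    (hκ : 0 < κ) (hκγ : κ ≤ γ) (hγ : γ ≤ 1) {K : ℝ} (hK : |p - q * κ| = K)
    (hmono : ∀ g, g ≤ -κ → K ≤ |p + q * g|) (hsnd : |u - v * κ| ≤ K) :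
    minExpansion η i = K := by
  unfold minExpansion
  apply IsLeast.csInf_eq
  have hv : ∀ g : ℝ, -γ ≤ g → g ≤ -κ → ‖(![1, g] : Fin 2 → ℝ)‖ = 1 := by
    intro g h1 h2
    rw [norm_fin_two]
    have : |g| ≤ 1 := abs_le.2 ⟨by linarith, by linarith⟩
    simpa using this
  have hMv : ∀ g c : ℝ, (returnMatrix η i).mulVec (c • ![1, g]) = c • ![p + q * g, u + v * g] := by
    intro g c
    rw [hM, Matrix.mulVec_smul]
    congr 1
    ext j
    fin_cases j <;> simp [Matrix.mulVec, dotProduct, Fin.sum_univ_two]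
  constructor
  · refine ⟨(1 : ℝ) • ![1, -κ], (hcone _).2 ⟨-κ, 1, by linarith, le_rfl, one_ne_zero, rfl⟩, ?_⟩
    simp only
    rw [hMv, one_smul, one_smul, hv _ (by linarith) le_rfl, div_one, norm_fin_two]
    have e1 : p + q * -κ = p - q * κ := by ring
    have e2 : u + v * -κ = u - v * κ := by ring
    simp only [Matrix.cons_val_zero, Matrix.cons_val_one, e1, e2, hK]
    exact max_eq_left hsnd
  · rintro _ ⟨w, hw, rfl⟩
    obtain ⟨g, c, h1, h2, h3, rfl⟩ := (hcone w).1 hw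
    simp only
    rw [hMv, norm_smul, norm_smul, hv g h1 h2, mul_one, mul_div_cancel_left₀ _ (by simpa using h3),
      norm_fin_two]
    exact (hmono g h2).trans (le_max_left _ _)

/-- The minimal expansion factors of the return matrices. -/
lemma minExpansion_eq (ha' : a = 1 / (1 - η)) (ht' : t = 1 / η - 2) (ha : 1 < a)
    (ht : 1 < t) {κ : ℝ} (hκ0 : 0 < κ) (hκ : kappaPoly a t κ = 0) :
    minExpansion η 0 = rateA a κ ∧ minExpansion η 1 = rateAB a t κ ∧
      minExpansion η 2 = rateABB a t κ := by
  obtain ⟨μ, hμ1, hμ⟩ : ∃ μ : ℝ, 1 < μ ∧ μ ^ 2 + 1 = (2 + a) * μ := by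
    refine ⟨(2 + a + √(a ^ 2 + 4 * a)) / 2, by linarith [Real.sqrt_nonneg (a ^ 2 + 4 * a)], ?_⟩
    have := Real.sq_sqrt (show 0 ≤ a ^ 2 + 4 * a by positivity)
    linear_combination this / 4
  have hκa := kappa_lt ha ht hκ0 hκ
  have hμ2 : μ - 1 < 1 + a := by nlinarith
  have hμ3 : 1 < μ - 1 := by
    by_contra hc
    nlinarith
  have hκγ : κ ≤ 1 / (μ - 1) := by
    rw [le_div_iff₀ (by linarith)]
    nlinarith
  have hγ1 : 1 / (μ - 1) ≤ 1 := by
    rw [div_le_one (by linarith)]; linarith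
  have hcone : ∀ w, w ∈ cone η ↔ ∃ g c : ℝ, -(1 / (μ - 1)) ≤ g ∧ g ≤ -κ ∧ c ≠ 0 ∧
      w = c • ![1, g] := by
    intro w
    constructor
    · rintro ⟨g₁, g₃, g, c, h1, h3, h4, h5, h6, h7⟩
      rw [unstableGradient_zero_iff ha' ha hμ1 hμ] at h1
      rw [unstableGradient_two_iff ha' ht' ha ht hκ0 hκ] at h3
      subst h1 h3
      exact ⟨g, c, h4, h5, h6, h7⟩
    · rintro ⟨g, c, h4, h5, h6, h7⟩
      exact ⟨_, _, g, c, (unstableGradient_zero_iff ha' ha hμ1 hμ).2 rfl,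
        (unstableGradient_two_iff ha' ht' ha ht hκ0 hκ).2 rfl, h4, h5, h6, h7⟩
  have hC : 0 < t ^ 2 - 1 := by nlinarith
  have hA : 0 < (1 + a) * t ^ 2 + (2 + a) * t - a := by nlinarith
  have hm : 0 < t ^ 2 + t - 1 := by nlinarith
  refine ⟨minExpansion_eq_of (returnMatrix_zero ha') hcone hκ0 hκγ hγ1 ?_ ?_ ?_,
    minExpansion_eq_of (returnMatrix_one ha' ht') hcone hκ0 hκγ hγ1 ?_ ?_ ?_,
    minExpansion_eq_of (returnMatrix_two ha' ht') hcone hκ0 hκγ hγ1 ?_ ?_ ?_⟩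
  · unfold rateA
    rw [abs_of_pos (by nlinarith)]; ring
  · intro g hg
    unfold rateA
    refine le_trans ?_ (le_abs_self _)
    nlinarith
  · unfold rateA
    rw [abs_le]; constructor <;> nlinarith
  · unfold rateAB
    have : 0 < ((1 + a) * (1 + t) + 1) * κ := by positivity
    rw [abs_of_neg (by nlinarith)]; ring
  · intro g hg
    unfold rateAB
    refine le_trans ?_ (neg_le_abs _)
    have : 0 ≤ ((1 + a) * (1 + t) + 1) * (-κ - g) := mul_nonneg (by positivity) (by linarith)
    nlinarith
  · unfold rateAB
    have h1 : 0 < a * t := by positivity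
    have h2 : 0 < a * t * κ := by positivity
    have h3 : 0 < t * κ := by positivity
    have h4 : 0 < a * κ := by positivity
    rw [abs_le]; constructor <;> linarith
  · unfold rateABB
    have : 0 < ((1 + a) * t ^ 2 + (2 + a) * t - a) * κ := by positivity
    have : 0 < a * (t ^ 2 - 1) := by positivity
    rw [abs_of_pos (by linarith)]; ring
  · intro g hg
    unfold rateABB
    refine le_trans ?_ (le_abs_self _)
    have : 0 ≤ ((1 + a) * t ^ 2 + (2 + a) * t - a) * (-κ - g) := mul_nonneg hA.le (by linarith)
    linarith
  · unfold rateABB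
    have h1 : 0 < a * (t ^ 2 - 1) := by positivity
    have h2 : 0 < ((1 + a) * t ^ 2 + (2 + a) * t - a - (t ^ 2 + t - 1)) * κ := by
      refine mul_pos ?_ hκ0
      nlinarith
    have h3 : 0 < (t ^ 2 + t - 1) * κ := by positivity
    rw [abs_le]; constructor <;> nlinarith

end expansion

/-! ### Numerical bounds for the threshold -/

section numerics

variable {a t κ : ℝ}

/-- The minimum for the third return matrix is attained at its own eigenvector, so `K₃` is an
eigenvalue: this is the characteristic equation, with determinant `1`. -/
lemma rateABB_eigenvalue (h : kappaPoly a t κ = 0) :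
    rateABB a t κ ^ 2 + 1 = (2 * (t ^ 2 + t - 1) + a * (t ^ 2 - 1)) * rateABB a t κ := by
  unfold kappaPoly at h
  unfold rateABB
  linear_combination ((1 + a) * t ^ 2 + (2 + a) * t - a) * h

lemma one_lt_rateABB (ha : 1 < a) (ht : 1 < t) (hκ : 0 < κ) : 1 < rateABB a t κ := by
  unfold rateABB
  have hC : 0 < t ^ 2 - 1 := by nlinarith
  have hA : 0 < (1 + a) * t ^ 2 + (2 + a) * t - a := by nlinarith
  have : 0 < ((1 + a) * t ^ 2 + (2 + a) * t - a) * κ := by positivity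
  nlinarith

/-- `K₃` is the larger root of `K + 1 / K = T`, where the trace `T` increases with `a` and `t`; so
`k + 1 / k ≤ T` gives `k ≤ K₃`. -/
lemma le_rateABB (ha : 1 < a) (ht : 1 < t) (hκ : 0 < κ) (h : kappaPoly a t κ = 0) {α τ k : ℝ}
    (hα : α ≤ a) (hτ : τ ≤ t) (hτ0 : 1 ≤ τ) (hk : 1 ≤ k)
    (hle : k ^ 2 + 1 ≤ (2 * (τ ^ 2 + τ - 1) + α * (τ ^ 2 - 1)) * k) : k ≤ rateABB a t κ := by
  have h1 := rateABB_eigenvalue h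
  have h2 := one_lt_rateABB ha ht hκ
  generalize rateABB a t κ = K at *
  have h3 : 2 * (τ ^ 2 + τ - 1) + α * (τ ^ 2 - 1) ≤ 2 * (t ^ 2 + t - 1) + a * (t ^ 2 - 1) := by
    have : τ ^ 2 ≤ t ^ 2 := by nlinarith
    have : α * (τ ^ 2 - 1) ≤ a * (t ^ 2 - 1) :=
      mul_le_mul hα (by linarith) (by nlinarith) (by linarith)
    linarith
  generalize 2 * (t ^ 2 + t - 1) + a * (t ^ 2 - 1) = T at *
  have h4 : k ^ 2 + 1 ≤ T * k := hle.trans (mul_le_mul_of_nonneg_right h3 (by linarith))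
  by_contra hc
  push Not at hc
  have h5 : K * (k ^ 2 + 1) ≤ K * (T * k) := mul_le_mul_of_nonneg_left h4 (by linarith)
  have h6 : K * (T * k) = k * (K ^ 2 + 1) := by rw [h1]; ring
  have h7 : 0 < (k - K) * (K * k - 1) := mul_pos (by linarith) (by nlinarith)
  nlinarith

/-- The bounds on `a` and `t` are their rounded values at `η = 0.3236`. The quadratic increases for
positive arguments and is still non-positive at `0.1646`. -/
lemma le_kappa (ha : 1 < a) (ha1 : a ≤ 1.47842) (ht : 1.09023 ≤ t) (hκ0 : 0 < κ)
    (h : kappaPoly a t κ = 0) : 0.1646 ≤ κ := by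
  unfold kappaPoly at h
  by_contra hc
  push Not at hc
  have hC : 0 < t ^ 2 - 1 := by nlinarith
  have hA : 0 < (1 + a) * t ^ 2 + (2 + a) * t - a := by nlinarith
  have h1 : ((1 + a) * t ^ 2 + (2 + a) * t - a) * κ ^ 2 ≤
      ((1 + a) * t ^ 2 + (2 + a) * t - a) * 0.1646 ^ 2 :=
    mul_le_mul_of_nonneg_left (by nlinarith) hA.le
  have h2 : a * (t ^ 2 - 1) * κ < a * (t ^ 2 - 1) * 0.1646 :=
    mul_lt_mul_of_pos_left hc (by positivity)
  have h3 : 0 ≤ (1.47842 - a) * (0.1646 * (t ^ 2 - 1) + 0.1646 ^ 2 * (t ^ 2 + t - 1)) :=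
    mul_nonneg (by linarith) (by nlinarith)
  nlinarith

/-- The expansion condition holds for small parameters. -/
lemma sum_rates_lt_one {η : ℝ} (h0 : 0 < η) (h1 : η ≤ 0.3236) (ha' : a = 1 / (1 - η))
    (ht' : t = 1 / η - 2) (hκ0 : 0 < κ) (h : kappaPoly a t κ = 0) :
    1 / rateA a κ + 1 / rateAB a t κ + 1 / rateABB a t κ < 1 := by
  have ha : a * (1 - η) = 1 := by rw [ha']; exact div_mul_cancel₀ _ (by linarith)
  have ht : t * η = 1 - 2 * η := by rw [ht']; field_simp
  have ha1 : 1 < a := by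
    by_contra hc
    nlinarith
  have ha2 : a ≤ 1.47842 := by
    by_contra hc
    nlinarith
  have ht1 : 1.09023 ≤ t := by
    by_contra hc
    nlinarith
  have hk := le_kappa ha1 ha2 ht1 hκ0 h
  have bounds : ∀ α τ k : ℝ, 1 ≤ α → α ≤ a → 1 ≤ τ → τ ≤ t → 1 ≤ k →
      k ^ 2 + 1 ≤ (2 * (τ ^ 2 + τ - 1) + α * (τ ^ 2 - 1)) * k →
      1 / (1 + α * 1.1646) + 1 / ((1 + α) * (τ + (1 + τ) * 0.1646) + 1.1646) + 1 / k < 1 →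
      1 / rateA a κ + 1 / rateAB a t κ + 1 / rateABB a t κ < 1 := by
    intro α τ k q1 q2 q3 q4 q5 q6 q7
    have p3 := le_rateABB ha1 (by linarith) hκ0 h q2 q4 q3 q5 q6
    have p1 : 1 + α * 1.1646 ≤ rateA a κ := by unfold rateA; nlinarith
    have p2 : (1 + α) * (τ + (1 + τ) * 0.1646) + 1.1646 ≤ rateAB a t κ := by
      have e : rateAB a t κ = (1 + a) * (t + (1 + t) * κ) + (1 + κ) := by unfold rateAB; ring
      rw [e]
      have : τ + (1 + τ) * 0.1646 ≤ t + (1 + t) * κ := by nlinarith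
      have : (1 + α) * (τ + (1 + τ) * 0.1646) ≤ (1 + a) * (t + (1 + t) * κ) :=
        mul_le_mul (by linarith) this (by linarith) (by linarith)
      linarith
    have r1 := one_div_le_one_div_of_le (by linarith) p1
    have r2 := one_div_le_one_div_of_le (by nlinarith) p2
    have r3 := one_div_le_one_div_of_le (by linarith) p3
    linarith
  -- As `η` grows, `a` increases and `t` decreases. On each of three intervals `a` is bounded below
  -- at the left end and `t` at the right end, and `k` is a resulting lower bound for `K₃`.
  rcases le_or_gt η 0.31 with k1 | k1
  · refine bounds 1 1.2258 3.6 le_rfl ha1.le (by norm_num) ?_ (by norm_num) (by norm_num)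
      (by norm_num)
    by_contra hc
    nlinarith
  rcases le_or_gt η 0.318 with k2 | k2
  · refine bounds 1.449 1.1446 3 (by norm_num) ?_ (by norm_num) ?_ (by norm_num) (by norm_num)
      (by norm_num)
    · by_contra hc
      nlinarith
    · by_contra hc
      nlinarith
  · refine bounds 1.466 1.0902 2.42 (by norm_num) ?_ (by norm_num) ?_ (by norm_num) (by norm_num)
      (by norm_num)
    · by_contra hc
      nlinarith
    · linarith

/-- The expansion condition fails at `0.3244`: upper bounds on `κ` bound the three rates by `2.718`,
`4.68` and `2.345`. This gives the upper bound for the threshold. -/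
lemma one_le_sum_rates (ha' : a = 1 / (1 - 0.3244)) (ht' : t = 1 / 0.3244 - 2) (hκ0 : 0 < κ)
    (h : kappaPoly a t κ = 0) :
    rateABB a t κ ≤ 1 / (1 - 1 / rateA a κ - 1 / rateAB a t κ) := by
  have ha1 : a ≤ 1.48017 := by rw [ha']; norm_num
  have ha2 : 1 ≤ a := by rw [ha']; norm_num
  have ht1 : t ≤ 1.08262 := by rw [ht']; norm_num
  have ht2 : 1 ≤ t := by rw [ht']; norm_num
  have hk : κ ≤ 0.16 := by
    unfold kappaPoly at h
    by_contra hc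
    push Not at hc
    have h1 : 5.19 * 0.16 ^ 2 ≤ ((1 + a) * t ^ 2 + (2 + a) * t - a) * κ ^ 2 := by
      refine mul_le_mul ?_ (by nlinarith) (by norm_num) ?_
      · rw [ha', ht']; norm_num
      · rw [ha', ht']; norm_num
    have h2 : 0.254 * 0.16 ≤ a * (t ^ 2 - 1) * κ := by
      refine mul_le_mul ?_ hc.le (by norm_num) ?_
      · rw [ha', ht']; norm_num
      · rw [ha', ht']; norm_num
    have h3 : t ^ 2 - 1 ≤ 0.1721 := by rw [ht']; norm_num
    linarith
  have k1 : rateA a κ ≤ 2.718 := by unfold rateA; nlinarith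
  have k2 : rateAB a t κ ≤ 4.68 := by
    unfold rateAB
    have e1 : (1 + a) * t ≤ 2.6851 := by rw [ha', ht']; norm_num
    have e2 : (1 + a) * (1 + t) + 1 ≤ 6.1653 := by rw [ha', ht']; norm_num
    have e3 : ((1 + a) * (1 + t) + 1) * κ ≤ 6.1653 * 0.16 :=
      mul_le_mul e2 hk hκ0.le (by norm_num)
    linarith
  have k3 : rateABB a t κ ≤ 2.345 := by
    unfold rateABB
    have e1 : t ^ 2 + t - 1 + a * (t ^ 2 - 1) ≤ 1.5095 := by rw [ha', ht']; norm_num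
    have e2 : (1 + a) * t ^ 2 + (2 + a) * t - a ≤ 5.1945 := by rw [ha', ht']; norm_num
    have e3 : ((1 + a) * t ^ 2 + (2 + a) * t - a) * κ ≤ 5.1945 * 0.16 :=
      mul_le_mul e2 hk hκ0.le (by norm_num)
    linarith
  have l1 : 2 < rateA a κ := by unfold rateA; nlinarith
  have l2 : 3 ≤ rateAB a t κ := by
    unfold rateAB
    have : 0 < ((1 + a) * (1 + t) + 1) * κ := by positivity
    nlinarith
  have m1 : 1 / 2.718 ≤ 1 / rateA a κ := one_div_le_one_div_of_le (by linarith) k1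
  have m2 : 1 / 4.68 ≤ 1 / rateAB a t κ := one_div_le_one_div_of_le (by linarith) k2
  have n1 : 1 / rateA a κ < 1 / 2 := one_div_lt_one_div_of_lt (by norm_num) l1
  have n2 : 1 / rateAB a t κ ≤ 1 / 3 := one_div_le_one_div_of_le (by norm_num) l2
  refine k3.trans ?_
  rw [le_div_iff₀ (by linarith)]
  norm_num at m1 m2 ⊢
  linarith

end numerics

/-- The expansion condition defining the threshold. -/
lemma expansion_iff {a t κ : ℝ} (ha : 1 < a) (ht : 1 < t) (hκ : 0 < κ) :
    rateABB a t κ > 1 / (1 - 1 / rateA a κ - 1 / rateAB a t κ) ↔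
      1 / rateA a κ + 1 / rateAB a t κ + 1 / rateABB a t κ < 1 := by
  have l1 : 2 < rateA a κ := by unfold rateA; nlinarith
  have l2 : 3 ≤ rateAB a t κ := by
    unfold rateAB
    have : 0 < ((1 + a) * (1 + t) + 1) * κ := by positivity
    nlinarith
  have l3 := one_lt_rateABB ha ht hκ
  have n1 : 1 / rateA a κ < 1 / 2 := one_div_lt_one_div_of_lt (by norm_num) l1
  have n2 : 1 / rateAB a t κ ≤ 1 / 3 := one_div_le_one_div_of_le (by norm_num) l2
  rw [gt_iff_lt, one_div_lt (by linarith) (by linarith)]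
  constructor <;> intro h <;> linarith

/-- For `0 < η < 1/3` the parameters `a`, `t`, `κ` are as required. -/
lemma exists_params {η : ℝ} (h0 : 0 < η) (h1 : η < 1 / 3) :
    1 < 1 / (1 - η) ∧ 1 < 1 / η - 2 ∧
      ∃ κ, 0 < κ ∧ kappaPoly (1 / (1 - η)) (1 / η - 2) κ = 0 := by
  have ha : 1 < 1 / (1 - η) := by rw [lt_div_iff₀ (by linarith)]; linarith
  have ht : 1 < 1 / η - 2 := by
    have : 3 < 1 / η := by rw [lt_div_iff₀ h0]; linarith
    linarith
  exact ⟨ha, ht, exists_kappa ha ht⟩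

lemma expansion_of_lt : (0.3236 : ℝ) ∈ {t : ℝ | 0 < t ∧ t ≤ 1 / 3 ∧ ∀ η : ℝ, 0 < η → η < t →
    minExpansion η 2 > 1 / (1 - 1 / minExpansion η 0 - 1 / minExpansion η 1)} := by
  refine ⟨by norm_num, by norm_num, fun η h0 h1 => ?_⟩
  obtain ⟨ha, ht, κ, hκ0, hκ⟩ := exists_params h0 (by norm_num at h1 ⊢; linarith)
  obtain ⟨e0, e1, e2⟩ := minExpansion_eq rfl rfl ha ht hκ0 hκ
  rw [e0, e1, e2, expansion_iff ha ht hκ0]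
  exact sum_rates_lt_one h0 h1.le rfl rfl hκ0 hκ

/-- Two-sided bounds for the threshold. -/
lemma eta1_bounds : 0.3236 ≤ eta1 ∧ eta1 ≤ 0.3244 := by
  have hub : ∀ x ∈ {t : ℝ | 0 < t ∧ t ≤ 1 / 3 ∧ ∀ η : ℝ, 0 < η → η < t →
      minExpansion η 2 > 1 / (1 - 1 / minExpansion η 0 - 1 / minExpansion η 1)}, x ≤ 0.3244 := by
    rintro x ⟨-, -, hx⟩
    by_contra hc
    push Not at hc
    have := hx 0.3244 (by norm_num) hc
    obtain ⟨ha, ht, κ, hκ0, hκ⟩ := exists_params (η := 0.3244) (by norm_num) (by norm_num)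
    obtain ⟨e0, e1, e2⟩ := minExpansion_eq rfl rfl ha ht hκ0 hκ
    rw [e0, e1, e2] at this
    exact absurd this (not_lt.2 (one_le_sum_rates rfl rfl hκ0 hκ))
  have hmem := expansion_of_lt
  exact ⟨le_csSup ⟨_, hub⟩ hmem, csSup_le ⟨_, hmem⟩ hub⟩

/-- Below the threshold there are admissible rates, and they satisfy the expansion condition. -/
theorem exists_rates {η : ℝ} (h0 : 0 < η) (h1 : η < eta1) :
    ∃ μ r κ, Rates η (1 / (1 - η)) (1 / η - 2) μ r κ ∧
      1 / rateA (1 / (1 - η)) κ + 1 / rateAB (1 / (1 - η)) (1 / η - 2) κ +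
        1 / rateABB (1 / (1 - η)) (1 / η - 2) κ < 1 := by
  have hη : η < 0.3244 := h1.trans_le eta1_bounds.2
  obtain ⟨ha, ht, κ, hκ0, hκ⟩ := exists_params h0 (by norm_num at hη ⊢; linarith)
  obtain ⟨e0, e1, e2⟩ := minExpansion_eq rfl rfl ha ht hκ0 hκ
  have hineq : minExpansion η 2 > 1 / (1 - 1 / minExpansion η 0 - 1 / minExpansion η 1) := by
    obtain ⟨x, ⟨-, -, hx⟩, hx'⟩ := exists_lt_of_lt_csSup ⟨_, expansion_of_lt⟩ h1
    exact hx η h0 hx'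
  rw [e0, e1, e2, expansion_iff ha ht hκ0] at hineq
  have ha' : 1 / (1 - η) * (1 - η) = 1 := div_mul_cancel₀ _ (by linarith)
  have ht' : (1 / η - 2) * η = 1 - 2 * η := by field_simp
  have hκa := kappa_lt ha ht hκ0 hκ
  generalize 1 / (1 - η) = a at *
  generalize 1 / η - 2 = t at *
  -- A gradient `g = y / x` corresponds to the slope `s / y = 1 - 1 / g`, so `-κ` gives `r = 1 + 1 /
  -- κ`.
  refine ⟨(2 + a + √(a ^ 2 + 4 * a)) / 2, 1 + 1 / κ, κ, ⟨h0, by linarith, ha', ht', ?_, ?_, ?_, ?_,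
    by field_simp; ring⟩, hineq⟩
  · linarith [Real.sqrt_nonneg (a ^ 2 + 4 * a)]
  · have := Real.sq_sqrt (show 0 ≤ a ^ 2 + 4 * a by positivity)
    linear_combination this / 4
  · unfold kappaPoly at hκ
    field_simp
    linear_combination -hκ
  · have : 1 + a < 1 / κ := by rw [lt_div_iff₀ hκ0]; exact hκa
    linarith

end ToralShear


namespace ToralShear

/-! ### The map in the coordinates `(y, s)` -/

/-- The point of the torus with coordinates `(x, y) = (y - s, y)`. -/
def pt (y s : ℝ) : Torus := (((y - s : ℝ) : UnitAddCircle), (y : UnitAddCircle))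

lemma rep_coe (y : ℝ) : rep (y : UnitAddCircle) = Int.fract y := by
  unfold rep
  rw [AddCircle.coe_equivIco_mk_apply]
  simp

lemma coe_rep (c : UnitAddCircle) : ((rep c : ℝ) : UnitAddCircle) = c :=
  (AddCircle.equivIco (1 : ℝ) 0).symm_apply_apply c

lemma rep_nonneg (c : UnitAddCircle) : 0 ≤ rep c := (AddCircle.equivIco (1 : ℝ) 0 c).2.1

lemma rep_lt_one (c : UnitAddCircle) : rep c < 1 := by
  have h := (AddCircle.equivIco (1 : ℝ) 0 c).2.2
  exact lt_of_lt_of_eq h (zero_add 1)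

lemma coe_int (m : ℤ) : ((m : ℝ) : UnitAddCircle) = 0 :=
  (AddCircle.coe_eq_zero_iff (1 : ℝ)).2 ⟨m, by simp⟩

lemma coe_add_int (y : ℝ) (m : ℤ) : ((y + m : ℝ) : UnitAddCircle) = y := by
  rw [AddCircle.coe_add, coe_int, add_zero]

lemma pt_add_int (y s : ℝ) (m n : ℤ) : pt (y + m) (s + n) = pt y s := by
  unfold pt
  rw [coe_add_int]
  have : y + (m : ℝ) - (s + n) = y - s + ((m - n : ℤ) : ℝ) := by push_cast; ring
  rw [this, coe_add_int]

lemma pt_add_proj (y s c : ℝ) (v : Fin 2 → ℝ) :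
    pt y s + proj (c • v) = pt (y + c * v 1) (s + c * (v 1 - v 0)) := by
  unfold pt proj
  ext
  · simp only [Prod.fst_add, Pi.smul_apply, smul_eq_mul, ← AddCircle.coe_add]
    congr 1; ring
  · simp only [Prod.snd_add, Pi.smul_apply, smul_eq_mul, ← AddCircle.coe_add]

lemma eq_pt_of_snd {z : Torus} {y s : ℝ} (h1 : z.2 = (y : UnitAddCircle))
    (h2 : z.2 - z.1 = (s : UnitAddCircle)) : z = pt y s := by
  unfold pt
  ext
  · simp only [AddCircle.coe_sub]
    rw [← h1, ← h2]; abel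
  · exact h1

lemma exists_eq_pt (z : Torus) : ∃ y s, z = pt y s :=
  ⟨rep z.2, rep (z.2 - z.1), eq_pt_of_snd (coe_rep _).symm (coe_rep _).symm⟩

/-- The periodic extension of the shear profile. -/
noncomputable def liftProfile (η y : ℝ) : ℝ := profile η (Int.fract y)

/-- The new `s` is the old `y`, so an orbit is a solution of a second order recursion in `y`. -/
lemma mapH_pt (η y s : ℝ) : mapH η (pt y s) = pt (2 * y - s + liftProfile η y) y := by
  change shearG (shearF η (pt y s)) = _
  unfold shearG shearF pt liftProfile
  simp only [Equiv.coe_fn_mk, rep_coe, ← AddCircle.coe_add]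
  ext
  · simp only
    congr 1; ring
  · simp only
    congr 1; ring

lemma mapH_inv_pt (η y s : ℝ) : (mapH η)⁻¹ (pt y s) = pt s (2 * s - y + liftProfile η s) := by
  rw [Equiv.Perm.inv_eq_iff_eq, mapH_pt]
  congr 1; ring

lemma mapH_inv_snd (η : ℝ) (z : Torus) : ((mapH η)⁻¹ z).2 = z.2 - z.1 := by
  obtain ⟨y, s, rfl⟩ := exists_eq_pt z
  rw [mapH_inv_pt]
  unfold pt
  simp only [AddCircle.coe_sub]
  abel

lemma liftProfile_of_nonneg {η y : ℝ} (hη : 0 < η) (h0 : 0 ≤ y) (h1 : y ≤ 1 - η) :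
    liftProfile η y = 1 / (1 - η) * y := by
  unfold liftProfile profile
  rw [Int.fract_eq_self.2 ⟨h0, by linarith⟩, if_pos h1]
  ring

lemma liftProfile_of_nonpos {η y : ℝ} (hη : 0 < η) (hη1 : η < 1) (h0 : -η ≤ y) (h1 : y ≤ 0) :
    liftProfile η y = -(1 / η) * y := by
  unfold liftProfile profile
  rcases h1.lt_or_eq with h1 | rfl
  · have e : Int.fract y = y + 1 := by
      rw [← Int.fract_add_one]
      exact Int.fract_eq_self.2 ⟨by linarith, by linarith⟩
    rw [e]
    split_ifs with h
    -- At `y = -η` the fractional part is `1 - η`, which the profile assigns to its first branch;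
    -- the two branches agree there.
    · have : y = -η := by linarith
      subst this
      have : (1 : ℝ) - η ≠ 0 := by linarith
      field_simp
      ring
    · field_simp; ring
  · simp [hη1.le]

lemma mapH_pt_A {η y : ℝ} (hη : 0 < η) (h0 : 0 ≤ y) (h1 : y ≤ 1 - η) (s : ℝ) :
    mapH η (pt y s) = pt ((2 + 1 / (1 - η)) * y - s) y := by
  rw [mapH_pt, liftProfile_of_nonneg hη h0 h1]
  congr 1; ring

lemma mapH_pt_B {η y : ℝ} (hη : 0 < η) (hη1 : η < 1) (h0 : -η ≤ y) (h1 : y ≤ 0) (s : ℝ) :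
    mapH η (pt y s) = pt (-(1 / η - 2) * y - s) y := by
  rw [mapH_pt, liftProfile_of_nonpos hη hη1 h0 h1]
  congr 1; ring

lemma mapH_inv_pt_A {η s : ℝ} (hη : 0 < η) (h0 : 0 ≤ s) (h1 : s ≤ 1 - η) (y : ℝ) :
    (mapH η)⁻¹ (pt y s) = pt s ((2 + 1 / (1 - η)) * s - y) := by
  rw [mapH_inv_pt, liftProfile_of_nonneg hη h0 h1]
  congr 1; ring

lemma mapH_inv_pt_B {η s : ℝ} (hη : 0 < η) (hη1 : η < 1) (h0 : -η ≤ s) (h1 : s ≤ 0) (y : ℝ) :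
    (mapH η)⁻¹ (pt y s) = pt s (-(1 / η - 2) * s - y) := by
  rw [mapH_inv_pt, liftProfile_of_nonpos hη hη1 h0 h1]
  congr 1; ring

/-! ### Segments contained in the backward images of a set -/

/-- The segment on the torus with the given end points in the coordinates `(y, s)`. -/
def segSet (y s y' s' : ℝ) : Set Torus :=
  (fun u : ℝ => pt (y + u * (y' - y)) (s + u * (s' - s))) '' Icc 0 1

/-- The segment is contained in some backward image of `γ`. -/
def InBackward (η : ℝ) (γ : Set Torus) (y s y' s' : ℝ) : Prop :=
  ∃ n : ℕ, segSet y s y' s' ⊆ ((mapH η)⁻¹ ^ n : Equiv.Perm Torus) '' γ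

lemma segClosed_inBackward {η : ℝ} (hη : 0 < η) (hη1 : η < 1) (γ : Set Torus) :
    SegClosed η (1 / (1 - η)) (1 / η - 2) (InBackward η γ) where
  sub {y s y' s' u v} h hu hu' hv hv' := by
    obtain ⟨n, hn⟩ := h
    refine ⟨n, subset_trans ?_ hn⟩
    rintro _ ⟨w, hw, rfl⟩
    refine ⟨u + w * (v - u), ⟨by nlinarith [hw.1, hw.2], by nlinarith [hw.1, hw.2]⟩, ?_⟩
    simp only
    congr 1 <;> ring
  shift {y s y' s'} h m k := by
    obtain ⟨n, hn⟩ := h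
    refine ⟨n, subset_trans ?_ hn⟩
    rintro _ ⟨w, hw, rfl⟩
    refine ⟨w, hw, ?_⟩
    simp only
    rw [← pt_add_int _ _ m k]
    congr 1 <;> ring
  stepA {y s y' s'} h h1 h2 h3 h4 := by
    obtain ⟨n, hn⟩ := h
    refine ⟨n + 1, ?_⟩
    rintro _ ⟨w, hw, rfl⟩
    obtain ⟨z, hz, e⟩ := hn ⟨w, hw, rfl⟩
    refine ⟨z, hz, ?_⟩
    rw [pow_succ', Equiv.Perm.mul_apply, e]
    simp only
    rw [mapH_inv_pt_A hη (by nlinarith [hw.1, hw.2]) (by nlinarith [hw.1, hw.2])]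
    congr 1; ring
  stepB {y s y' s'} h h1 h2 h3 h4 := by
    obtain ⟨n, hn⟩ := h
    refine ⟨n + 1, ?_⟩
    rintro _ ⟨w, hw, rfl⟩
    obtain ⟨z, hz, e⟩ := hn ⟨w, hw, rfl⟩
    refine ⟨z, hz, ?_⟩
    rw [pow_succ', Equiv.Perm.mul_apply, e]
    simp only
    rw [mapH_inv_pt_B hη hη1 (by nlinarith [hw.1, hw.2]) (by nlinarith [hw.1, hw.2])]
    congr 1; ring

/-! ### Orbits off the singular set -/

/-- The full orbit of `z` avoids the singular set. -/
def OffSingular (η : ℝ) (z : Torus) : Prop := ∀ n : ℤ, (mapH η ^ n) z ∉ singularSet η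

/-- `z` lies in the strip where the Jacobian matrix is `jacA η`. -/
def InA (η : ℝ) (z : Torus) : Prop := rep z.2 < 1 - η

lemma OffSingular.zpow {η : ℝ} {z : Torus} (h : OffSingular η z) (k : ℤ) :
    OffSingular η ((mapH η ^ k) z) := by
  intro n
  rw [← Equiv.Perm.mul_apply, ← zpow_add]
  exact h _

lemma OffSingular.pow {η : ℝ} {z : Torus} (h : OffSingular η z) (k : ℕ) :
    OffSingular η ((mapH η ^ k) z) := by
  simpa using h.zpow k

lemma OffSingular.map {η : ℝ} {z : Torus} (h : OffSingular η z) : OffSingular η (mapH η z) := by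
  simpa using h.zpow 1

lemma OffSingular.map_inv {η : ℝ} {z : Torus} (h : OffSingular η z) :
    OffSingular η ((mapH η)⁻¹ z) := by
  simpa using h.zpow (-1)

lemma OffSingular.notMem {η : ℝ} {z : Torus} (h : OffSingular η z) : z ∉ singularSet η := by
  simpa using h 0

/-- A point of `A` off the singular set has a lift in the open interval `(0, 1 - η)`. -/
lemma InA.exists_lift {η : ℝ} {z : Torus} (h : InA η z) (hz : z ∉ singularSet η) :
    ∃ y : ℝ, z.2 = y ∧ 0 < y ∧ y < 1 - η := by
  refine ⟨rep z.2, (coe_rep _).symm, (rep_nonneg _).lt_of_ne ?_, h⟩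
  intro h0
  apply hz
  left
  rw [← coe_rep z.2, ← h0]; rfl

/-- A point outside `A` off the singular set has a lift in the open interval `(-η, 0)`. -/
lemma exists_lift_of_not_inA {η : ℝ} {z : Torus} (h : ¬ InA η z) (hz : z ∉ singularSet η) :
    ∃ y : ℝ, z.2 = y ∧ -η < y ∧ y < 0 := by
  refine ⟨rep z.2 - 1, ?_, ?_, by linarith [rep_lt_one z.2]⟩
  · have := coe_add_int (rep z.2) (-1)
    rw [coe_rep] at this
    refine this.symm.trans ?_
    push_cast
    rfl
  · have h1 : 1 - η ≤ rep z.2 := not_lt.1 h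
    have h2 : 1 - η ≠ rep z.2 := by
      intro h0
      apply hz
      right
      rw [h0, coe_rep]
    have := h1.lt_of_ne h2
    linarith

/-- No orbit off the singular set spends three consecutive steps outside `A`. -/
lemma OffSingular.inA_map_map {η : ℝ} {z : Torus} (hη : 0 < η) (hη1 : η < 1 / 2)
    (hz : OffSingular η z) (h0 : ¬ InA η z) (h1 : ¬ InA η (mapH η z)) :
    InA η (mapH η (mapH η z)) := by
  obtain ⟨y₀, e0, p0, q0⟩ := exists_lift_of_not_inA h0 hz.notMem
  obtain ⟨y₁, e1, p1, q1⟩ := exists_lift_of_not_inA h1 hz.map.notMem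
  have e : mapH η z = pt y₁ y₀ := by
    refine eq_pt_of_snd e1 ?_
    rw [← mapH_inv_snd η (mapH η z)]
    simpa using e0
  rw [e, mapH_pt_B hη (by linarith) p1.le q1.le]
  unfold InA pt
  simp only [rep_coe]
  have ht : (1 / η - 2) * η = 1 - 2 * η := by field_simp
  have ht0 : 0 < 1 / η - 2 := by
    by_contra hc
    nlinarith
  -- The extreme value is `(1 / η - 2) η + η = 1 - η`.
  have r1 : -(1 / η - 2) * y₁ - y₀ < 1 - η := by nlinarith
  have r2 : 0 < -(1 / η - 2) * y₁ - y₀ := by nlinarith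
  rw [Int.fract_eq_self.2 ⟨r2.le, by linarith⟩]
  exact r1

end ToralShear


namespace ToralShear

/-! ### The derivative cocycle -/

section cocycle

lemma cocycle_add (T : Equiv.Perm Torus) (D : Torus → Matrix (Fin 2) (Fin 2) ℝ) (m k : ℕ)
    (z : Torus) : cocycle T D (m + k) z = cocycle T D k ((T ^ m) z) * cocycle T D m z := by
  induction k with
  | zero => simp [cocycle]
  | succ k ih =>
    rw [← add_assoc, cocycle, ih, cocycle, Matrix.mul_assoc, ← Equiv.Perm.mul_apply, ← pow_add,
      add_comm k m]

lemma cocycle_one (T : Equiv.Perm Torus) (D : Torus → Matrix (Fin 2) (Fin 2) ℝ) (z : Torus) :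
    cocycle T D 1 z = D z := by
  simp [cocycle]

variable {η : ℝ} {z : Torus}

lemma jacH_mulVec_of_inA (h : InA η z) (v : Fin 2 → ℝ) :
    (jacH η z).mulVec v = ![v 0 + 1 / (1 - η) * v 1, v 0 + (1 + 1 / (1 - η)) * v 1] := by
  unfold InA at h
  unfold jacH
  rw [if_pos h, jacA_eq]
  ext i
  fin_cases i <;> simp [Matrix.mulVec, dotProduct, Fin.sum_univ_two]

lemma jacH_mulVec_of_not_inA (h : ¬ InA η z) (v : Fin 2 → ℝ) :
    (jacH η z).mulVec v = ![v 0 + -(1 / η) * v 1, v 0 + (1 + -(1 / η)) * v 1] := by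
  unfold InA at h
  unfold jacH
  rw [if_neg h, jacB_eq]
  ext i
  fin_cases i <;> simp [Matrix.mulVec, dotProduct, Fin.sum_univ_two, sub_eq_add_neg]

/-- The Jacobian matrix and its inverse are bounded by the same constant. -/
lemma exists_jacH_bound (hη : 0 < η) (hη1 : η < 1) : ∃ M : ℝ, 1 ≤ M ∧
    ∀ (z : Torus) (v : Fin 2 → ℝ), ‖(jacH η z).mulVec v‖ ≤ M * ‖v‖ ∧
      ‖v‖ ≤ M * ‖(jacH η z).mulVec v‖ := by
  have key : ∀ c C : ℝ, |c| ≤ C → ∀ v : Fin 2 → ℝ,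
      ‖(![v 0 + c * v 1, v 0 + (1 + c) * v 1] : Fin 2 → ℝ)‖ ≤ (2 + 2 * C) * ‖v‖ ∧
        ‖v‖ ≤ (2 + 2 * C) * ‖(![v 0 + c * v 1, v 0 + (1 + c) * v 1] : Fin 2 → ℝ)‖ := by
    intro c C hc v
    have hC : 0 ≤ C := (abs_nonneg c).trans hc
    have bd : ∀ x y N : ℝ, |x| ≤ N → |y| ≤ N → |x + c * y| ≤ (1 + C) * N := by
      intro x y N hx hy
      have h1 : |c * y| ≤ C * N := by
        rw [abs_mul]; exact mul_le_mul hc hy (abs_nonneg _) hC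
      linarith [abs_add_le x (c * y)]
    have v0 : |v 0| ≤ ‖v‖ := norm_le_pi_norm v 0
    have v1 : |v 1| ≤ ‖v‖ := norm_le_pi_norm v 1
    constructor
    · rw [norm_fin_two (![v 0 + c * v 1, v 0 + (1 + c) * v 1])]
      have h0 := bd _ _ _ v0 v1
      have hN := norm_nonneg v
      refine max_le ?_ ?_
      · simp only [Matrix.cons_val_zero]
        nlinarith
      · simp only [Matrix.cons_val_one, Matrix.cons_val_fin_one]
        have e : v 0 + (1 + c) * v 1 = (v 0 + c * v 1) + v 1 := by ring
        rw [e]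
        have := abs_add_le (v 0 + c * v 1) (v 1)
        nlinarith
    · obtain ⟨u, hu⟩ : ∃ u, u = (![v 0 + c * v 1, v 0 + (1 + c) * v 1] : Fin 2 → ℝ) := ⟨_, rfl⟩
      have e1 : v 1 = u 1 - u 0 := by rw [hu]; simp; ring
      have e0 : v 0 = u 0 - c * (u 1 - u 0) := by rw [← e1, hu]; simp
      rw [← hu, norm_fin_two v]
      have u0 : |u 0| ≤ ‖u‖ := norm_le_pi_norm u 0
      have u1 : |u 1| ≤ ‖u‖ := norm_le_pi_norm u 1
      have hN := norm_nonneg u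
      have hd : |u 1 - u 0| ≤ 2 * ‖u‖ := by linarith [abs_sub (u 1) (u 0)]
      have hcd : |c * (u 1 - u 0)| ≤ C * (2 * ‖u‖) := by
        rw [abs_mul]; exact mul_le_mul hc hd (abs_nonneg _) hC
      refine max_le ?_ ?_
      · rw [e0]
        have := abs_sub (u 0) (c * (u 1 - u 0))
        nlinarith
      · rw [e1]
        nlinarith
  refine ⟨2 + 2 * (1 / (1 - η) + 1 / η), ?_, ?_⟩
  · have : 0 < 1 / (1 - η) := one_div_pos.2 (by linarith)
    have : 0 < 1 / η := one_div_pos.2 hη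
    linarith
  · intro z v
    have p1 : 0 < 1 / (1 - η) := one_div_pos.2 (by linarith)
    have p2 : 0 < 1 / η := one_div_pos.2 hη
    by_cases h : InA η z
    · rw [jacH_mulVec_of_inA h]
      exact key _ _ (by rw [abs_of_pos p1]; linarith) v
    · rw [jacH_mulVec_of_not_inA h]
      exact key _ _ (by rw [abs_neg, abs_of_pos p2]; linarith) v

lemma cocycle_bounds {M : ℝ} (hM1 : 1 ≤ M) (hM : ∀ (z : Torus) (v : Fin 2 → ℝ),
    ‖(jacH η z).mulVec v‖ ≤ M * ‖v‖ ∧ ‖v‖ ≤ M * ‖(jacH η z).mulVec v‖) (n : ℕ) (z : Torus)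
    (v : Fin 2 → ℝ) : ‖(cocycle (mapH η) (jacH η) n z).mulVec v‖ ≤ M ^ n * ‖v‖ ∧
      ‖v‖ ≤ M ^ n * ‖(cocycle (mapH η) (jacH η) n z).mulVec v‖ := by
  have hM0 : 0 ≤ M := by linarith
  induction n with
  | zero => simp [cocycle]
  | succ n ih =>
    have h := hM ((mapH η ^ n) z) ((cocycle (mapH η) (jacH η) n z).mulVec v)
    rw [cocycle, ← Matrix.mulVec_mulVec, pow_succ]
    constructor
    · calc _ ≤ M * ‖(cocycle (mapH η) (jacH η) n z).mulVec v‖ := h.1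
        _ ≤ M * (M ^ n * ‖v‖) := mul_le_mul_of_nonneg_left ih.1 hM0
        _ = _ := by ring
    · calc _ ≤ M ^ n * ‖(cocycle (mapH η) (jacH η) n z).mulVec v‖ := ih.2
        _ ≤ M ^ n * (M * _) := mul_le_mul_of_nonneg_left h.2 (by positivity)
        _ = _ := by ring

lemma det_jacH (z : Torus) : (jacH η z).det = 1 := by
  unfold jacH
  split_ifs
  · rw [jacA_eq, Matrix.det_fin_two_of]; ring
  · rw [jacB_eq, Matrix.det_fin_two_of]; ring

lemma det_cocycle (n : ℕ) (z : Torus) : (cocycle (mapH η) (jacH η) n z).det = 1 := by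
  induction n with
  | zero => simp [cocycle]
  | succ n ih => rw [cocycle, Matrix.det_mul, ih, det_jacH, one_mul]

/-- The area spanned by two vectors is preserved by the cocycle. -/
lemma wedge_cocycle (n : ℕ) (z : Torus) (v w : Fin 2 → ℝ) :
    (cocycle (mapH η) (jacH η) n z).mulVec v 0 * (cocycle (mapH η) (jacH η) n z).mulVec w 1 -
      (cocycle (mapH η) (jacH η) n z).mulVec v 1 * (cocycle (mapH η) (jacH η) n z).mulVec w 0 =
    v 0 * w 1 - v 1 * w 0 := by
  have h := det_cocycle (η := η) n z
  rw [Matrix.det_fin_two] at h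
  simp only [Matrix.mulVec, dotProduct, Fin.sum_univ_two]
  linear_combination (v 0 * w 1 - v 1 * w 0) * h

end cocycle

lemma jacH_mulVec_sub {η : ℝ} (z : Torus) (v : Fin 2 → ℝ) :
    (jacH η z).mulVec v 1 - (jacH η z).mulVec v 0 = v 1 := by
  by_cases h : InA η z
  · rw [jacH_mulVec_of_inA h]; simp; ring
  · rw [jacH_mulVec_of_not_inA h]; simp; ring

lemma jacH_mulVec_snd_of_inA {η : ℝ} {z : Torus} (h : InA η z) (v : Fin 2 → ℝ) :
    (jacH η z).mulVec v 1 = (2 + 1 / (1 - η)) * v 1 - (v 1 - v 0) := by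
  rw [jacH_mulVec_of_inA h]; simp; ring

lemma jacH_mulVec_snd_of_not_inA {η : ℝ} {z : Torus} (h : ¬ InA η z) (v : Fin 2 → ℝ) :
    (jacH η z).mulVec v 1 = -(1 / η - 2) * v 1 - (v 1 - v 0) := by
  rw [jacH_mulVec_of_not_inA h]; simp; ring

/-! ### The backward invariant cone -/

/-- The vector with coordinates `(y, s)` has slope in `[μ, r]`. -/
def SlopeIn (μ r y s : ℝ) : Prop := ∃ ρ, μ ≤ ρ ∧ ρ ≤ r ∧ s = ρ * y

/-- The quadratic form of the condition makes it closed, as the compactness argument in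
`exists_vCone_forever` requires. -/
lemma slopeIn_iff {μ r : ℝ} (h : μ ≤ r) (y s : ℝ) :
    SlopeIn μ r y s ↔ 0 ≤ (s - μ * y) * (r * y - s) := by
  constructor
  · rintro ⟨ρ, h1, h2, rfl⟩
    have : (ρ * y - μ * y) * (r * y - ρ * y) = (ρ - μ) * (r - ρ) * y ^ 2 := by ring
    rw [this]
    exact mul_nonneg (mul_nonneg (by linarith) (by linarith)) (sq_nonneg _)
  · intro h0
    rcases eq_or_ne y 0 with rfl | hy
    · refine ⟨μ, le_rfl, h, ?_⟩
      have : s ^ 2 ≤ 0 := by nlinarith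
      have : s = 0 := by simpa using le_antisymm this (sq_nonneg s)
      simp [this]
    · have e : (s - μ * y) * (r * y - s) = (s / y - μ) * (r - s / y) * y ^ 2 := by field_simp
      rw [e] at h0
      have h1 : 0 ≤ (s / y - μ) * (r - s / y) :=
        nonneg_of_mul_nonneg_left h0 (by positivity)
      refine ⟨s / y, ?_, ?_, by field_simp⟩
      · by_contra hc
        push Not at hc
        nlinarith
      · by_contra hc
        push Not at hc
        nlinarith

/-! ### Pulling cone vectors back along one return to `A` -/

section back

variable {η a t μ r κ y s : ℝ}

/-- If the image vector under `DH` lies in the cone, so does the original one, and it is longer by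
the expansion rate of `H⁻¹`. Lengths are measured by `|y - s| = |x|`. -/
lemma Rates.back_A (P : Rates η a t μ r κ) (h : SlopeIn μ r ((2 + a) * y - s) y) :
    SlopeIn μ r y s ∧ rateA a κ * |(2 + a) * y - s - y| ≤ |y - s| := by
  obtain ⟨ρ, h1, h2, h3⟩ := h
  have hμ := P.one_lt
  have ha := P.one_lt_a
  obtain ⟨y₁, hy₁⟩ : ∃ y₁, y₁ = (2 + a) * y - s := ⟨_, rfl⟩
  rw [← hy₁] at h3 ⊢
  have hρ : ρ ≠ 0 := by linarith
  have hs : s = (2 + a) * y - y₁ := by linarith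
  refine ⟨⟨2 + a - 1 / ρ, (P.slopeA h1).1, (P.slopeA h1).2, ?_⟩, ?_⟩
  · rw [hs, h3]; field_simp
  · have e1 : |y₁ - y| = (ρ - 1) * |y₁| := by
      rw [h3, show y₁ - ρ * y₁ = -((ρ - 1) * y₁) by ring, abs_neg, abs_mul,
        abs_of_nonneg (show 0 ≤ ρ - 1 by linarith)]
    have e2 : |y - s| = ((1 + a) * ρ - 1) * |y₁| := by
      rw [hs, h3, show ρ * y₁ - ((2 + a) * (ρ * y₁) - y₁) = -(((1 + a) * ρ - 1) * y₁) by ring,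
        abs_neg, abs_mul, abs_of_nonneg (show 0 ≤ (1 + a) * ρ - 1 by nlinarith)]
    rw [e1, e2, ← mul_assoc]
    exact mul_le_mul_of_nonneg_right (P.rateA_mul_le h2) (abs_nonneg _)

lemma Rates.back_AB (P : Rates η a t μ r κ) {y₁ y₂ : ℝ} (h₁ : y₁ = (2 + a) * y - s)
    (h₂ : y₂ = -t * y₁ - y) (h : SlopeIn μ r y₂ y₁) :
    SlopeIn μ r y s ∧ rateAB a t κ * |y₂ - y₁| ≤ |y - s| := by
  obtain ⟨ρ, h1, h2, h3⟩ := h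
  have hμ := P.one_lt
  have ha := P.one_lt_a
  have ht := P.lt_t
  have hρ : 0 < ρ := by linarith
  have hd : 0 < t * ρ + 1 := by positivity
  have hy : y = -(t * ρ + 1) * y₂ := by rw [h3] at h₂; linarith
  have hs : s = (2 + a) * y - ρ * y₂ := by linarith
  refine ⟨⟨_, (P.slopeAB h1 h2).1, (P.slopeAB h1 h2).2, ?_⟩, ?_⟩
  · rw [hs, hy]; field_simp; ring
  · have e1 : |y₂ - y₁| = (ρ - 1) * |y₂| := by
      rw [h3, show y₂ - ρ * y₂ = -((ρ - 1) * y₂) by ring, abs_neg, abs_mul,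
        abs_of_nonneg (show 0 ≤ ρ - 1 by linarith)]
    have e2 : |y - s| = ((1 + a) * (1 + t * ρ) + ρ) * |y₂| := by
      rw [hs, hy, show -(t * ρ + 1) * y₂ - ((2 + a) * (-(t * ρ + 1) * y₂) - ρ * y₂) =
        ((1 + a) * (1 + t * ρ) + ρ) * y₂ by ring, abs_mul, abs_of_nonneg (by positivity)]
    rw [e1, e2, ← mul_assoc]
    exact mul_le_mul_of_nonneg_right (P.rateAB_mul_le h2) (abs_nonneg _)

lemma Rates.back_ABB (P : Rates η a t μ r κ) {y₁ y₂ y₃ : ℝ} (h₁ : y₁ = (2 + a) * y - s)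
    (h₂ : y₂ = -t * y₁ - y) (h₃ : y₃ = -t * y₂ - y₁) (h : SlopeIn μ r y₃ y₂) :
    SlopeIn μ r y s ∧ rateABB a t κ * |y₃ - y₂| ≤ |y - s| := by
  obtain ⟨ρ, h1, h2, h3⟩ := h
  have hμ := P.one_lt
  have ha := P.one_lt_a
  have ht := P.lt_t
  have hρ : 0 < ρ := by linarith
  have ht2 : 0 < t ^ 2 - 1 := by nlinarith
  have hd : 0 < (t ^ 2 - 1) * ρ + t := by positivity
  have hy₁ : y₁ = -(t * ρ + 1) * y₃ := by rw [h3] at h₃; linarith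
  have hy : y = ((t ^ 2 - 1) * ρ + t) * y₃ := by rw [h3, hy₁] at h₂; linarith
  have hs : s = (2 + a) * y + (t * ρ + 1) * y₃ := by linarith
  refine ⟨⟨_, (P.slopeABB h1 h2).1, (P.slopeABB h1 h2).2, ?_⟩, ?_⟩
  · rw [hs, hy]
    have := hd.ne'
    field_simp
  · have e1 : |y₃ - y₂| = (ρ - 1) * |y₃| := by
      rw [h3, show y₃ - ρ * y₃ = -((ρ - 1) * y₃) by ring, abs_neg, abs_mul,
        abs_of_nonneg (show 0 ≤ ρ - 1 by linarith)]
    have e2 : |y - s| = ((1 + a) * ((t ^ 2 - 1) * ρ + t) + 1 + t * ρ) * |y₃| := by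
      rw [hs, hy, show ((t ^ 2 - 1) * ρ + t) * y₃ - ((2 + a) * (((t ^ 2 - 1) * ρ + t) * y₃) +
        (t * ρ + 1) * y₃) = -(((1 + a) * ((t ^ 2 - 1) * ρ + t) + 1 + t * ρ) * y₃) by ring,
        abs_neg, abs_mul, abs_of_nonneg (by positivity)]
    rw [e1, e2, ← mul_assoc]
    exact mul_le_mul_of_nonneg_right (P.rateABB_mul_le h2) (abs_nonneg _)

end back

/-- The vector `v` lies in the cone. -/
def VCone (μ r : ℝ) (v : Fin 2 → ℝ) : Prop := SlopeIn μ r (v 1) (v 1 - v 0)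

lemma VCone.smul {μ r c : ℝ} {v : Fin 2 → ℝ} (h : VCone μ r v) : VCone μ r (c • v) := by
  obtain ⟨ρ, h1, h2, h3⟩ := h
  refine ⟨ρ, h1, h2, ?_⟩
  simp only [Pi.smul_apply, smul_eq_mul]
  linear_combination c * h3

lemma VCone.snd_ne_zero {μ r : ℝ} {v : Fin 2 → ℝ} (h : VCone μ r v) (hv : v ≠ 0) : v 1 ≠ 0 := by
  obtain ⟨ρ, h1, h2, h3⟩ := h
  intro h0
  apply hv
  rw [h0] at h3
  ext i
  fin_cases i
  · simpa using h3
  · exact h0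

lemma VCone.norm_eq {μ r : ℝ} {v : Fin 2 → ℝ} (hμ : 2 ≤ μ) (h : VCone μ r v) : ‖v‖ = |v 0| := by
  obtain ⟨ρ, h1, h2, h3⟩ := h
  rw [norm_fin_two]
  apply max_eq_left
  have : v 0 = -((ρ - 1) * v 1) := by linarith
  rw [this, abs_neg, abs_mul, abs_of_nonneg (show 0 ≤ ρ - 1 by linarith)]
  nlinarith [abs_nonneg (v 1)]

/-! ### Contraction between visits to `A` -/

section stable

variable {η μ r κ θ : ℝ}

/-- Between visits to `A`, the inverse cocycle preserves the cone and expands it. -/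
lemma Rates.back (P : Rates η (1 / (1 - η)) (1 / η - 2) μ r κ) (hθ : 1 ≤ θ)
    (h1 : θ ^ 3 ≤ rateA (1 / (1 - η)) κ) (h2 : θ ^ 3 ≤ rateAB (1 / (1 - η)) (1 / η - 2) κ)
    (h3 : θ ^ 3 ≤ rateABB (1 / (1 - η)) (1 / η - 2) κ) (n : ℕ) :
    ∀ z, OffSingular η z → InA η z → InA η ((mapH η ^ n) z) → ∀ v,
      VCone μ r ((cocycle (mapH η) (jacH η) n z).mulVec v) →
      VCone μ r v ∧ θ ^ n * |(cocycle (mapH η) (jacH η) n z).mulVec v 0| ≤ |v 0| := by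
  have hθ0 : 0 ≤ θ := by linarith
  have hη := P.pos
  have hη' := P.lt
  -- combining one return with the estimate for the remaining time
  have comb : ∀ (j k : ℕ) (K x x' x'' : ℝ), j ≤ 3 → θ ^ 3 ≤ K → θ ^ k * |x''| ≤ |x'| →
      K * |x'| ≤ |x| → θ ^ (j + k) * |x''| ≤ |x| := by
    intro j k K x x' x'' hj hK hk hx
    calc θ ^ (j + k) * |x''| = θ ^ j * (θ ^ k * |x''|) := by rw [pow_add]; ring
      _ ≤ θ ^ 3 * |x'| := mul_le_mul (pow_le_pow_right₀ hθ hj) hk (by positivity) (by positivity)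
      _ ≤ K * |x'| := mul_le_mul_of_nonneg_right hK (abs_nonneg _)
      _ ≤ |x| := hx
  induction n using Nat.strong_induction_on with
  | _ n ih =>
  intro z hz hA hn v hv
  rcases n with _ | n
  · simpa [cocycle] using hv
  obtain ⟨v₁, hv₁⟩ : ∃ v₁, v₁ = (jacH η z).mulVec v := ⟨_, rfl⟩
  have s₁ : v₁ 1 - v₁ 0 = v 1 := by rw [hv₁]; exact jacH_mulVec_sub z v
  have y₁ : v₁ 1 = (2 + 1 / (1 - η)) * v 1 - (v 1 - v 0) := by
    rw [hv₁]; exact jacH_mulVec_snd_of_inA hA v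
  rw [pow_succ, Equiv.Perm.mul_apply] at hn
  have c₁ : (cocycle (mapH η) (jacH η) (n + 1) z).mulVec v =
      (cocycle (mapH η) (jacH η) n (mapH η z)).mulVec v₁ := by
    rw [add_comm n 1, cocycle_add, cocycle_one, pow_one, ← Matrix.mulVec_mulVec, ← hv₁]
  rw [c₁] at hv ⊢
  by_cases hA₁ : InA η (mapH η z)
  · obtain ⟨g1, g2⟩ := ih n (by omega) _ hz.map hA₁ hn v₁ hv
    unfold VCone at g1
    rw [s₁, y₁] at g1
    obtain ⟨q1, q2⟩ := P.back_A g1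
    refine ⟨q1, ?_⟩
    rw [add_comm n 1]
    refine comb 1 n _ _ _ _ (by norm_num) h1 g2 (le_of_eq_of_le ?_ (q2.trans_eq ?_))
    · rw [show v₁ 0 = v₁ 1 - v 1 by linarith, y₁]
    · congr 1; ring
  rcases n with _ | n
  · exact absurd hn hA₁
  obtain ⟨v₂, hv₂⟩ : ∃ v₂, v₂ = (jacH η (mapH η z)).mulVec v₁ := ⟨_, rfl⟩
  have s₂ : v₂ 1 - v₂ 0 = v₁ 1 := by rw [hv₂]; exact jacH_mulVec_sub _ v₁
  have y₂ : v₂ 1 = -(1 / η - 2) * v₁ 1 - v 1 := by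
    rw [hv₂, jacH_mulVec_snd_of_not_inA hA₁ v₁, s₁]
  rw [pow_succ, Equiv.Perm.mul_apply] at hn
  have c₂ : (cocycle (mapH η) (jacH η) (n + 1) (mapH η z)).mulVec v₁ =
      (cocycle (mapH η) (jacH η) n (mapH η (mapH η z))).mulVec v₂ := by
    rw [add_comm n 1, cocycle_add, cocycle_one, pow_one, ← Matrix.mulVec_mulVec, ← hv₂]
  rw [c₂] at hv ⊢
  by_cases hA₂ : InA η (mapH η (mapH η z))
  · obtain ⟨g1, g2⟩ := ih n (by omega) _ hz.map.map hA₂ hn v₂ hv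
    unfold VCone at g1
    rw [s₂] at g1
    obtain ⟨q1, q2⟩ := P.back_AB y₁ y₂ g1
    refine ⟨q1, ?_⟩
    rw [show n + 1 + 1 = 2 + n by ring]
    refine comb 2 n _ _ _ _ (by norm_num) h2 g2 (le_of_eq_of_le ?_ (q2.trans_eq ?_))
    · rw [show v₂ 0 = v₂ 1 - v₁ 1 by linarith]
    · congr 1; ring
  rcases n with _ | n
  · exact absurd hn hA₂
  obtain ⟨v₃, hv₃⟩ : ∃ v₃, v₃ = (jacH η (mapH η (mapH η z))).mulVec v₂ := ⟨_, rfl⟩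
  have s₃ : v₃ 1 - v₃ 0 = v₂ 1 := by rw [hv₃]; exact jacH_mulVec_sub _ v₂
  have y₃ : v₃ 1 = -(1 / η - 2) * v₂ 1 - v₁ 1 := by
    rw [hv₃, jacH_mulVec_snd_of_not_inA hA₂ v₂, s₂]
  rw [pow_succ, Equiv.Perm.mul_apply] at hn
  have c₃ : (cocycle (mapH η) (jacH η) (n + 1) (mapH η (mapH η z))).mulVec v₂ =
      (cocycle (mapH η) (jacH η) n (mapH η (mapH η (mapH η z)))).mulVec v₃ := by
    rw [add_comm n 1, cocycle_add, cocycle_one, pow_one, ← Matrix.mulVec_mulVec, ← hv₃]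
  rw [c₃] at hv ⊢
  -- Two consecutive steps outside `A` force the third back into `A`, so no longer return occurs.
  have hA₃ := hz.map.inA_map_map hη (by linarith) hA₁ hA₂
  obtain ⟨g1, g2⟩ := ih n (by omega) _ hz.map.map.map hA₃ hn v₃ hv
  unfold VCone at g1
  rw [s₃] at g1
  obtain ⟨q1, q2⟩ := P.back_ABB y₁ y₂ y₃ g1
  refine ⟨q1, ?_⟩
  rw [show n + 1 + 1 + 1 = 3 + n by ring]
  refine comb 3 n _ _ _ _ le_rfl h3 g2 (le_of_eq_of_le ?_ (q2.trans_eq ?_))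
  · rw [show v₃ 0 = v₃ 1 - v₂ 1 by linarith]
  · congr 1; ring

end stable

end ToralShear


namespace ToralShear

/-! ### Stable directions -/

section stable

variable {η μ r κ θ : ℝ}

/-- The rates exceed a uniform bound `θ ^ 3 > 1`. -/
lemma exists_theta {K₁ K₂ K₃ : ℝ} (p1 : 0 < K₁) (p2 : 0 < K₂) (p3 : 0 < K₃)
    (hK : 1 / K₁ + 1 / K₂ + 1 / K₃ < 1) :
    ∃ θ : ℝ, 1 < θ ∧ θ ^ 3 ≤ K₁ ∧ θ ^ 3 ≤ K₂ ∧ θ ^ 3 ≤ K₃ := by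
  have q1 : 0 < 1 / K₁ := by positivity
  have q2 : 0 < 1 / K₂ := by positivity
  have q3 : 0 < 1 / K₃ := by positivity
  have g1 : 1 < K₁ := by
    have : 1 / K₁ < 1 := by linarith
    rwa [div_lt_one p1] at this
  have g2 : 1 < K₂ := by
    have : 1 / K₂ < 1 := by linarith
    rwa [div_lt_one p2] at this
  have g3 : 1 < K₃ := by
    have : 1 / K₃ < 1 := by linarith
    rwa [div_lt_one p3] at this
  obtain ⟨K, hK1, hK2⟩ : ∃ K, K = min K₁ (min K₂ K₃) ∧ 1 < K :=
    ⟨_, rfl, lt_min g1 (lt_min g2 g3)⟩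
  have hcube : (K ^ (1 / 3 : ℝ)) ^ 3 = K := by
    rw [← Real.rpow_natCast, ← Real.rpow_mul (by linarith)]
    norm_num
  refine ⟨K ^ (1 / 3 : ℝ), Real.one_lt_rpow hK2 (by norm_num), ?_, ?_, ?_⟩ <;> rw [hcube, hK1]
  · exact min_le_left _ _
  · exact (min_le_right _ _).trans (min_le_left _ _)
  · exact (min_le_right _ _).trans (min_le_right _ _)

/-- At a point of `A` some direction of the cone stays in the cone at all later visits to `A`. -/
lemma exists_vCone_forever (P : Rates η (1 / (1 - η)) (1 / η - 2) μ r κ) (hθ : 1 ≤ θ)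
    (h1 : θ ^ 3 ≤ rateA (1 / (1 - η)) κ) (h2 : θ ^ 3 ≤ rateAB (1 / (1 - η)) (1 / η - 2) κ)
    (h3 : θ ^ 3 ≤ rateABB (1 / (1 - η)) (1 / η - 2) κ) {z : Torus} (hz : OffSingular η z)
    (hA : InA η z) : ∃ w : Fin 2 → ℝ, w ≠ 0 ∧ ∀ n : ℕ, InA η ((mapH η ^ n) z) →
      VCone μ r ((cocycle (mapH η) (jacH η) n z).mulVec w) := by
  have hμr : μ ≤ r := P.μ_lt_r.le
  -- The slopes that stay in the cone up to time `N` form a decreasing sequence of compact sets; any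
  -- slope in the intersection will do.
  let S : ℕ → Set ℝ := fun N => {ρ | ρ ∈ Icc μ r ∧ ∀ n ≤ N, InA η ((mapH η ^ n) z) →
    VCone μ r ((cocycle (mapH η) (jacH η) n z).mulVec ![1 - ρ, 1])}
  have hclosed : ∀ N, IsClosed (S N) := by
    intro N
    have : S N = Icc μ r ∩ ⋂ n ∈ {n : ℕ | n ≤ N ∧ InA η ((mapH η ^ n) z)},
        {ρ | VCone μ r ((cocycle (mapH η) (jacH η) n z).mulVec ![1 - ρ, 1])} := by
      ext ρ
      simp only [S, mem_ofPred_eq, mem_inter_iff, mem_iInter, and_imp]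
    rw [this]
    refine isClosed_Icc.inter (isClosed_biInter fun n _ => ?_)
    have : {ρ | VCone μ r ((cocycle (mapH η) (jacH η) n z).mulVec ![1 - ρ, 1])} =
        {ρ | 0 ≤ (fun ρ : ℝ =>
          ((cocycle (mapH η) (jacH η) n z).mulVec ![1 - ρ, 1] 1 -
            (cocycle (mapH η) (jacH η) n z).mulVec ![1 - ρ, 1] 0 -
            μ * (cocycle (mapH η) (jacH η) n z).mulVec ![1 - ρ, 1] 1) *
          (r * (cocycle (mapH η) (jacH η) n z).mulVec ![1 - ρ, 1] 1 -
            ((cocycle (mapH η) (jacH η) n z).mulVec ![1 - ρ, 1] 1 -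
            (cocycle (mapH η) (jacH η) n z).mulVec ![1 - ρ, 1] 0))) ρ} := by
      ext ρ
      exact slopeIn_iff hμr _ _
    rw [this]
    refine isClosed_le continuous_const ?_
    simp only [Matrix.mulVec, dotProduct, Fin.sum_univ_two, Matrix.cons_val_zero,
      Matrix.cons_val_one, Matrix.cons_val_fin_one]
    fun_prop
  have hne : ∀ N, (S N).Nonempty := by
    intro N
    classical
    -- Non-emptiness: a cone vector at the last visit up to time `N` is pulled back to `z`, and
    -- backward invariance keeps it in the cone at all earlier visits.
    obtain ⟨n, hn⟩ : ∃ n, n = Nat.findGreatest (fun n => InA η ((mapH η ^ n) z)) N := ⟨_, rfl⟩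
    have hnA : InA η ((mapH η ^ n) z) := by
      rw [hn]
      exact Nat.findGreatest_spec (P := fun n => InA η ((mapH η ^ n) z)) (Nat.zero_le N) hA
    have hmax : ∀ m ≤ N, InA η ((mapH η ^ m) z) → m ≤ n := by
      intro m hm hmA
      rw [hn]
      exact Nat.le_findGreatest hm hmA
    obtain ⟨L, hL⟩ : ∃ L, L = cocycle (mapH η) (jacH η) n z := ⟨_, rfl⟩
    have hdet : IsUnit L.det := by rw [hL, det_cocycle]; exact isUnit_one
    obtain ⟨v, hv⟩ : ∃ v, L.mulVec v = ![1 - μ, 1] := by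
      refine ⟨L⁻¹.mulVec ![1 - μ, 1], ?_⟩
      rw [Matrix.mulVec_mulVec, Matrix.mul_nonsing_inv _ hdet, Matrix.one_mulVec]
    have hvn : VCone μ r (L.mulVec v) := by
      rw [hv]
      refine ⟨μ, le_rfl, hμr, ?_⟩
      simp
    have hall : ∀ m ≤ N, InA η ((mapH η ^ m) z) →
        VCone μ r ((cocycle (mapH η) (jacH η) m z).mulVec v) := by
      intro m hm hmA
      obtain ⟨k, rfl⟩ := Nat.exists_eq_add_of_le (hmax m hm hmA)
      rw [hL, cocycle_add, ← Matrix.mulVec_mulVec] at hvn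
      rw [add_comm, pow_add, Equiv.Perm.mul_apply] at hnA
      exact (P.back hθ h1 h2 h3 k _ (hz.pow m) hmA hnA _ hvn).1
    have hv0 : VCone μ r v := by
      have := hall 0 (Nat.zero_le N) hA
      simpa [cocycle] using this
    have hvne : v ≠ 0 := by
      rintro rfl
      rw [Matrix.mulVec_zero] at hv
      have := congrFun hv 1
      simp at this
    have hv1 := hv0.snd_ne_zero hvne
    obtain ⟨ρ, r1, r2, r3⟩ := hv0
    have e : (![1 - ρ, 1] : Fin 2 → ℝ) = (v 1)⁻¹ • v := by
      ext i
      fin_cases i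
      · simp only [Fin.zero_eta, Matrix.cons_val_zero, Pi.smul_apply, smul_eq_mul]
        field_simp
        linarith
      · simp [hv1]
    refine ⟨ρ, ⟨r1, r2⟩, fun m hm hmA => ?_⟩
    rw [e, Matrix.mulVec_smul]
    exact (hall m hm hmA).smul
  obtain ⟨ρ, hρ⟩ := IsCompact.nonempty_iInter_of_sequence_nonempty_isCompact_isClosed S
    (fun N ρ h => ⟨h.1, fun n hn => h.2 n (hn.trans (Nat.le_succ N))⟩) hne
    (isCompact_Icc.of_isClosed_subset (hclosed 0) fun ρ h => h.1) hclosed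
  rw [mem_iInter] at hρ
  refine ⟨![1 - ρ, 1], fun h => ?_, fun n hn => (hρ n).2 n le_rfl hn⟩
  have := congrFun h 1
  simp at this

/-- Under the expansion condition every point of `A` with orbit off the singular set has a direction
in the cone that is contracted exponentially. -/
lemma exists_contracted (P : Rates η (1 / (1 - η)) (1 / η - 2) μ r κ) (hθ : 1 < θ)
    (h1 : θ ^ 3 ≤ rateA (1 / (1 - η)) κ) (h2 : θ ^ 3 ≤ rateAB (1 / (1 - η)) (1 / η - 2) κ)
    (h3 : θ ^ 3 ≤ rateABB (1 / (1 - η)) (1 / η - 2) κ) {z : Torus} (hz : OffSingular η z)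
    (hA : InA η z) : ∃ w : Fin 2 → ℝ, w ≠ 0 ∧ VCone μ r w ∧ ∃ C > 0, ∀ n : ℕ,
      ‖(cocycle (mapH η) (jacH η) n z).mulVec w‖ ≤ C * (θ⁻¹) ^ n := by
  obtain ⟨w, hw, hcone⟩ := exists_vCone_forever P hθ.le h1 h2 h3 hz hA
  have hη := P.pos
  have hη' := P.lt
  have hμ := P.lt_μ
  have hw0 : VCone μ r w := by simpa [cocycle] using hcone 0 hA
  obtain ⟨M, hM1, hM⟩ := exists_jacH_bound hη (by linarith : η < 1)
  have hθ0 : 0 < θ := by linarith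
  have visit : ∀ n : ℕ, InA η ((mapH η ^ n) z) →
      ‖(cocycle (mapH η) (jacH η) n z).mulVec w‖ ≤ ‖w‖ * (θ⁻¹) ^ n := by
    intro n hn
    have := (P.back hθ.le h1 h2 h3 n z hz hA hn w (hcone n hn)).2
    rw [(hcone n hn).norm_eq (by linarith), hw0.norm_eq (by linarith), inv_pow,
      ← div_eq_mul_inv, le_div_iff₀ (by positivity)]
    linarith
  have hwpos : 0 < ‖w‖ := norm_pos_iff.2 hw
  -- At most two steps separate time `n` from the last visit, and each costs a factor `M θ` against
  -- the decay `θ⁻¹ ^ n`.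
  refine ⟨w, hw, hw0, ‖w‖ * (M * θ) ^ 2, by positivity, fun n => ?_⟩
  have hMθ : 1 ≤ M * θ := by nlinarith
  have grow : ∀ n C', ‖(cocycle (mapH η) (jacH η) n z).mulVec w‖ ≤ C' * (θ⁻¹) ^ n →
      ‖(cocycle (mapH η) (jacH η) (n + 1) z).mulVec w‖ ≤ C' * (M * θ) * (θ⁻¹) ^ (n + 1) := by
    intro n C' h
    rw [cocycle, ← Matrix.mulVec_mulVec]
    refine (hM _ _).1.trans ?_
    calc M * ‖(cocycle (mapH η) (jacH η) n z).mulVec w‖ ≤ M * (C' * (θ⁻¹) ^ n) :=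
          mul_le_mul_of_nonneg_left h (by linarith)
      _ = C' * (M * θ) * (θ⁻¹) ^ (n + 1) := by rw [pow_succ]; field_simp
  have mono : ∀ n C' C'', C' ≤ C'' →
      ‖(cocycle (mapH η) (jacH η) n z).mulVec w‖ ≤ C' * (θ⁻¹) ^ n →
      ‖(cocycle (mapH η) (jacH η) n z).mulVec w‖ ≤ C'' * (θ⁻¹) ^ n :=
    fun n C' C'' h h' => h'.trans (mul_le_mul_of_nonneg_right h (by positivity))
  have m1 : ‖w‖ ≤ ‖w‖ * (M * θ) ^ 2 := le_mul_of_one_le_right hwpos.le (one_le_pow₀ hMθ)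
  have m2 : ‖w‖ * (M * θ) ≤ ‖w‖ * (M * θ) ^ 2 :=
    mul_le_mul_of_nonneg_left (le_self_pow₀ hMθ two_ne_zero) hwpos.le
  by_cases hn : InA η ((mapH η ^ n) z)
  · exact mono n _ _ m1 (visit n hn)
  rcases n with _ | n
  · exact absurd hA hn
  by_cases hn' : InA η ((mapH η ^ n) z)
  · exact mono _ _ _ m2 (grow n _ (visit n hn'))
  rcases n with _ | n
  · exact absurd hA hn'
  have hn'' : InA η ((mapH η ^ n) z) := by
    by_contra hcon
    rw [pow_succ', Equiv.Perm.mul_apply] at hn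
    rw [pow_succ', Equiv.Perm.mul_apply] at hn' hn
    exact hn ((hz.pow n).inA_map_map hη (by linarith) hcon hn')
  have := grow _ _ (grow n _ (visit n hn''))
  rwa [mul_assoc (‖w‖), ← sq] at this

/-- Some backward image of a point with orbit off the singular set lies in `A`. -/
lemma OffSingular.exists_inA {z : Torus} (hη : 0 < η) (hη1 : η < 1 / 2) (hz : OffSingular η z) :
    ∃ (j : ℕ) (z' : Torus), (mapH η ^ j) z' = z ∧ InA η z' := by
  by_cases h0 : InA η z
  · exact ⟨0, z, rfl, h0⟩
  by_cases h1 : InA η ((mapH η)⁻¹ z)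
  · exact ⟨1, _, by simp, h1⟩
  by_cases h2 : InA η ((mapH η)⁻¹ ((mapH η)⁻¹ z))
  · refine ⟨2, _, ?_, h2⟩
    rw [sq, Equiv.Perm.mul_apply]; simp
  have := hz.map_inv.map_inv.inA_map_map hη hη1 h2 (by simpa using h1)
  exact absurd (by simpa using this) h0

end stable

/-! ### Lyapunov exponents -/

lemma tendsto_log_rate {c m : ℝ} :
    Tendsto (fun n : ℕ => (1 / (n : ℝ)) * (Real.log c + n * Real.log m)) atTop
      (𝓝 (Real.log m)) := by
  have h1 : Tendsto (fun n : ℕ => (1 / (n : ℝ)) * Real.log c + Real.log m) atTop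
      (𝓝 (0 * Real.log c + Real.log m)) :=
    (tendsto_one_div_atTop_nhds_zero_nat.mul_const _).add_const _
  rw [zero_mul, zero_add] at h1
  refine h1.congr' ?_
  filter_upwards [eventually_gt_atTop 0] with n hn
  have : (n : ℝ) ≠ 0 := by positivity
  field_simp

/-- Both bounds serve each conclusion: together they make the sequence bounded, without which a real
`limsup` may be a default value. -/
lemma limsup_log_bounds {u : ℕ → ℝ} {c C m M : ℝ} (hc : 0 < c) (hC : 0 < C) (hm : 0 < m)
    (hM : 0 < M) (h1 : ∀ n, c * m ^ n ≤ u n) (h2 : ∀ n, u n ≤ C * M ^ n) :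
    Real.log m ≤ limsup (fun n : ℕ => (1 / (n : ℝ)) * Real.log (u n)) atTop ∧
      limsup (fun n : ℕ => (1 / (n : ℝ)) * Real.log (u n)) atTop ≤ Real.log M := by
  have t1 := tendsto_log_rate (c := c) (m := m)
  have t2 := tendsto_log_rate (c := C) (m := M)
  have hu : ∀ n, 0 < u n := fun n => lt_of_lt_of_le (by positivity) (h1 n)
  have low : ∀ n : ℕ, (1 / (n : ℝ)) * (Real.log c + n * Real.log m) ≤
      (1 / (n : ℝ)) * Real.log (u n) := by
    intro n
    refine mul_le_mul_of_nonneg_left ?_ (by positivity)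
    rw [← Real.log_pow, ← Real.log_mul hc.ne' (by positivity)]
    exact Real.log_le_log (by positivity) (h1 n)
  have high : ∀ n : ℕ, (1 / (n : ℝ)) * Real.log (u n) ≤
      (1 / (n : ℝ)) * (Real.log C + n * Real.log M) := by
    intro n
    refine mul_le_mul_of_nonneg_left ?_ (by positivity)
    rw [← Real.log_pow, ← Real.log_mul hC.ne' (by positivity)]
    exact Real.log_le_log (hu n) (h2 n)
  have b1 : IsBoundedUnder (· ≤ ·) atTop fun n : ℕ => (1 / (n : ℝ)) * Real.log (u n) :=
    t2.isBoundedUnder_le.mono_le (Eventually.of_forall high)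
  have b2 : IsBoundedUnder (· ≥ ·) atTop fun n : ℕ => (1 / (n : ℝ)) * Real.log (u n) :=
    t1.isBoundedUnder_ge.mono_ge (Eventually.of_forall low)
  constructor
  · rw [← t1.limsup_eq]
    exact limsup_le_limsup (Eventually.of_forall low) t1.isCoboundedUnder_le b1
  · rw [← t2.limsup_eq]
    exact limsup_le_limsup (Eventually.of_forall high) b2.isCoboundedUnder_le t2.isBoundedUnder_le

end ToralShear


namespace ToralShear

/-! ### The dichotomy for growth rates -/

section dichotomy

variable {η μ r κ θ : ℝ}

/-- The expansion hypothesis in the form in which it is used below. -/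
structure Expanding (η μ r κ θ : ℝ) : Prop where
  rates : Rates η (1 / (1 - η)) (1 / η - 2) μ r κ
  one_lt : 1 < θ
  leA : θ ^ 3 ≤ rateA (1 / (1 - η)) κ
  leAB : θ ^ 3 ≤ rateAB (1 / (1 - η)) (1 / η - 2) κ
  leABB : θ ^ 3 ≤ rateABB (1 / (1 - η)) (1 / η - 2) κ

/-- Every orbit off the singular set has an exponentially contracted direction, which comes from the
cone at an earlier visit to `A`. -/
lemma Expanding.exists_stable (E : Expanding η μ r κ θ) {z : Torus} (hz : OffSingular η z) :
    ∃ (j : ℕ) (z' : Torus) (w : Fin 2 → ℝ), (mapH η ^ j) z' = z ∧ InA η z' ∧ OffSingular η z' ∧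
      w ≠ 0 ∧ VCone μ r w ∧ (cocycle (mapH η) (jacH η) j z').mulVec w ≠ 0 ∧ ∃ C > 0, ∀ n : ℕ,
        ‖(cocycle (mapH η) (jacH η) n z).mulVec ((cocycle (mapH η) (jacH η) j z').mulVec w)‖ ≤
          C * θ⁻¹ ^ n := by
  have hη := E.rates.pos
  have hη' := E.rates.lt
  have hθ := E.one_lt
  obtain ⟨j, z', rfl, hA⟩ := hz.exists_inA hη (by linarith)
  have hz' : OffSingular η z' := by
    have := hz.zpow (-(j : ℤ))
    rwa [← Equiv.Perm.mul_apply, ← zpow_natCast, ← zpow_add, neg_add_cancel, zpow_zero,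
      Equiv.Perm.one_apply] at this
  obtain ⟨w, hw, hcone, C, hC, hdec⟩ :=
    exists_contracted E.rates hθ E.leA E.leAB E.leABB hz' hA
  obtain ⟨M, hM1, hM⟩ := exists_jacH_bound hη (by linarith : η < 1)
  refine ⟨j, z', w, rfl, hA, hz', hw, hcone, ?_, C, hC, fun n => ?_⟩
  · intro h0
    have := (cocycle_bounds hM1 hM j z' w).2
    rw [h0, norm_zero, mul_zero] at this
    exact hw (norm_le_zero_iff.1 this)
  · rw [Matrix.mulVec_mulVec, ← cocycle_add]
    refine (hdec _).trans (mul_le_mul_of_nonneg_left ?_ hC.le)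
    refine pow_le_pow_of_le_one (by positivity) (inv_le_one_of_one_le₀ hθ.le) (by omega)

/-- A vector is either a multiple of the contracted direction or expanded exponentially. -/
lemma Expanding.rate_dichotomy (E : Expanding η μ r κ θ) {z : Torus} {w v : Fin 2 → ℝ}
    (hw : w ≠ 0) {C : ℝ} (hC : 0 < C)
    (hdec : ∀ n : ℕ, ‖(cocycle (mapH η) (jacH η) n z).mulVec w‖ ≤ C * θ⁻¹ ^ n) (hv : v ≠ 0) :
    ∃ c C' m M : ℝ, 0 < c ∧ 0 < C' ∧ 0 < m ∧ 0 < M ∧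
      (∀ n : ℕ, c * m ^ n ≤ ‖(cocycle (mapH η) (jacH η) n z).mulVec v‖) ∧
      (∀ n : ℕ, ‖(cocycle (mapH η) (jacH η) n z).mulVec v‖ ≤ C' * M ^ n) ∧
      ((M < 1 ∧ ∃ b : ℝ, b ≠ 0 ∧ v = b • w) ∨ 1 < m) := by
  have hη := E.rates.pos
  have hη' := E.rates.lt
  have hθ := E.one_lt
  have hθ0 : 0 < θ := by linarith
  obtain ⟨M, hM1, hM⟩ := exists_jacH_bound hη (by linarith : η < 1)
  have hM0 : 0 < M := by linarith
  have hvpos : 0 < ‖v‖ := norm_pos_iff.2 hv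
  have hlow : ∀ n : ℕ, ‖v‖ * M⁻¹ ^ n ≤ ‖(cocycle (mapH η) (jacH η) n z).mulVec v‖ := by
    intro n
    have := (cocycle_bounds hM1 hM n z v).2
    rw [inv_pow, ← div_eq_mul_inv, div_le_iff₀ (by positivity)]
    linarith
  by_cases hdet : v 0 * w 1 - v 1 * w 0 = 0
  · obtain ⟨b, hb⟩ : ∃ b : ℝ, v = b • w := by
      by_cases h0 : w 0 = 0
      · have h1 : w 1 ≠ 0 := by
          intro h1
          apply hw
          ext i
          fin_cases i
          · exact h0
          · exact h1
        refine ⟨v 1 / w 1, ?_⟩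
        rw [h0, mul_zero, sub_zero] at hdet
        ext i
        fin_cases i
        · simp [h0, (mul_eq_zero.1 hdet).resolve_right h1]
        · simp [h1]
      · refine ⟨v 0 / w 0, ?_⟩
        ext i
        fin_cases i
        · simp [h0]
        · simp only [Fin.mk_one, Pi.smul_apply, smul_eq_mul]
          field_simp
          linarith
    have hb0 : b ≠ 0 := by
      rintro rfl
      exact hv (by simpa using hb)
    refine ⟨‖v‖, |b| * C, M⁻¹, θ⁻¹, hvpos, by positivity, by positivity, by positivity, hlow,
      fun n => ?_, Or.inl ⟨inv_lt_one_of_one_lt₀ hθ, b, hb0, hb⟩⟩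
    rw [hb, Matrix.mulVec_smul, norm_smul, Real.norm_eq_abs, mul_assoc]
    exact mul_le_mul_of_nonneg_left (hdec n) (abs_nonneg _)
  -- The area spanned by `v` and `w` is preserved while `w` shrinks like `θ⁻¹ ^ n`, so `v` must grow
  -- at least like `θ ^ n`.
  · have hd : 0 < |v 0 * w 1 - v 1 * w 0| := abs_pos.2 hdet
    refine ⟨|v 0 * w 1 - v 1 * w 0| / (2 * C), ‖v‖, θ, M, by positivity, hvpos, hθ0, hM0,
      fun n => ?_, fun n => ?_, Or.inr hθ⟩
    · have h := wedge_cocycle (η := η) n z v w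
      have h1 := hdec n
      generalize (cocycle (mapH η) (jacH η) n z).mulVec v = v' at *
      generalize (cocycle (mapH η) (jacH η) n z).mulVec w = w' at *
      rw [← h]
      have v0 : |v' 0| ≤ ‖v'‖ := norm_le_pi_norm v' 0
      have v1 : |v' 1| ≤ ‖v'‖ := norm_le_pi_norm v' 1
      have w0 : |w' 0| ≤ ‖w'‖ := norm_le_pi_norm w' 0
      have w1 : |w' 1| ≤ ‖w'‖ := norm_le_pi_norm w' 1
      have h2 : |v' 0 * w' 1 - v' 1 * w' 0| ≤ 2 * (‖v'‖ * ‖w'‖) := by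
        refine (abs_sub _ _).trans ?_
        rw [abs_mul, abs_mul]
        have e1 := mul_le_mul v0 w1 (abs_nonneg _) (norm_nonneg _)
        have e2 := mul_le_mul v1 w0 (abs_nonneg _) (norm_nonneg _)
        linarith
      have h3 : ‖v'‖ * ‖w'‖ ≤ ‖v'‖ * (C * θ⁻¹ ^ n) := mul_le_mul_of_nonneg_left h1 (norm_nonneg _)
      have h4 : |v' 0 * w' 1 - v' 1 * w' 0| ≤ 2 * (‖v'‖ * (C * θ⁻¹ ^ n)) := by linarith
      calc |v' 0 * w' 1 - v' 1 * w' 0| / (2 * C) * θ ^ n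
          ≤ 2 * (‖v'‖ * (C * θ⁻¹ ^ n)) / (2 * C) * θ ^ n := by gcongr
        _ = ‖v'‖ := by rw [inv_pow]; field_simp
    · rw [mul_comm]
      exact (cocycle_bounds hM1 hM n z v).1

/-- A direction of negative exponent is a multiple of the contracted direction. -/
lemma Expanding.eq_smul_of_lyapunov_neg (E : Expanding η μ r κ θ) {z : Torus} {w v : Fin 2 → ℝ}
    (hw : w ≠ 0) {C : ℝ} (hC : 0 < C)
    (hdec : ∀ n : ℕ, ‖(cocycle (mapH η) (jacH η) n z).mulVec w‖ ≤ C * θ⁻¹ ^ n) (hv : v ≠ 0)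
    (hneg : lyapunov (mapH η) (jacH η) z v < 0) : ∃ b : ℝ, b ≠ 0 ∧ v = b • w := by
  obtain ⟨c, C', m, M, hc, hC', hm, hM, h1, h2, h3⟩ := E.rate_dichotomy hw hC hdec hv
  have := limsup_log_bounds hc hC' hm hM h1 h2
  rcases h3 with ⟨-, h⟩ | h3
  · exact h
  · exact absurd (this.1.trans_lt hneg) (not_lt.2 (Real.log_pos h3).le)

/-- All exponents along an orbit off the singular set are non-zero. -/
lemma Expanding.lyapunov_ne_zero (E : Expanding η μ r κ θ) {z : Torus} (hz : OffSingular η z)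
    {v : Fin 2 → ℝ} (hv : v ≠ 0) : lyapunov (mapH η) (jacH η) z v ≠ 0 := by
  obtain ⟨j, z', w, -, -, -, -, -, hw, C, hC, hdec⟩ := E.exists_stable hz
  obtain ⟨c, C', m, M, hc, hC', hm, hM, h1, h2, h3⟩ := E.rate_dichotomy hw hC hdec hv
  have := limsup_log_bounds hc hC' hm hM h1 h2
  rcases h3 with ⟨h3, -⟩ | h3
  · exact (this.2.trans_lt (Real.log_neg hM h3)).ne
  · exact ((Real.log_pos h3).trans_le this.1).ne'

end dichotomy

/-! ### Reversibility -/

/-- The linear involution that conjugates `H` to its inverse. -/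
def revT : Equiv.Perm Torus where
  toFun z := (-z.1, z.2 - z.1)
  invFun z := (-z.1, z.2 - z.1)
  left_inv z := by ext <;> simp
  right_inv z := by ext <;> simp

/-- The matrix of the involution. -/
def revM : Matrix (Fin 2) (Fin 2) ℝ := !![-1, 0; -1, 1]

lemma revT_pt (y s : ℝ) : revT (pt y s) = pt s y := by
  unfold pt revT
  ext
  · simp only [Equiv.coe_fn_mk, AddCircle.coe_sub]; abel
  · simp only [Equiv.coe_fn_mk, AddCircle.coe_sub]; abel

lemma revT_revT (z : Torus) : revT (revT z) = z := revT.left_inv z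

/-- In the coordinates `(y, s)` the involution exchanges the two entries, and the recursion is
symmetric under time reversal. -/
lemma mapH_inv_apply (η : ℝ) (z : Torus) : (mapH η)⁻¹ z = revT (mapH η (revT z)) := by
  obtain ⟨y, s, rfl⟩ := exists_eq_pt z
  rw [revT_pt, mapH_pt, revT_pt, mapH_inv_pt]

lemma mapH_inv_pow_apply (η : ℝ) (n : ℕ) (z : Torus) :
    ((mapH η)⁻¹ ^ n) z = revT ((mapH η ^ n) (revT z)) := by
  induction n with
  | zero => simp [revT_revT]
  | succ n ih =>
    rw [pow_succ', Equiv.Perm.mul_apply, ih, mapH_inv_apply, revT_revT, pow_succ',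
      Equiv.Perm.mul_apply]

lemma revM_mul_revM : revM * revM = 1 := by
  unfold revM
  ext i j
  fin_cases i <;> fin_cases j <;> simp [Matrix.mul_apply, Fin.sum_univ_two]

lemma jacHinv_eq (η : ℝ) (z : Torus) : jacHinv η z = revM * jacH η (revT z) * revM := by
  have e : ((mapH η)⁻¹ z).2 = (revT z).2 := mapH_inv_snd η z
  unfold jacHinv jacH
  rw [e]
  split_ifs
  · rw [jacA_inv, jacA_eq]
    unfold revM
    ext i j
    fin_cases i <;> fin_cases j <;> simp [Matrix.mul_apply, Fin.sum_univ_two]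
  · rw [jacB_inv, jacB_eq]
    unfold revM
    ext i j
    fin_cases i <;> fin_cases j <;> simp [Matrix.mul_apply, Fin.sum_univ_two]
    ring

lemma cocycle_inv_eq (η : ℝ) (n : ℕ) (z : Torus) :
    cocycle (mapH η)⁻¹ (jacHinv η) n z =
      revM * cocycle (mapH η) (jacH η) n (revT z) * revM := by
  induction n with
  | zero => simp [cocycle, revM_mul_revM]
  | succ n ih =>
    rw [cocycle, ih, jacHinv_eq, mapH_inv_pow_apply, revT_revT, cocycle]
    calc revM * jacH η ((mapH η ^ n) (revT z)) * revM *
          (revM * cocycle (mapH η) (jacH η) n (revT z) * revM)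
        = revM * jacH η ((mapH η ^ n) (revT z)) * (revM * revM) *
          (cocycle (mapH η) (jacH η) n (revT z) * revM) := by
          simp only [Matrix.mul_assoc]
      _ = _ := by rw [revM_mul_revM, Matrix.mul_one]; simp only [Matrix.mul_assoc]

lemma norm_revM_mulVec_le (v : Fin 2 → ℝ) : ‖revM.mulVec v‖ ≤ 2 * ‖v‖ := by
  have v0 : |v 0| ≤ ‖v‖ := norm_le_pi_norm v 0
  have v1 : |v 1| ≤ ‖v‖ := norm_le_pi_norm v 1
  have hN := norm_nonneg v
  rw [norm_fin_two (revM.mulVec v)]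
  unfold revM
  refine max_le ?_ ?_
  · simp [Matrix.mulVec, dotProduct, Fin.sum_univ_two]; linarith
  · simp [Matrix.mulVec, dotProduct, Fin.sum_univ_two]
    have := abs_add_le (-v 0) (v 1)
    rw [abs_neg] at this
    linarith

lemma revM_mulVec_revM (v : Fin 2 → ℝ) : revM.mulVec (revM.mulVec v) = v := by
  rw [Matrix.mulVec_mulVec, revM_mul_revM, Matrix.one_mulVec]

lemma revM_mulVec_ne_zero {v : Fin 2 → ℝ} (hv : v ≠ 0) : revM.mulVec v ≠ 0 := by
  intro h
  apply hv
  rw [← revM_mulVec_revM v, h, Matrix.mulVec_zero]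

/-- The singular set depends on the second coordinate only, and `revT w` has the same second
coordinate as `(mapH η)⁻¹ w`. -/
lemma OffSingular.revT {η : ℝ} {z : Torus} (h : OffSingular η z) :
    OffSingular η (ToralShear.revT z) := by
  have key : ∀ n : ℤ, ∃ m : ℤ, ((mapH η ^ n) (ToralShear.revT z)).2 = ((mapH η ^ m) z).2 := by
    have e1 : ∀ w, (ToralShear.revT w).2 = ((mapH η)⁻¹ w).2 := fun w => (mapH_inv_snd η w).symm
    intro n
    refine ⟨-1 + -n, ?_⟩
    have e2 : (mapH η ^ n) (ToralShear.revT z) = ToralShear.revT ((mapH η ^ (-n)) z) := by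
      rcases Int.eq_nat_or_neg n with ⟨k, rfl | rfl⟩
      · have := mapH_inv_pow_apply η k z
        rw [zpow_neg, zpow_natCast, ← inv_pow, this, revT_revT]
      · have := mapH_inv_pow_apply η k (ToralShear.revT z)
        rw [revT_revT] at this
        rw [neg_neg, zpow_neg, zpow_natCast, ← inv_pow, this]
    rw [e2, e1, zpow_add, Equiv.Perm.mul_apply, zpow_neg_one]
  intro n hn
  obtain ⟨m, hm⟩ := key n
  apply h m
  unfold singularSet at hn ⊢
  simp only [mem_ofPred_eq] at hn ⊢
  rwa [← hm]

lemma lyapunov_inv_eq (η : ℝ) (z : Torus) (v : Fin 2 → ℝ) :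
    lyapunov (mapH η)⁻¹ (jacHinv η) z v = limsup (fun n : ℕ => (1 / (n : ℝ)) * Real.log
      ‖revM.mulVec ((cocycle (mapH η) (jacH η) n (revT z)).mulVec (revM.mulVec v))‖) atTop := by
  unfold lyapunov
  simp only [cocycle_inv_eq, Matrix.mulVec_mulVec, Matrix.mul_assoc]

/-! ### Exponents of the inverse map -/

section reversed

variable {η μ r κ θ : ℝ}

/-- The dichotomy for the exponents of `H⁻¹`. -/
lemma Expanding.lyapunov_inv_dichotomy (E : Expanding η μ r κ θ) {z : Torus} {w v : Fin 2 → ℝ}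
    (hw : w ≠ 0) {C : ℝ} (hC : 0 < C)
    (hdec : ∀ n : ℕ, ‖(cocycle (mapH η) (jacH η) n (revT z)).mulVec w‖ ≤ C * θ⁻¹ ^ n)
    (hv : v ≠ 0) :
    (lyapunov (mapH η)⁻¹ (jacHinv η) z v < 0 ∧ lyapunov (mapH η) (jacH η) (revT z)
      (revM.mulVec v) < 0) ∨ (0 < lyapunov (mapH η)⁻¹ (jacHinv η) z v ∧
      0 < lyapunov (mapH η) (jacH η) (revT z) (revM.mulVec v)) := by
  obtain ⟨c, C', m, M, hc, hC', hm, hM, h1, h2, h3⟩ :=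
    E.rate_dichotomy hw hC hdec (revM_mulVec_ne_zero hv)
  have h0 := limsup_log_bounds hc hC' hm hM h1 h2
  have := limsup_log_bounds (u := fun n : ℕ =>
      ‖revM.mulVec ((cocycle (mapH η) (jacH η) n (revT z)).mulVec (revM.mulVec v))‖)
    (c := c / 2) (C := 2 * C') (by positivity) (by positivity) hm hM
    (fun n => by
      have := norm_revM_mulVec_le (revM.mulVec
        ((cocycle (mapH η) (jacH η) n (revT z)).mulVec (revM.mulVec v)))
      rw [revM_mulVec_revM] at this
      linarith [h1 n])
    (fun n => by
      have := norm_revM_mulVec_le ((cocycle (mapH η) (jacH η) n (revT z)).mulVec (revM.mulVec v))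
      linarith [h2 n])
  rw [lyapunov_inv_eq]
  rcases h3 with ⟨h3, -⟩ | h3
  · exact Or.inl ⟨this.2.trans_lt (Real.log_neg hM h3), h0.2.trans_lt (Real.log_neg hM h3)⟩
  · exact Or.inr ⟨(Real.log_pos h3).trans_le this.1, (Real.log_pos h3).trans_le h0.1⟩

end reversed

lemma revT_add_proj (z : Torus) (v : Fin 2 → ℝ) :
    revT (z + proj v) = revT z + proj (revM.mulVec v) := by
  unfold revT proj revM
  ext
  · simp [Matrix.mulVec, dotProduct, Fin.sum_univ_two]; abel
  · simp [Matrix.mulVec, dotProduct, Fin.sum_univ_two]; abel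

lemma revT_image_seg (z : Torus) (v : Fin 2 → ℝ) (a b : ℝ) :
    revT '' seg z v a b = seg (revT z) (revM.mulVec v) a b := by
  unfold seg
  rw [image_image]
  simp only [revT_add_proj, Matrix.mulVec_smul]

end ToralShear


namespace ToralShear

/-! ### Local stable manifolds -/

lemma norm_coe_le (y : ℝ) : ‖(y : UnitAddCircle)‖ ≤ |y| := by
  rw [UnitAddCircle.norm_eq]
  simpa using round_le y 0

lemma dist_proj_le (u v : Fin 2 → ℝ) : dist (proj u) (proj v) ≤ ‖u - v‖ := by
  unfold proj
  rw [Prod.dist_eq]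
  refine max_le ?_ ?_
  · rw [dist_eq_norm, ← AddCircle.coe_sub]
    exact (norm_coe_le _).trans (norm_le_pi_norm (u - v) 0)
  · rw [dist_eq_norm, ← AddCircle.coe_sub]
    exact (norm_coe_le _).trans (norm_le_pi_norm (u - v) 1)

/-- The map is affine near a point off the singular set. -/
lemma mapH_add_proj {η : ℝ} (hη : 0 < η) (hη1 : η < 1) {z : Torus} (hz : z ∉ singularSet η)
    {u : Fin 2 → ℝ} (h1 : |u 1| ≤ ‖z.2‖)
    (h2 : |u 1| ≤ ‖z.2 - ((1 - η : ℝ) : UnitAddCircle)‖) :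
    mapH η (z + proj u) = mapH η z + proj ((jacH η z).mulVec u) := by
  by_cases hA : InA η z
  · obtain ⟨y, hy, y0, y1⟩ := hA.exists_lift hz
    have e : z = pt y (rep (z.2 - z.1)) := eq_pt_of_snd hy (coe_rep _).symm
    generalize rep (z.2 - z.1) = s at e
    rw [hy] at h1 h2
    rw [← AddCircle.coe_sub] at h2
    have h1' := h1.trans (norm_coe_le y)
    have h2' := h2.trans (norm_coe_le _)
    rw [abs_of_pos y0] at h1'
    rw [abs_of_neg (show y - (1 - η) < 0 by linarith)] at h2'
    have b1 := neg_abs_le (u 1)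
    have b2 := le_abs_self (u 1)
    rw [jacH_mulVec_of_inA hA]
    have p1 := pt_add_proj y s 1 u
    rw [one_smul] at p1
    have p2 := pt_add_proj ((2 + 1 / (1 - η)) * y - s) y 1
      ![u 0 + 1 / (1 - η) * u 1, u 0 + (1 + 1 / (1 - η)) * u 1]
    rw [one_smul] at p2
    rw [e, p1, mapH_pt_A hη y0.le y1.le, mapH_pt_A hη (by linarith) (by linarith), p2]
    simp only [Matrix.cons_val_zero, Matrix.cons_val_one, Matrix.cons_val_fin_one]
    congr 1 <;> ring
  · obtain ⟨y, hy, y0, y1⟩ := exists_lift_of_not_inA hA hz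
    have e : z = pt y (rep (z.2 - z.1)) := eq_pt_of_snd hy (coe_rep _).symm
    generalize rep (z.2 - z.1) = s at e
    rw [hy] at h1 h2
    have hc : ((y : ℝ) : UnitAddCircle) - ((1 - η : ℝ) : UnitAddCircle) = ((y + η : ℝ)) := by
      rw [← AddCircle.coe_sub, ← coe_add_int (y - (1 - η)) 1]
      congr 1; push_cast; ring
    rw [hc] at h2
    have h1' := h1.trans (norm_coe_le y)
    have h2' := h2.trans (norm_coe_le _)
    rw [abs_of_neg y1] at h1'
    rw [abs_of_pos (show 0 < y + η by linarith)] at h2'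
    have b1 := neg_abs_le (u 1)
    have b2 := le_abs_self (u 1)
    rw [jacH_mulVec_of_not_inA hA]
    have p1 := pt_add_proj y s 1 u
    rw [one_smul] at p1
    have p2 := pt_add_proj (-(1 / η - 2) * y - s) y 1
      ![u 0 + -(1 / η) * u 1, u 0 + (1 + -(1 / η)) * u 1]
    rw [one_smul] at p2
    rw [e, p1, mapH_pt_B hη hη1 y0.le y1.le, mapH_pt_B hη hη1 (by linarith) (by linarith), p2]
    simp only [Matrix.cons_val_zero, Matrix.cons_val_one, Matrix.cons_val_fin_one]
    congr 1 <;> ring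

/-- The orbit of `z` approaches the singular set at most at the exponential rate `ℓ`. -/
def SlowApproach (η ℓ : ℝ) (z : Torus) : Prop :=
  ∃ δ > 0, ∀ n : ℕ, δ * ℓ ^ n ≤ ‖((mapH η ^ n) z).2‖ ∧
    δ * ℓ ^ n ≤ ‖((mapH η ^ n) z).2 - ((1 - η : ℝ) : UnitAddCircle)‖

section manifolds

variable {η μ r κ θ : ℝ}

/-- The contracted direction integrates to a local stable manifold if the orbit approaches the
singular set slowly. -/
lemma Expanding.exists_seg (E : Expanding η μ r κ θ) {z : Torus} (hz : OffSingular η z)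
    (hs : SlowApproach η θ⁻¹ z) : ∃ (w : Fin 2 → ℝ) (ε C : ℝ), w ≠ 0 ∧ 0 < ε ∧ 0 < C ∧
      (∀ n : ℕ, ‖(cocycle (mapH η) (jacH η) n z).mulVec w‖ ≤ C * θ⁻¹ ^ n) ∧
      lyapunov (mapH η) (jacH η) z w < 0 ∧
      ∀ ζ ∈ seg z w ε ε, ∀ ζ' ∈ seg z w ε ε,
        Tendsto (fun n : ℕ => dist ((mapH η ^ n) ζ) ((mapH η ^ n) ζ')) atTop (𝓝 0) := by
  have hη := E.rates.pos
  have hη' := E.rates.lt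
  have hθ := E.one_lt
  have hθ0 : 0 < θ⁻¹ := by positivity
  have hθ1 : θ⁻¹ < 1 := inv_lt_one_of_one_lt₀ hθ
  obtain ⟨j, z', w', -, -, -, -, -, hw, C, hC, hdec⟩ := E.exists_stable hz
  generalize (cocycle (mapH η) (jacH η) j z').mulVec w' = w at hw hdec
  obtain ⟨δ, hδ, hd⟩ := hs
  -- With half-length `δ / C` the `n`-th image has half-length at most `δ θ⁻¹ ^ n`, hence no larger
  -- than the distance of the orbit point from the singular lines. The segment is never cut and `H ^
  -- n` is affine on it.
  refine ⟨w, δ / C, C, hw, by positivity, hC, hdec, ?_, ?_⟩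
  · obtain ⟨c, C', m, M, hc, hC', hm, hM, h1, -, -⟩ := E.rate_dichotomy hw hC hdec hw
    exact (limsup_log_bounds hc hC hm hθ0 h1 hdec).2.trans_lt (Real.log_neg hθ0 hθ1)
  have aff : ∀ t ∈ Icc (-(δ / C)) (δ / C), ∀ n : ℕ, (mapH η ^ n) (z + proj (t • w)) =
      (mapH η ^ n) z + proj (t • (cocycle (mapH η) (jacH η) n z).mulVec w) := by
    intro t ht n
    induction n with
    | zero => simp [cocycle]
    | succ n ih =>
      have hsmall : |(t • (cocycle (mapH η) (jacH η) n z).mulVec w) 1| ≤ δ * θ⁻¹ ^ n := by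
        have h1 : |t| ≤ δ / C := abs_le.2 ht
        have h2 : |(cocycle (mapH η) (jacH η) n z).mulVec w 1| ≤ C * θ⁻¹ ^ n :=
          (norm_le_pi_norm _ 1).trans (hdec n)
        rw [Pi.smul_apply, smul_eq_mul, abs_mul]
        calc _ ≤ δ / C * (C * θ⁻¹ ^ n) := mul_le_mul h1 h2 (abs_nonneg _) (by positivity)
          _ = _ := by field_simp
      rw [pow_succ', Equiv.Perm.mul_apply, ih, mapH_add_proj hη (by linarith) (hz.pow n).notMem
        (hsmall.trans (hd n).1) (hsmall.trans (hd n).2), cocycle, ← Matrix.mulVec_mulVec,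
        Matrix.mulVec_smul, Equiv.Perm.mul_apply]
  rintro _ ⟨t, ht, rfl⟩ _ ⟨t', ht', rfl⟩
  have lim : Tendsto (fun n : ℕ => |t - t'| * (C * θ⁻¹ ^ n)) atTop (𝓝 0) := by
    have := ((tendsto_pow_atTop_nhds_zero_of_lt_one hθ0.le hθ1).const_mul C).const_mul |t - t'|
    simpa using this
  refine squeeze_zero (fun n => dist_nonneg) (fun n => ?_) lim
  simp only
  rw [aff t ht n, aff t' ht' n, dist_add_left]
  refine (dist_proj_le _ _).trans ?_
  rw [← sub_smul, norm_smul]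
  exact mul_le_mul_of_nonneg_left (hdec n) (abs_nonneg _)

lemma Expanding.exists_isStableManifold (E : Expanding η μ r κ θ) {z : Torus}
    (hz : OffSingular η z) (hs : SlowApproach η θ⁻¹ z) : ∃ γ, IsStableManifold η z γ := by
  obtain ⟨w, ε, C, hw, hε, -, -, hneg, hlim⟩ := E.exists_seg hz hs
  exact ⟨seg z w ε ε, ⟨w, ε, ε, hw, hneg, hε, hε, rfl⟩, hlim⟩

lemma dist_revT_le (p q : Torus) : dist (revT p) (revT q) ≤ 2 * dist p q := by
  have h1 : dist p.1 q.1 ≤ dist p q := by rw [Prod.dist_eq]; exact le_max_left _ _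
  have h2 : dist p.2 q.2 ≤ dist p q := by rw [Prod.dist_eq]; exact le_max_right _ _
  unfold revT
  rw [Prod.dist_eq]
  refine max_le ?_ ?_
  · simp only [Equiv.coe_fn_mk, dist_neg_neg]
    linarith [dist_nonneg (x := p) (y := q)]
  · simp only [Equiv.coe_fn_mk]
    linarith [dist_sub_sub_le p.2 p.1 q.2 q.1]

lemma Expanding.exists_isUnstableManifold (E : Expanding η μ r κ θ) {z : Torus}
    (hz : OffSingular η z) (hs : SlowApproach η θ⁻¹ (revT z)) :
    ∃ γ, IsUnstableManifold η z γ := by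
  obtain ⟨w, ε, C, hw, hε, hC, hdec, hneg, hlim⟩ := E.exists_seg hz.revT hs
  refine ⟨seg z (revM.mulVec w) ε ε, ⟨revM.mulVec w, ε, ε, revM_mulVec_ne_zero hw, ?_, hε, hε, rfl⟩,
    ?_⟩
  · rcases E.lyapunov_inv_dichotomy (z := z) hw hC hdec (revM_mulVec_ne_zero hw) with h | h
    · exact h.1
    · rw [revM_mulVec_revM] at h
      exact absurd hneg (not_lt.2 h.2.le)
  · intro ζ hζ ζ' hζ'
    have hmem : ∀ ξ ∈ seg z (revM.mulVec w) ε ε, revT ξ ∈ seg (revT z) w ε ε := by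
      intro ξ hξ
      have := mem_image_of_mem revT hξ
      rwa [revT_image_seg, revM_mulVec_revM] at this
    have h := (hlim _ (hmem ζ hζ) _ (hmem ζ' hζ')).const_mul 2
    rw [mul_zero] at h
    refine squeeze_zero (fun n => dist_nonneg) (fun n => ?_) h
    rw [mapH_inv_pow_apply, mapH_inv_pow_apply]
    exact dist_revT_le _ _

/-- Points with orbit off the singular set and slow approach in both time directions are
regular. -/
lemma Expanding.mem_regularSet (E : Expanding η μ r κ θ) {z : Torus} (hz : OffSingular η z)
    (hs : SlowApproach η θ⁻¹ z) (hs' : SlowApproach η θ⁻¹ (revT z)) : z ∈ regularSet η := by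
  refine ⟨hz, fun v hv => ⟨E.lyapunov_ne_zero hz hv, ?_⟩, E.exists_isStableManifold hz hs,
    E.exists_isUnstableManifold hz hs'⟩
  obtain ⟨w, ε, C, hw, -, hC, hdec, -⟩ := E.exists_seg hz.revT hs'
  rcases E.lyapunov_inv_dichotomy hw hC hdec hv with h | h
  · exact h.1.ne
  · exact h.1.ne'

end manifolds

/-! ### Invariance of the measure -/

instance : IsProbabilityMeasure (volume : Measure UnitAddCircle) :=
  ⟨UnitAddCircle.measure_univ⟩

lemma measurable_rep : Measurable rep :=
  measurable_subtype_coe.comp (AddCircle.measurableEquivIco (1 : ℝ) 0).measurable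

lemma measurable_profile (η : ℝ) : Measurable (profile η) := by
  unfold profile
  exact Measurable.ite measurableSet_Iic (by fun_prop) (by fun_prop)

lemma measurePreserving_shearG : MeasurePreserving shearG (volume : Measure Torus) volume := by
  refine MeasurePreserving.skew_product (f := id) (g := fun x y => y + x) (.id volume) ?_ ?_
  · exact measurable_snd.add measurable_fst
  · exact Eventually.of_forall fun x => (measurePreserving_add_right volume x).map_eq

lemma measurePreserving_shearF (η : ℝ) :
    MeasurePreserving (shearF η) (volume : Measure Torus) volume := by
  have h : MeasurePreserving (fun p : Torus =>
      (p.1, p.2 + (profile η (rep p.1) : UnitAddCircle))) (volume : Measure Torus) volume := by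
    refine MeasurePreserving.skew_product (f := id)
      (g := fun y x => x + (profile η (rep y) : UnitAddCircle)) (.id volume) ?_ ?_
    · refine measurable_snd.add ?_
      exact AddCircle.measurable_mk'.comp
        ((measurable_profile η).comp (measurable_rep.comp measurable_fst))
    · exact Eventually.of_forall fun x => (measurePreserving_add_right volume _).map_eq
  exact (Measure.measurePreserving_swap.comp h).comp Measure.measurePreserving_swap

lemma measurePreserving_mapH (η : ℝ) :
    MeasurePreserving (mapH η) (volume : Measure Torus) volume :=
  measurePreserving_shearG.comp (measurePreserving_shearF η)

lemma measurePreserving_revT : MeasurePreserving revT (volume : Measure Torus) volume := by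
  refine MeasurePreserving.skew_product (f := Neg.neg) (g := fun x y => y - x)
    (Measure.measurePreserving_neg volume) ?_ ?_
  · exact measurable_snd.sub measurable_fst
  · exact Eventually.of_forall fun x => (measurePreserving_sub_right volume x).map_eq

lemma measurePreserving_mapH_pow (η : ℝ) (n : ℕ) :
    MeasurePreserving (mapH η ^ n : Equiv.Perm Torus) (volume : Measure Torus) volume := by
  have := (measurePreserving_mapH η).iterate n
  rwa [← Equiv.Perm.coe_pow] at this

lemma measurePreserving_mapH_inv_pow (η : ℝ) (n : ℕ) :
    MeasurePreserving ((mapH η)⁻¹ ^ n : Equiv.Perm Torus) (volume : Measure Torus) volume := by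
  have e : ⇑((mapH η)⁻¹ ^ n : Equiv.Perm Torus) = revT ∘ (mapH η ^ n : Equiv.Perm Torus) ∘ revT :=
    funext fun z => mapH_inv_pow_apply η n z
  rw [e]
  exact measurePreserving_revT.comp
    ((measurePreserving_mapH_pow η n).comp measurePreserving_revT)

lemma measurePreserving_mapH_zpow (η : ℝ) (n : ℤ) :
    MeasurePreserving (mapH η ^ n : Equiv.Perm Torus) (volume : Measure Torus) volume := by
  rcases Int.eq_nat_or_neg n with ⟨k, rfl | rfl⟩
  · rw [zpow_natCast]; exact measurePreserving_mapH_pow η k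
  · rw [zpow_neg, zpow_natCast, ← inv_pow]; exact measurePreserving_mapH_inv_pow η k

lemma measurePreserving_snd_torus :
    MeasurePreserving (Prod.snd : Torus → UnitAddCircle) volume volume :=
  measurePreserving_snd

lemma volume_singleton_circle (c : UnitAddCircle) : volume ({c} : Set UnitAddCircle) = 0 := by
  rw [← Metric.closedBall_zero, AddCircle.volume_closedBall]
  simp

lemma ae_offSingular (η : ℝ) : ∀ᵐ z : Torus, OffSingular η z := by
  unfold OffSingular
  rw [ae_all_iff]
  intro n
  have h := (measurePreserving_snd_torus.comp (measurePreserving_mapH_zpow η n))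
  have hs : volume ({0, ((1 - η : ℝ) : UnitAddCircle)} : Set UnitAddCircle) = 0 :=
    measure_union_null (volume_singleton_circle _) (volume_singleton_circle _)
  have := h.measure_preimage (s := {0, ((1 - η : ℝ) : UnitAddCircle)})
    (Set.toFinite _).measurableSet.nullMeasurableSet
  rw [hs] at this
  exact measure_eq_zero_iff_ae_notMem.1 this

lemma exists_pos_mul_le {ℓ : ℝ} (h0 : 0 < ℓ) (h1 : ℓ ≤ 1) {d : ℕ → ℝ} (hd : ∀ n, 0 < d n)
    (he : ∀ᶠ n in atTop, ℓ ^ n < d n) : ∃ δ > 0, ∀ n, δ * ℓ ^ n ≤ d n := by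
  obtain ⟨N, hN⟩ := eventually_atTop.1 he
  obtain ⟨k, -, hk⟩ := Finset.exists_min_image (Finset.range (N + 1)) d ⟨0, by simp⟩
  refine ⟨min 1 (d k), lt_min one_pos (hd k), fun n => ?_⟩
  have hp : 0 < ℓ ^ n := by positivity
  have hp1 : ℓ ^ n ≤ 1 := pow_le_one₀ h0.le h1
  rcases le_or_gt N n with hn | hn
  · calc min 1 (d k) * ℓ ^ n ≤ 1 * ℓ ^ n := mul_le_mul_of_nonneg_right (min_le_left _ _) hp.le
      _ ≤ d n := by rw [one_mul]; exact (hN n hn).le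
  · calc min 1 (d k) * ℓ ^ n ≤ d k * 1 :=
          mul_le_mul (min_le_right _ _) hp1 hp.le (hd k).le
      _ ≤ d n := by rw [mul_one]; exact hk n (by simp; omega)

/-- Borel–Cantelli: by invariance the exceptional set at time `n` has measure at most `2 ℓ ^ n`,
which is summable. -/
lemma ae_eventually_lt (η : ℝ) {ℓ : ℝ} (h0 : 0 < ℓ) (h1 : ℓ < 1) (c : UnitAddCircle) :
    ∀ᵐ z : Torus, ∀ᶠ n : ℕ in atTop, ℓ ^ n < ‖((mapH η ^ n) z).2 - c‖ := by
  have hvol : ∀ n : ℕ, volume {z : Torus | ‖((mapH η ^ n) z).2 - c‖ ≤ ℓ ^ n} ≤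
      ENNReal.ofReal (2 * ℓ ^ n) := by
    intro n
    have h := (measurePreserving_snd_torus.comp (measurePreserving_mapH_pow η n))
    have := h.measure_preimage (s := Metric.closedBall c (ℓ ^ n))
      Metric.isClosed_closedBall.measurableSet.nullMeasurableSet
    have e : (Prod.snd ∘ (mapH η ^ n : Equiv.Perm Torus)) ⁻¹' Metric.closedBall c (ℓ ^ n) =
        {z : Torus | ‖((mapH η ^ n) z).2 - c‖ ≤ ℓ ^ n} := by
      ext z
      simp [Metric.mem_closedBall, dist_eq_norm]
    rw [← e, this, AddCircle.volume_closedBall]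
    exact ENNReal.ofReal_le_ofReal (min_le_right _ _)
  have hsum : ∑' n : ℕ, volume {z : Torus | ‖((mapH η ^ n) z).2 - c‖ ≤ ℓ ^ n} ≠ ⊤ := by
    refine ne_top_of_le_ne_top ?_ (ENNReal.tsum_le_tsum hvol)
    exact ((summable_geometric_of_lt_one h0.le h1).mul_left 2).tsum_ofReal_ne_top
  have := measure_setOfPred_frequently_eq_zero hsum
  filter_upwards [measure_eq_zero_iff_ae_notMem.1 this] with z hz
  have hz' : ¬ ∃ᶠ n : ℕ in atTop, ‖((mapH η ^ n) z).2 - c‖ ≤ ℓ ^ n := hz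
  rw [not_frequently] at hz'
  exact hz'.mono fun n hn => not_le.1 hn

lemma ae_slowApproach (η : ℝ) {ℓ : ℝ} (h0 : 0 < ℓ) (h1 : ℓ < 1) :
    ∀ᵐ z : Torus, SlowApproach η ℓ z := by
  filter_upwards [ae_offSingular η, ae_eventually_lt η h0 h1 0,
    ae_eventually_lt η h0 h1 ((1 - η : ℝ) : UnitAddCircle)] with z hz e1 e2
  have hoff : ∀ n : ℕ, (mapH η ^ n) z ∉ singularSet η := fun n => (hz.pow n).notMem
  obtain ⟨δ₁, d1, k1⟩ := exists_pos_mul_le h0 h1.le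
    (fun n => norm_pos_iff.2 fun h => hoff n (Or.inl (by simpa using h))) e1
  obtain ⟨δ₂, d2, k2⟩ := exists_pos_mul_le h0 h1.le
    (fun n => norm_pos_iff.2 fun h => hoff n (Or.inr (sub_eq_zero.1 h))) e2
  refine ⟨min δ₁ δ₂, lt_min d1 d2, fun n => ⟨?_, ?_⟩⟩
  · refine (mul_le_mul_of_nonneg_right (min_le_left _ _) (by positivity)).trans ((k1 n).trans_eq ?_)
    simp
  · exact (mul_le_mul_of_nonneg_right (min_le_right _ _) (by positivity)).trans (k2 n)

/-- Almost every point is regular. -/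
theorem Expanding.volume_compl_regularSet {η μ r κ θ : ℝ} (E : Expanding η μ r κ θ) :
    volume (regularSet η)ᶜ = 0 := by
  have hθ := E.one_lt
  have h := ae_slowApproach η (inv_pos.2 (by linarith : 0 < θ)) (inv_lt_one_of_one_lt₀ hθ)
  have h' := measurePreserving_revT.quasiMeasurePreserving.ae h
  rw [← mem_ae_iff]
  filter_upwards [ae_offSingular η, h, h'] with z hz hs hs'
  exact E.mem_regularSet hz hs hs'

end ToralShear


namespace ToralShear

/-! ### Growth of local manifolds and condition (M) -/

/-- Some backward image of `γ` contains a segment centred at `z` in the direction `v`. -/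
def BackwardThrough (η : ℝ) (γ : Set Torus) (z : Torus) (v : Fin 2 → ℝ) : Prop :=
  ∃ (n : ℕ) (ε : ℝ), 0 < ε ∧ seg z v ε ε ⊆ ((mapH η)⁻¹ ^ n : Equiv.Perm Torus) '' γ

lemma backwardThrough_of_seg_subset {η a b c : ℝ} {γ : Set Torus} {z : Torus} {v : Fin 2 → ℝ}
    (ha : 0 < a) (hb : 0 < b) (hc : c ≠ 0) (h : seg z (c • v) a b ⊆ γ) :
    BackwardThrough η γ z v := by
  have hc' : 0 < |c| := abs_pos.2 hc
  refine ⟨0, |c| * min a b, by positivity, ?_⟩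
  rw [pow_zero, Equiv.Perm.coe_one, image_id]
  rintro _ ⟨t, ht, rfl⟩
  have h1 : |t / c| ≤ min a b := by
    rw [abs_div, div_le_iff₀' hc']
    exact abs_le.2 ht
  rw [abs_le] at h1
  refine h ⟨t / c, ⟨?_, h1.2.trans (min_le_right _ _)⟩, ?_⟩
  · linarith [h1.1, min_le_left a b]
  · simp only [smul_smul]
    rw [div_mul_cancel₀ _ hc]

lemma BackwardThrough.of_map {η : ℝ} (hη : 0 < η) (hη1 : η < 1) {γ : Set Torus} {z : Torus}
    (hz : z ∉ singularSet η) {v : Fin 2 → ℝ}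
    (h : BackwardThrough η γ (mapH η z) ((jacH η z).mulVec v)) : BackwardThrough η γ z v := by
  obtain ⟨n, ε, hε, hn⟩ := h
  have d1 : 0 < ‖z.2‖ := norm_pos_iff.2 fun h => hz (Or.inl h)
  have d2 : 0 < ‖z.2 - ((1 - η : ℝ) : UnitAddCircle)‖ :=
    norm_pos_iff.2 fun h => hz (Or.inr (sub_eq_zero.1 h))
  set d := min ‖z.2‖ ‖z.2 - ((1 - η : ℝ) : UnitAddCircle)‖
  have hd : 0 < d := lt_min d1 d2
  have hv : 0 < |v 1| + 1 := by positivity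
  refine ⟨n + 1, min ε (d / (|v 1| + 1)), by positivity, ?_⟩
  rintro _ ⟨t, ht, rfl⟩
  have ht' : |t| ≤ min ε (d / (|v 1| + 1)) := abs_le.2 ht
  have hu : |(t • v) 1| ≤ d := by
    rw [Pi.smul_apply, smul_eq_mul, abs_mul]
    calc |t| * |v 1| ≤ d / (|v 1| + 1) * (|v 1| + 1) :=
          mul_le_mul (ht'.trans (min_le_right _ _)) (by linarith) (abs_nonneg _) (by positivity)
      _ = d := div_mul_cancel₀ _ hv.ne'
  have e := mapH_add_proj hη hη1 hz (hu.trans (min_le_left _ _)) (hu.trans (min_le_right _ _))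
  rw [Matrix.mulVec_smul] at e
  obtain ⟨x, hx, hx'⟩ := hn ⟨t, abs_le.1 (ht'.trans (min_le_left _ _)), e.symm⟩
  refine ⟨x, hx, ?_⟩
  rw [pow_succ', Equiv.Perm.mul_apply, hx']
  simp

lemma BackwardThrough.of_cocycle {η : ℝ} (hη : 0 < η) (hη1 : η < 1) {γ : Set Torus} {z : Torus}
    (hz : OffSingular η z) {v : Fin 2 → ℝ} {j : ℕ} (h : BackwardThrough η γ ((mapH η ^ j) z)
      ((cocycle (mapH η) (jacH η) j z).mulVec v)) : BackwardThrough η γ z v := by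
  induction j with
  | zero => simpa [cocycle] using h
  | succ j ih =>
    refine ih (BackwardThrough.of_map hη hη1 (hz.pow j).notMem ?_)
    rw [pow_succ', Equiv.Perm.mul_apply, cocycle, ← Matrix.mulVec_mulVec] at h
    exact h

/-- The size `d` is small enough that the segment lies over `[0, 1 - η]`, as the starting point of
the growth argument. -/
lemma BackwardThrough.hasLength {η μ r : ℝ} (hμ : 1 < μ) {γ : Set Torus}
    {z : Torus} (hA : InA η z) (hz : z ∉ singularSet η) {w : Fin 2 → ℝ} (hw : VCone μ r w)
    (hw1 : w 1 ≠ 0) (h : BackwardThrough η γ z w) :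
    ∃ L > 0, HasLength η μ r (InBackward η γ) L := by
  obtain ⟨n, ε, hε, hn⟩ := h
  obtain ⟨y, hy, y0, y1⟩ := hA.exists_lift hz
  have e : z = pt y (rep (z.2 - z.1)) := eq_pt_of_snd hy (coe_rep _).symm
  generalize rep (z.2 - z.1) = s at e
  obtain ⟨ρ, h1, h2, h3⟩ := hw
  have hwp : 0 < |w 1| := abs_pos.2 hw1
  set d := min (ε * |w 1|) (min y (1 - η - y))
  have hd : 0 < d := lt_min (by positivity) (lt_min y0 (by linarith))
  have l1 : d ≤ ε * |w 1| := min_le_left _ _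
  have l2 : d ≤ y := (min_le_right _ _).trans (min_le_left _ _)
  have l3 : d ≤ 1 - η - y := (min_le_right _ _).trans (min_le_right _ _)
  refine ⟨(ρ - 1) * (2 * d), mul_pos (by linarith) (by linarith), y - d, s - ρ * d, 2 * d, ρ,
    by linarith, h1, h2, by linarith, by linarith, le_rfl, n, subset_trans ?_ hn⟩
  rintro _ ⟨u, hu, rfl⟩
  have ht : |(2 * u - 1) * d / w 1| ≤ ε := by
    rw [abs_div, div_le_iff₀ hwp, abs_mul, abs_of_pos hd]
    have : |2 * u - 1| ≤ 1 := abs_le.2 ⟨by linarith [hu.1], by linarith [hu.2]⟩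
    nlinarith
  refine ⟨(2 * u - 1) * d / w 1, abs_le.1 ht, ?_⟩
  simp only
  rw [e, pt_add_proj, h3]
  congr 1
  · field_simp; ring
  · field_simp; ring

lemma Expanding.crosses_of_lyapunov_neg {η μ r κ θ : ℝ} (E : Expanding η μ r κ θ)
    (hK : 1 / rateA (1 / (1 - η)) κ + 1 / rateAB (1 / (1 - η)) (1 / η - 2) κ +
      1 / rateABB (1 / (1 - η)) (1 / η - 2) κ < 1) {z : Torus} (hz : OffSingular η z)
    {v : Fin 2 → ℝ} (hv : v ≠ 0) (hneg : lyapunov (mapH η) (jacH η) z v < 0) {a b : ℝ}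
    (ha : 0 < a) (hb : 0 < b) : Crosses η (InBackward η (seg z v a b)) := by
  have hη := E.rates.pos
  have hη' : η < 1 := by linarith [E.rates.lt]
  have hμ : 1 < μ := by linarith [E.rates.lt_μ]
  -- The direction of negative exponent is unique up to scaling, hence it is the image of a cone
  -- vector at an earlier point `z'` of `A`. Pulling the segment back to `z'` gives a cone segment
  -- to be grown.
  obtain ⟨j, z', w, rfl, hA, hz', hw, hcone, hne, C, hC, hdec⟩ := E.exists_stable hz
  obtain ⟨c, hc, rfl⟩ := E.eq_smul_of_lyapunov_neg hne hC hdec hv hneg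
  have h : BackwardThrough η _ z' w := BackwardThrough.of_cocycle hη hη' hz'
    (backwardThrough_of_seg_subset (z := (mapH η ^ j) z')
      (v := (cocycle (mapH η) (jacH η) j z').mulVec w) ha hb hc subset_rfl)
  obtain ⟨L, hL, hlen⟩ := h.hasLength hμ hA hz'.notMem hcone (hcone.snd_ne_zero hw)
  exact hlen.crosses E.rates (segClosed_inBackward hη hη' _) hK hL

/-- Two segments joining opposite sides of a square meet. -/
lemma exists_crossing {h y₀ y₁ s₀ s₁ : ℝ} (hh : 0 < h) (hy : 0 ≤ y₀) (hyy : y₀ ≤ y₁)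
    (hy' : y₁ ≤ h) (hs : 0 ≤ s₀) (hss : s₀ ≤ s₁) (hs' : s₁ ≤ h) :
    ∃ u ∈ Icc (0 : ℝ) 1, ∃ w ∈ Icc (0 : ℝ) 1,
      y₀ + u * (y₁ - y₀) = w * h ∧ u * h = s₀ + w * (s₁ - s₀) := by
  -- The first segment at parameter `u` has horizontal position `w h` with `w = (y₀ + u (y₁ - y₀)) /
  -- h`; the function compares its height with that of the second segment there.
  have hcont : ContinuousOn
      (fun u : ℝ => u * h - s₀ - (y₀ + u * (y₁ - y₀)) / h * (s₁ - s₀)) (Icc 0 1) := by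
    fun_prop
  have w0 : ∀ u ∈ Icc (0 : ℝ) 1, 0 ≤ (y₀ + u * (y₁ - y₀)) / h ∧
      (y₀ + u * (y₁ - y₀)) / h ≤ 1 := by
    intro u hu
    have n1 : 0 ≤ u * (y₁ - y₀) := mul_nonneg hu.1 (by linarith)
    have n2 : u * (y₁ - y₀) ≤ 1 * (y₁ - y₀) := mul_le_mul_of_nonneg_right hu.2 (by linarith)
    exact ⟨div_nonneg (by linarith) hh.le, by rw [div_le_one hh]; linarith⟩
  have hmem : (0 : ℝ) ∈ Icc (0 * h - s₀ - (y₀ + 0 * (y₁ - y₀)) / h * (s₁ - s₀))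
      (1 * h - s₀ - (y₀ + 1 * (y₁ - y₀)) / h * (s₁ - s₀)) := by
    have a0 := w0 0 (by simp)
    have a1 := w0 1 (by simp)
    constructor
    · nlinarith [mul_nonneg a0.1 (sub_nonneg.2 hss)]
    · nlinarith [mul_le_mul_of_nonneg_right a1.2 (sub_nonneg.2 hss)]
  obtain ⟨u, hu, e⟩ := intermediate_value_Icc zero_le_one hcont hmem
  refine ⟨u, hu, _, w0 u hu, (div_mul_cancel₀ _ hh.ne').symm, ?_⟩
  simp only at e
  linarith

theorem Expanding.conditionM {η μ r κ θ : ℝ} (E : Expanding η μ r κ θ)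
    (hK : 1 / rateA (1 / (1 - η)) κ + 1 / rateAB (1 / (1 - η)) (1 / η - 2) κ +
      1 / rateABB (1 / (1 - η)) (1 / η - 2) κ < 1) : ConditionM η := by
  rintro z ⟨hz, -⟩ z' ⟨hz', -⟩ _ _ ⟨⟨v, a, b, hv, hneg, ha, hb, rfl⟩, -⟩
    ⟨⟨v', a', b', hv', hneg', ha', hb', rfl⟩, -⟩
  have hη : 0 < 1 - η := by linarith [E.rates.lt]
  have hz : OffSingular η z := hz
  obtain ⟨y₀, y₁, p1, p2, p3, n, hn⟩ := E.crosses_of_lyapunov_neg hK hz' hv' hneg' ha' hb'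
  obtain ⟨j, x, w, -, -, -, -, -, hw, C, hC, hdec⟩ := E.exists_stable hz.revT
  have hneg2 : lyapunov (mapH η) (jacH η) (revT z) (revM.mulVec v) < 0 := by
    rcases E.lyapunov_inv_dichotomy hw hC hdec hv with h | h
    · exact h.2
    · exact absurd hneg h.1.not_gt
  -- The reflection of the unstable segment is a stable segment at `revT z`. A backward image of it
  -- crosses from bottom to top; reflected back, this is a forward image of the unstable segment
  -- crossing from left to right.
  obtain ⟨s₀, s₁, q1, q2, q3, m, hm⟩ :=
    E.crosses_of_lyapunov_neg hK hz.revT (revM_mulVec_ne_zero hv) hneg2 ha hb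
  obtain ⟨u, hu, t, ht, e1, e2⟩ := exists_crossing hη p1 p2 p3 q1 q2 q3
  refine ⟨m, n, pt (y₀ + u * (y₁ - y₀)) (u * (1 - η)), ?_, hn ⟨u, hu, ?_⟩⟩
  · obtain ⟨x, hx, hx'⟩ := hm ⟨t, ht, rfl⟩
    rw [← revT_image_seg] at hx
    obtain ⟨x, hx, rfl⟩ := hx
    refine ⟨x, hx, ?_⟩
    rw [mapH_inv_pow_apply, revT_revT] at hx'
    have := congrArg revT hx'
    rw [revT_revT] at this
    rw [this, revT_pt, e1, e2]
    congr 1; ring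
  · simp only
    congr 1; ring

end ToralShear

theorem mainTheorem1 :
    |ToralShear.eta1 - 0.324| < 0.0005 ∧
    ∀ η : ℝ, 0 < η → η < ToralShear.eta1 →
      MeasureTheory.volume (ToralShear.regularSet η)ᶜ = 0 ∧ ToralShear.ConditionM η := by
  obtain ⟨h1, h2⟩ := ToralShear.eta1_bounds
  refine ⟨abs_lt.2 ⟨by linarith, by linarith⟩, fun η h0 hη => ?_⟩
  obtain ⟨μ, r, κ, P, hK⟩ := ToralShear.exists_rates h0 hη
  obtain ⟨θ, hθ, hA, hB, hC⟩ :=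
    ToralShear.exists_theta P.rateA_pos P.rateAB_pos P.rateABB_pos hK
  have E : ToralShear.Expanding η μ r κ θ := ⟨P, hθ, hA, hB, hC⟩
  exact ⟨E.volume_compl_regularSet, E.conditionM hK⟩
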